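/- A vehicle stands at the origin, on the mid line of a road of half-width $W>0$. The positions along the road of the base stations (BSs) form a homogeneous Poisson point process on $\mathbb R$ of density $\lambda_b>0$; a BS at position $x$ has distance $\sqrt{x^2+W^2}$ from the vehicle. Independently of everything else, a BS at position $x$ is in line of sight (state $L$) with probability $p_L(|x|)$ and otherwise in state $N$, with probability $p_N=1-p_L$. Here $p_L(x)=e^{-\lambda_o\tau_o}$ in the rural scenario $s=R$ ($\lambda_o,\tau_o\ge0$) and $p_L(x)=e^{-a_{\rm LOS}x}$ in the urban scenario $s=U$ ($a_{\rm LOS}\ge0$). Let $\Phi_L,\Phi_N$ be the sets of BSs in the two states, and for $i\in\{L,N\}$ let $i^*$ be the other state. A BS of state $i$ at distance $r$ has path loss component $\ell_i(r)=C_ir^{-\alpha_i}$, with $C_i>0$ and $\alpha_i>1$. The power fading coefficients $|h_k|^2$ of the BSs are i.i.d. exponential of rate $\mu>0$ (mean $1/\mu$). The antenna gain to the serving BS is $\Delta_1=G_bG_{\rm VN}$, and the gains $\Delta_{I_k}$ of the interfering BSs are i.i.d., equal to $G_bG_{\rm VN}$ with probability $\theta_b/\pi$ and to $g_bg_{\rm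 VN}$ with probability $1-\theta_b/\pi$, where $0\le\theta_b\le\pi$, $G_b,G_{\rm VN}>0$ and $g_b,g_{\rm VN}\ge0$. Positions, states, fading and gains are independent, except that the state of a BS depends on its position as described. The vehicle is served by the BS $n^*$ with the largest path loss component, and, if $n^*\in\Phi_i$ has distance $r_1$ and fading coefficient $|h_1|^2$, $$\mathrm{SINR}=\frac{|h_1|^2\Delta_1\ell_i(r_1)}{I_L+I_N+\sigma^2},\qquad I_j=\sum_{k\in\Phi_j,\ k\ne n^*}|h_k|^2\Delta_{I_k}\ell_j(r_k),$$ where $r_k$ is the distance of BS $k$ and $\sigma^2>0$ is the noise power. Put $b(r)=\sqrt{\max(r^2-W^2,0)}$, $A_i(r)=\big(\tfrac{C_{i^*}}{C_i}r^{\alpha_i}\big)^{1/\alpha_{i^*}}$ and, for $r>W$, $$f_i(r)=\frac{\partial}{\partial r}\Big(1-e^{-2\lambda_b\int_0^{b(r)}p_i(x)\,dx}\Big),\qquad \bar f_i(r)=e^{-2\lambda_b\int_0^{b(A_i(r))}p_{i^*}(x)\,dx}\,f_i(r).$$ **Theorem.** For every $\Gamma>0$, the coverage probability $P_{cov}(\Gamma)=\mathbb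 P[\mathrm{SINR}>\Gamma]$ is $$P_{cov}(\Gamma)=\sum_{i\in\{L,N\}}\int_W^\infty \exp\Big(\frac{-\mu\sigma^2\Gamma r^{\alpha_i}}{\Delta_1C_i}\Big)\,\mathcal L_{I_i^L}\Big(\frac{\mu\Gamma r^{\alpha_i}}{\Delta_1C_i}\Big)\,\mathcal L_{I_i^N}\Big(\frac{\mu\Gamma r^{\alpha_i}}{\Delta_1C_i}\Big)\,\bar f_i(r)\,dr,$$ with integrable integrands. Here, for $t\ge0$, $\mathcal L_{I_i^j}(t)=\mathbb E\big[e^{-tI_j}\,\big|\,n^*\in\Phi_i,\ r_1=r\big]$ is the Laplace functional of the interference from the BSs in $\Phi_j$ when the vehicle is served by a BS of $\Phi_i$ at distance $r$, and it equals, for almost every $r$ (with respect to the law of $r_1$ on the event $n^*\in\Phi_i$), $$\mathcal L_{I_i^j}(t)=\exp\Big(-2\lambda_b\int_{b(\rho)}^\infty\Big[1-\frac{\theta_b}{\pi}\,\frac{\mu}{\mu+tG_bG_{\rm VN}C_jv_x^{-\alpha_j}}-\Big(1-\frac{\theta_b}{\pi}\Big)\frac{\mu}{\mu+tg_bg_{\rm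 VN}C_jv_x^{-\alpha_j}}\Big]p_j(x)\,dx\Big),$$ where $v_x=\sqrt{x^2+W^2}$, and $\rho=r$ if $j=i$, $\rho=A_i(r)$ if $j\ne i$. -/

import Mathlib

open MeasureTheory ProbabilityTheory Set
open scoped ENNReal NNReal

noncomputable section

/-- Propagation state of a link: line of sight (`los`) or not (`nlos`). -/
inductive LinkState where
  | los : LinkState
  | nlos : LinkState
  deriving DecidableEq

instance : Fintype LinkState := ⟨{.los, .nlos}, fun i => by cases i <;> simp⟩

instance : MeasurableSpace LinkState := ⊤

/-- The state other than `i`. -/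
def LinkState.other : LinkState → LinkState
  | .los => .nlos
  | .nlos => .los

/-- The two highway scenarios. `rural lo tau`: obstacles of density `lo` and length `tau`;
`urban a`: LOS probability decaying at rate `a`. -/
inductive Scenario where
  | rural (lo tau : ℝ≥0) : Scenario
  | urban (a : ℝ≥0) : Scenario

/-- Probability that a base station at offset `x ≥ 0` along the road (measured from the vehicle)
is in LOS. -/
def Scenario.losProb : Scenario → ℝ → ℝ
  | .rural lo tau, _ => Real.exp (-((lo : ℝ) * tau))
  | .urban a, x => Real.exp (-((a : ℝ) * x))

/-- Probability `p_i(x)` that a base station at offset `x ≥ 0` along the road is in state `i`. -/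
def Scenario.prob (s : Scenario) : LinkState → ℝ → ℝ
  | .los, x => s.losProb x
  | .nlos, x => 1 - s.losProb x

/-- Numerical parameters of the network. -/
structure Params where
  /-- propagation scenario -/
  scenario : Scenario
  /-- half-width of the road -/
  W : ℝ
  W_pos : 0 < W
  /-- density of base stations -/
  lamb : ℝ
  lamb_pos : 0 < lamb
  /-- Rayleigh fading parameter: the power fading is exponential of rate `mu` -/
  mu : ℝ
  mu_pos : 0 < mu
  /-- thermal noise power `σ²` -/
  noise : ℝ
  noise_pos : 0 < noise
  /-- path loss exponents -/
  alpha : LinkState → ℝ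
  one_lt_alpha : ∀ i, 1 < alpha i
  /-- path loss gains at unit distance -/
  C : LinkState → ℝ
  C_pos : ∀ i, 0 < C i
  /-- main lobe gain of the base stations -/
  Gb : ℝ
  Gb_pos : 0 < Gb
  /-- main lobe gain of the vehicle -/
  Gv : ℝ
  Gv_pos : 0 < Gv
  /-- side lobe gain of the base stations -/
  gb : ℝ
  gb_nonneg : 0 ≤ gb
  /-- side lobe gain of the vehicle -/
  gv : ℝ
  gv_nonneg : 0 ≤ gv
  /-- half beamwidth of the aggregate antenna pattern -/
  theta : ℝ
  theta_nonneg : 0 ≤ theta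
  theta_le_pi : theta ≤ Real.pi

namespace Params

variable (p : Params)

/-- Antenna gain `Δ₁` under perfect beam alignment. -/
def Delta1 : ℝ := p.Gb * p.Gv

/-- Path loss component `ℓ_i(r) = C_i r ^ (-α_i)`. -/
def pathLoss (i : LinkState) (r : ℝ) : ℝ := p.C i * r ^ (-p.alpha i)

/-- Distance from the vehicle, at the origin, to a base station `(x, ±W)` at either side of the
road. -/
def dist (x : ℝ) : ℝ := √(x ^ 2 + p.W ^ 2)

/-- Offset along the road of a base station at distance `r` (`0` if `r ≤ W`). -/
def b (r : ℝ) : ℝ := √(r ^ 2 - p.W ^ 2)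

/-- Law of the antenna gain of an interfering link. -/
def gainLaw : Measure ℝ :=
  ENNReal.ofReal (p.theta / Real.pi) • Measure.dirac (p.Gb * p.Gv) +
    ENNReal.ofReal (1 - p.theta / Real.pi) • Measure.dirac (p.gb * p.gv)

/-- The distance beyond which base stations of the other state have a larger path loss than one of
state `i` at distance `r`. -/
def A (i : LinkState) (r : ℝ) : ℝ :=
  (p.C i.other / p.C i * r ^ p.alpha i) ^ (1 / p.alpha i.other)

/-- `exp (-2 λ_b ∫_0^{b(r)} p_i)`: the probability of no base station of state `i` within
distance `r`. -/
def voidProb (i : LinkState) (r : ℝ) : ℝ :=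
  Real.exp (-(2 * p.lamb * ∫ x in (0 : ℝ)..p.b r, p.scenario.prob i x))

/-- Density `f_i` of the distance to the nearest base station of state `i`. -/
def f (i : LinkState) (r : ℝ) : ℝ := deriv (fun r' => 1 - p.voidProb i r') r

/-- Density `f̄_i` of the distance to the serving base station, on the event that the latter has
state `i`. -/
def fbar (i : LinkState) (r : ℝ) : ℝ := p.voidProb i.other (p.A i r) * p.f i r

/-- Minimal distance of the interferers of state `j` when the vehicle is served by a base station
of state `i` at distance `r`. -/
def exclusion (i j : LinkState) (r : ℝ) : ℝ := if j = i then r else p.A i r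

/-- The explicit Laplace functional, at `t`, of the interference from the base stations of
state `j` when the vehicle is served by a base station of state `i` at distance `r`. -/
def laplace (i j : LinkState) (r t : ℝ) : ℝ :=
  Real.exp (-(2 * p.lamb * ∫ x in Ioi (p.b (p.exclusion i j r)),
    (1 - (p.theta / Real.pi) *
          (p.mu / (p.mu + t * (p.Gb * p.Gv) * p.pathLoss j (p.dist x)))
       - (1 - p.theta / Real.pi) *
          (p.mu / (p.mu + t * (p.gb * p.gv) * p.pathLoss j (p.dist x))))
      * p.scenario.prob j x))

/-- The argument `μ Γ r ^ α_i / (Δ₁ C_i)`. -/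
def laplaceArg (i : LinkState) (Γ r : ℝ) : ℝ :=
  p.mu * Γ * r ^ p.alpha i / (p.Delta1 * p.C i)

/-- The integrand of the coverage probability. -/
def covIntegrand (i : LinkState) (Γ r : ℝ) : ℝ :=
  Real.exp (-p.mu * p.noise * Γ * r ^ p.alpha i / (p.Delta1 * p.C i)) *
    p.laplace i .los r (p.laplaceArg i Γ r) *
    p.laplace i .nlos r (p.laplaceArg i Γ r) *
    p.fbar i r

end Params

/-- The points `X 0, X 1, …` form a homogeneous Poisson point process on `ℝ` of density `lamb`:
the number of points in a Borel set `B` of finite length is Poisson with mean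
`lamb * length B`, and the numbers of points in disjoint such sets are independent. -/
structure IsPoissonProcess {Ω : Type*} [MeasurableSpace Ω] (P : Measure Ω) (lamb : ℝ)
    (X : ℕ → Ω → ℝ) : Prop where
  measurable : ∀ n, Measurable (X n)
  count_law : ∀ B : Set ℝ, MeasurableSet B → volume B ≠ ∞ →
    P.map (fun ω => {n | X n ω ∈ B}.encard) =
      (poissonMeasure (lamb * volume.real B).toNNReal).map (fun k : ℕ => (k : ℕ∞))
  count_indep : ∀ (m : ℕ) (B : Fin m → Set ℝ),
    (∀ k, MeasurableSet (B k)) → (∀ k, volume (B k) ≠ ∞) →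
    Pairwise (fun k l => Disjoint (B k) (B l)) →
    iIndepFun (fun k ω => {n | X n ω ∈ B k}.encard) P

/-- A realization of the network. `X n` is the position along the road of the `n`-th base station;
`U n` (uniform on `[0,1]`) decides its state by independent thinning, `h n` is its power fading
and `D n` its antenna gain when it interferes. The base stations form a Poisson process, and the
marks `(U n, h n, D n)` are i.i.d., have independent components and are independent of the
positions. -/
structure IsNetwork {Ω : Type*} [MeasurableSpace Ω] (P : Measure Ω) (p : Params)
    (X U h D : ℕ → Ω → ℝ) : Prop where
  poisson : IsPoissonProcess P p.lamb X
  measurable_U : ∀ n, Measurable (U n)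
  measurable_h : ∀ n, Measurable (h n)
  measurable_D : ∀ n, Measurable (D n)
  mark_law : ∀ n, P.map (fun ω => (U n ω, h n ω, D n ω)) =
    (volume.restrict (Icc (0 : ℝ) 1)).prod ((expMeasure p.mu).prod p.gainLaw)
  mark_indep : iIndepFun (fun n ω => (U n ω, h n ω, D n ω)) P
  indep : IndepFun (fun ω n => X n ω) (fun ω n => (U n ω, h n ω, D n ω)) P

namespace Params

variable {Ω : Type*} (p : Params) (X U h D : ℕ → Ω → ℝ)

/-- State of the `n`-th base station: LOS with probability `p_L(|X n|)`, independently. -/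
def state (n : ℕ) (ω : Ω) : LinkState :=
  if U n ω ≤ p.scenario.losProb |X n ω| then .los else .nlos

/-- Average received power (path loss component) of the `n`-th base station. -/
def avgPower (n : ℕ) (ω : Ω) : ℝ := p.pathLoss (p.state X U n ω) (p.dist (X n ω))

/-- Index `n*` of the serving base station, the one of maximal average received power (the first
one, should several be maximal, which has probability zero). -/
def serving (ω : Ω) : ℕ := sInf {n | ∀ m, p.avgPower X U m ω ≤ p.avgPower X U n ω}

/-- State of the serving base station. -/
def servingState (ω : Ω) : LinkState := p.state X U (p.serving X U ω) ω

/-- Distance to the serving base station. -/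
def servingDist (ω : Ω) : ℝ := p.dist (X (p.serving X U ω) ω)

/-- Interference `I_j` from all base stations of state `j` other than the serving one. -/
def interference (j : LinkState) (ω : Ω) : ℝ≥0∞ :=
  ∑' n, if n ≠ p.serving X U ω ∧ p.state X U n ω = j then
    ENNReal.ofReal (h n ω * D n ω * p.avgPower X U n ω) else 0

/-- Signal-to-interference-plus-noise ratio at the vehicle. -/
def sinr (ω : Ω) : ℝ≥0∞ :=
  ENNReal.ofReal (h (p.serving X U ω) ω * p.Delta1 * p.avgPower X U (p.serving X U ω) ω) /
    (p.interference X U h D .los ω + p.interference X U h D .nlos ω + ENNReal.ofReal p.noise)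

/-- The σ-algebra generated by the state and the distance of the serving base station. -/
@[reducible]
def servingSigma : MeasurableSpace Ω :=
  MeasurableSpace.comap (fun ω => (p.servingState X U ω, p.servingDist X U ω)) inferInstance

end Params

end

/-!
The base stations, each carrying its position and its marks (the variable deciding its state, its
fading and its gain), form a Poisson process on `ℝ × ℝ × ℝ × ℝ`. Everything about the process is
read off its Laplace functional `E exp (-∑ f) = exp (-∫ (1 - exp (-f)) dΛ)`, which follows from the
law of the counts by complete independence and monotone approximation
(`IsPoissonProcess.laplace`) and passes to the marked process by averaging over the marks
(`HasPoissonLaplace.prodMk`). To be free of side conditions, exponents take values in `[0, ∞]`; the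
value `∞` turns `exp (-∑ f)` into the indicator of a void region.

The serving station minimizes the inverse path loss `T`. The central fact is
`HasPoissonLaplace.lintegral_first`: the minimizer of `T` has intensity `Λ`, weighted by the
probability that no point has a smaller value of `T`, and the remaining points are Poisson beyond
it. It is proved without Palm theory. For a small cell `B` of a partition of the range of `T`, the
event that `B` contains exactly one point, jointly with the points outside `B`, is the coefficient
of `s` in a probability generating function (`HasPoissonLaplace.lintegral_unique_mem`); summing over
the cells and refining the partition gives the formula, since almost surely no two points have the
same value of `T` (`HasPoissonLaplace.ae_injective_comp`).

For the network, a station of state `j` beats one of state `i` at distance `r` exactly if it is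
closer than `exclusion i j r`. The exponent in `lintegral_first` therefore splits, state by state,
into a void probability and a Laplace functional of the interference from beyond that distance
(`Params.expNeg_barrier`). Two applications finish the proof. With a constant argument `t` and the
interference from one state, division by the same formula without interference identifies the
conditional Laplace functional (`IsNetwork.condExp_laplace`). For the coverage probability, the
exponential fading of the serving station is independent of all else and turns the event
`Γ < SINR` into `exp (-q (I + σ²))`, `q` being a function of the path loss of the serving station
(`IsNetwork.measure_coverage_eq`); the substitution `x = b r` then produces the densities `f_i`.
Integrability of the integrands, which are nonnegative, comes with the same identity, as the
integrals add up to a probability.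
-/

noncomputable section

/-! ### The function `a ↦ exp (-a)` on `[0, ∞]` -/

/-- The function `a ↦ exp (-a)` from `[0, ∞]` to `[0, 1]`, with `exp (-∞) = 0`. Exponentials of
infinite sums and of integrals that may diverge can then be written without side conditions, and
the value `∞` encodes the indicator of an event as the exponential of a sum over the points. -/
def expNeg (a : ℝ≥0∞) : ℝ≥0∞ := EReal.exp (-(a : EReal))

@[simp] lemma expNeg_zero : expNeg 0 = 1 := by simp [expNeg]

@[simp] lemma expNeg_top : expNeg ∞ = 0 := by simp [expNeg]

lemma expNeg_add (a b : ℝ≥0∞) : expNeg (a + b) = expNeg a * expNeg b := by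
  rw [expNeg, expNeg, expNeg, ← EReal.exp_add, EReal.coe_ennreal_add, EReal.neg_add]
  · rfl
  · exact Or.inl (EReal.coe_ennreal_ne_bot a)
  · exact Or.inr (EReal.coe_ennreal_ne_bot b)

lemma expNeg_ofReal {x : ℝ} (hx : 0 ≤ x) :
    expNeg (ENNReal.ofReal x) = ENNReal.ofReal (Real.exp (-x)) := by
  rw [expNeg, EReal.coe_ennreal_ofReal, max_eq_left hx, ← EReal.coe_neg, EReal.exp_coe]

lemma expNeg_eq_ofReal {a : ℝ≥0∞} (ha : a ≠ ∞) :
    expNeg a = ENNReal.ofReal (Real.exp (-a.toReal)) := by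
  conv_lhs => rw [← ENNReal.ofReal_toReal ha]
  exact expNeg_ofReal ENNReal.toReal_nonneg

lemma continuous_expNeg : Continuous expNeg :=
  ENNReal.continuous_exp.comp (continuous_neg.comp continuous_coe_ennreal_ereal)

lemma antitone_expNeg : Antitone expNeg := fun _ _ h =>
  EReal.exp_monotone (EReal.neg_le_neg_iff.2 (EReal.coe_ennreal_le_coe_ennreal_iff.2 h))

lemma expNeg_le_one (a : ℝ≥0∞) : expNeg a ≤ 1 := by
  simpa using antitone_expNeg (zero_le (a := a))

lemma expNeg_ne_top (a : ℝ≥0∞) : expNeg a ≠ ∞ := ne_top_of_le_ne_top ENNReal.one_ne_top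
  (expNeg_le_one a)

lemma measurable_expNeg : Measurable expNeg := continuous_expNeg.measurable

@[fun_prop]
lemma Measurable.expNeg {α : Type*} [MeasurableSpace α] {f : α → ℝ≥0∞} (hf : Measurable f) :
    Measurable fun x => expNeg (f x) := measurable_expNeg.comp hf

lemma one_sub_expNeg_le (a : ℝ≥0∞) : 1 - expNeg a ≤ a := by
  rcases eq_or_ne a ∞ with rfl | ha
  · simp
  rw [expNeg_eq_ofReal ha, ← ENNReal.ofReal_one, ← ENNReal.ofReal_sub _ (Real.exp_pos _).le]
  refine ENNReal.ofReal_le_of_le_toReal ?_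
  linarith [Real.add_one_le_exp (-a.toReal)]

lemma expNeg_sum {ι : Type*} (s : Finset ι) (f : ι → ℝ≥0∞) :
    expNeg (∑ i ∈ s, f i) = ∏ i ∈ s, expNeg (f i) := by
  classical
  induction s using Finset.induction_on with
  | empty => simp
  | insert a s ha ih => rw [Finset.sum_insert ha, Finset.prod_insert ha, expNeg_add, ih]

lemma expNeg_nat_mul (n : ℕ) (a : ℝ≥0∞) : expNeg (n * a) = expNeg a ^ n := by
  have := expNeg_sum (Finset.range n) (fun _ => a)
  simpa using this

/-- The inverse `a ↦ -log a` of `expNeg` on `[0, 1]`. -/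
def negLog (a : ℝ≥0∞) : ℝ≥0∞ := (-(ENNReal.log a)).toENNReal

lemma expNeg_negLog {a : ℝ≥0∞} (ha : a ≤ 1) : expNeg (negLog a) = a := by
  have h : 0 ≤ -(ENNReal.log a) := by
    rw [EReal.le_neg, neg_zero]
    exact ENNReal.log_le_zero_iff.2 ha
  rw [negLog, expNeg, EReal.coe_toENNReal h, neg_neg, ENNReal.exp_log]

lemma measurable_negLog : Measurable negLog :=
  measurable_ereal_toENNReal.comp
    (continuous_neg.comp ENNReal.continuous_log).measurable

/-- Bounded convergence for exponentials `exp (-S)` under a probability measure. -/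
lemma tendsto_lintegral_expNeg {Ω : Type*} [MeasurableSpace Ω] {P : Measure Ω}
    [IsProbabilityMeasure P] {S : ℕ → Ω → ℝ≥0∞} {S' : Ω → ℝ≥0∞} (hS : ∀ k, Measurable (S k))
    (h : ∀ᵐ ω ∂P, Filter.Tendsto (fun k => S k ω) Filter.atTop (nhds (S' ω))) :
    Filter.Tendsto (fun k => ∫⁻ ω, expNeg (S k ω) ∂P) Filter.atTop
      (nhds (∫⁻ ω, expNeg (S' ω) ∂P)) := by
  refine tendsto_lintegral_of_dominated_convergence (fun _ => 1) (fun k => (hS k).expNeg)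
    (fun k => Filter.Eventually.of_forall fun ω => expNeg_le_one _) (by simp) ?_
  filter_upwards [h] with ω hω
  exact (continuous_expNeg.tendsto _).comp hω

/-! ### Laplace functional of a Poisson process on the line -/

lemma lintegral_pow_poissonMeasure (m : ℝ≥0) {s : ℝ≥0} (hs : s ≤ 1) :
    ∫⁻ k, (s : ℝ≥0∞) ^ k ∂(poissonMeasure m) = expNeg (m * (1 - s)) := by
  have key : HasSum (fun n : ℕ => Real.exp (-m) * (m * s : ℝ) ^ n / n.factorial)
      (Real.exp (-(m * (1 - s)))) := by
    have h := (hasSum_one_poissonMeasure (m * s)).mul_left (Real.exp (-(m * (1 - s))))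
    rw [mul_one] at h
    refine (funext fun n => ?_ :
      (fun n : ℕ => Real.exp (-m) * (m * s : ℝ) ^ n / n.factorial) = _) ▸ h
    rw [NNReal.coe_mul, mul_div_assoc, mul_div_assoc, ← mul_assoc, ← Real.exp_add]
    congr 2
    ring
  have h1 : (m : ℝ≥0∞) * (1 - s) = ENNReal.ofReal (m * (1 - s)) := by
    rw [ENNReal.ofReal_mul NNReal.zero_le_coe, ENNReal.ofReal_sub _ NNReal.zero_le_coe]
    simp
  rw [lintegral_countable', h1,
    expNeg_ofReal (x := m * (1 - s)) (mul_nonneg NNReal.zero_le_coe (sub_nonneg.2 hs)),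
    ← key.tsum_eq, ENNReal.ofReal_tsum_of_nonneg (fun n => by positivity) key.summable]
  refine tsum_congr fun n => ?_
  rw [poissonMeasure_singleton]
  have : (s : ℝ≥0∞) ^ n = ENNReal.ofReal ((s : ℝ) ^ n) := by
    rw [ENNReal.ofReal_pow NNReal.zero_le_coe]; simp
  rw [this, ← ENNReal.ofReal_mul (by positivity)]
  congr 1
  rw [mul_pow]; ring

lemma tsum_indicator_const_eq_encard (A : Set ℕ) (c : ℝ≥0∞) :
    ∑' n, A.indicator (fun _ => c) n = (A.encard : ℝ≥0∞) * c := by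
  rw [← tsum_subtype, ENNReal.tsum_set_const]

namespace IsPoissonProcess

variable {Ω : Type*} [MeasurableSpace Ω] {P : Measure Ω} {lamb : ℝ} {X : ℕ → Ω → ℝ}

lemma measurable_count (hX : IsPoissonProcess P lamb X) {B : Set ℝ} (hB : MeasurableSet B) :
    Measurable fun ω => {n | X n ω ∈ B}.encard :=
  measurable_encard.comp (measurable_set_iff.2 fun n => measurable_mem.2 (hX.measurable n hB))

lemma lintegral_expNeg_count [IsProbabilityMeasure P] (hX : IsPoissonProcess P lamb X)
    {B : Set ℝ} (hB : MeasurableSet B) (hvol : volume B ≠ ∞) (c : ℝ≥0∞) :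
    ∫⁻ ω, expNeg (({n | X n ω ∈ B}.encard : ℝ≥0∞) * c) ∂P =
      expNeg (ENNReal.ofReal lamb * volume B * (1 - expNeg c)) := by
  have hm : Measurable fun k : ℕ∞ => expNeg ((k : ℝ≥0∞) * c) := Measurable.of_discrete
  rw [← lintegral_map hm (hX.measurable_count hB), hX.count_law B hB hvol,
    lintegral_map hm Measurable.of_discrete]
  lift expNeg c to ℝ≥0 using expNeg_ne_top c with s hs
  have hs1 : s ≤ 1 := by
    have := expNeg_le_one c
    rw [← hs] at this
    exact_mod_cast this
  have hl : ((lamb * volume.real B).toNNReal : ℝ≥0∞) = ENNReal.ofReal lamb * volume B := by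
    change ENNReal.ofReal (lamb * volume.real B) = _
    rw [ENNReal.ofReal_mul' measureReal_nonneg, ofReal_measureReal hvol]
  rw [← hl, ← lintegral_pow_poissonMeasure _ hs1]
  refine lintegral_congr fun k => ?_
  rw [hs, ← expNeg_nat_mul]
  simp

/-- The Laplace functional at a function with finitely many values: by complete independence it
factorizes over the level sets. -/
lemma laplace_sum_indicator [IsProbabilityMeasure P] (hX : IsPoissonProcess P lamb X) {m : ℕ}
    {B : Fin m → Set ℝ} (hB : ∀ k, MeasurableSet (B k)) (hvol : ∀ k, volume (B k) ≠ ∞)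
    (hd : Pairwise fun k l => Disjoint (B k) (B l)) (c : Fin m → ℝ≥0∞) :
    ∫⁻ ω, expNeg (∑' n, ∑ k, (B k).indicator (fun _ => c k) (X n ω)) ∂P =
      expNeg (∫⁻ x, 1 - expNeg (∑ k, (B k).indicator (fun _ => c k) x)
        ∂(ENNReal.ofReal lamb • volume)) := by
  have h1 : ∀ ω, ∑' n, ∑ k, (B k).indicator (fun _ => c k) (X n ω) =
      ∑ k, ({n | X n ω ∈ B k}.encard : ℝ≥0∞) * c k := fun ω => by
    rw [Summable.tsum_finsetSum fun k _ => ENNReal.summable]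
    refine Finset.sum_congr rfl fun k _ => ?_
    rw [← tsum_indicator_const_eq_encard]
    rfl
  have h2 : ∀ x, 1 - expNeg (∑ k, (B k).indicator (fun _ => c k) x) =
      ∑ k, (B k).indicator (fun _ => 1 - expNeg (c k)) x := fun x => by
    by_cases hx : ∃ k, x ∈ B k
    · obtain ⟨k, hk⟩ := hx
      have hne : ∀ l, l ≠ k → x ∉ B l := fun l hl hxl =>
        (Set.disjoint_left.1 (hd hl) hxl) hk
      rw [Finset.sum_eq_single_of_mem k (Finset.mem_univ _)
        (fun l _ hl => Set.indicator_of_notMem (hne l hl) _),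
        Finset.sum_eq_single_of_mem k (Finset.mem_univ _)
        (fun l _ hl => Set.indicator_of_notMem (hne l hl) _)]
      simp [hk]
    · push Not at hx
      simp [hx]
  simp_rw [h1, h2, expNeg_sum]
  have hind := (hX.count_indep m B hB hvol hd).comp
    (fun k (a : ℕ∞) => expNeg ((a : ℝ≥0∞) * c k)) (fun k => Measurable.of_discrete)
  have := lintegral_prod_eq_prod_lintegral_of_indepFun Finset.univ _ hind
    (fun k => Measurable.of_discrete.comp (hX.measurable_count (hB k)))
  simp only [Function.comp_def] at this
  rw [this, lintegral_finsetSum _ (fun k _ => measurable_const.indicator (hB k)), expNeg_sum]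
  refine Finset.prod_congr rfl fun k _ => ?_
  rw [hX.lintegral_expNeg_count (hB k) (hvol k), lintegral_indicator (hB k), setLIntegral_const,
    Measure.smul_apply, smul_eq_mul, mul_comm]

lemma laplace_simpleFunc [IsProbabilityMeasure P] (hX : IsPoissonProcess P lamb X)
    (φ : SimpleFunc ℝ ℝ≥0∞) {K : Set ℝ} (hK : volume K ≠ ∞) (hφ : ∀ x ∉ K, φ x = 0) :
    ∫⁻ ω, expNeg (∑' n, φ (X n ω)) ∂P =
      expNeg (∫⁻ x, 1 - expNeg (φ x) ∂(ENNReal.ofReal lamb • volume)) := by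
  classical
  let S : Finset ℝ≥0∞ := φ.range.filter (· ≠ 0)
  let e := S.equivFin
  have hsum : ∀ x, φ x = ∑ k, (φ ⁻¹' {(e.symm k : ℝ≥0∞)}).indicator
      (fun _ => (e.symm k : ℝ≥0∞)) x := fun x => by
    rw [Equiv.sum_comp e.symm (fun c : S => (φ ⁻¹' {(c : ℝ≥0∞)}).indicator
      (fun _ => (c : ℝ≥0∞)) x),
      Finset.sum_coe_sort S (fun c => (φ ⁻¹' {c}).indicator (fun _ => c) x)]
    simp only [Set.indicator_apply, Set.mem_preimage, Set.mem_singleton_iff,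
      Finset.sum_ite_eq, S, Finset.mem_filter, SimpleFunc.mem_range_self, true_and]
    by_cases h : φ x = 0 <;> simp [h]
  have := hX.laplace_sum_indicator (B := fun k => φ ⁻¹' {(e.symm k : ℝ≥0∞)})
    (fun k => φ.measurableSet_preimage _) (fun k => ?_) (fun k l hkl => ?_)
    (fun k => (e.symm k : ℝ≥0∞))
  · simpa only [← hsum] using this
  · refine ne_top_of_le_ne_top hK (measure_mono fun x hx => ?_)
    by_contra hxK
    have h0 : (e.symm k : ℝ≥0∞) ≠ 0 := (Finset.mem_filter.1 (e.symm k).2).2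
    exact h0 (hx.symm.trans (hφ x hxK))
  · refine Set.disjoint_left.2 fun x hx hx' => hkl ?_
    exact e.symm.injective (Subtype.ext (hx.symm.trans hx'))

/-- The Laplace functional of a Poisson process,
`E exp (-∑ f (X n)) = exp (-λ ∫ (1 - exp (-f)))`. -/
theorem laplace [IsProbabilityMeasure P] (hX : IsPoissonProcess P lamb X) {f : ℝ → ℝ≥0∞}
    (hf : Measurable f) :
    ∫⁻ ω, expNeg (∑' n, f (X n ω)) ∂P =
      expNeg (∫⁻ x, 1 - expNeg (f x) ∂(ENNReal.ofReal lamb • volume)) := by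
  let φ : ℕ → SimpleFunc ℝ ℝ≥0∞ := fun k =>
    (SimpleFunc.eapprox f k).restrict (Icc (-(k : ℝ)) k)
  have hφ : ∀ k x, φ k x = (Icc (-(k : ℝ)) k).indicator (SimpleFunc.eapprox f k) x :=
    fun k x => SimpleFunc.restrict_apply _ measurableSet_Icc _
  have hmono : ∀ x, Monotone fun k => φ k x := fun x k l hkl => by
    simp only [hφ]
    have hkl' : (k : ℝ) ≤ l := Nat.cast_le.2 hkl
    exact (Set.indicator_le_indicator_of_subset (Set.Icc_subset_Icc (neg_le_neg hkl') hkl')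
      (fun _ => zero_le) x).trans
      (Set.indicator_le_indicator (SimpleFunc.monotone_eapprox f hkl x))
  have hlim : ∀ x, Filter.Tendsto (fun k => φ k x) Filter.atTop (nhds (f x)) := fun x => by
    have h' : Filter.Tendsto (fun k => SimpleFunc.eapprox f k x) Filter.atTop (nhds (f x)) := by
      rw [← SimpleFunc.iSup_eapprox_apply hf x]
      exact tendsto_atTop_iSup fun k l hkl => SimpleFunc.monotone_eapprox f hkl x
    refine h'.congr' ?_
    filter_upwards [Filter.eventually_ge_atTop ⌈|x|⌉₊] with k hk
    rw [hφ, Set.indicator_of_mem]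
    have : |x| ≤ k := (Nat.le_ceil _).trans (by exact_mod_cast hk)
    exact ⟨(abs_le.1 this).1, (abs_le.1 this).2⟩
  have hsumlim : ∀ ω, Filter.Tendsto (fun k => ∑' n, φ k (X n ω)) Filter.atTop
      (nhds (∑' n, f (X n ω))) := fun ω => by
    simp_rw [← lintegral_count]
    exact lintegral_tendsto_of_tendsto_of_monotone (fun k => Measurable.of_discrete.aemeasurable)
      (Filter.Eventually.of_forall fun n => hmono _)
      (Filter.Eventually.of_forall fun n => hlim _)
  have hL := tendsto_lintegral_expNeg (P := P)
    (S := fun k ω => ∑' n, φ k (X n ω)) (S' := fun ω => ∑' n, f (X n ω))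
    (fun k => Measurable.tsum fun n => (φ k).measurable.comp (hX.measurable n))
    (Filter.Eventually.of_forall hsumlim)
  have hR : Filter.Tendsto (fun k => ∫⁻ x, 1 - expNeg (φ k x) ∂(ENNReal.ofReal lamb • volume))
      Filter.atTop (nhds (∫⁻ x, 1 - expNeg (f x) ∂(ENNReal.ofReal lamb • volume))) := by
    refine lintegral_tendsto_of_tendsto_of_monotone
      (fun k => ((φ k).measurable.expNeg.const_sub 1).aemeasurable)
      (Filter.Eventually.of_forall fun x k l hkl =>
        tsub_le_tsub_left (antitone_expNeg (hmono x hkl)) 1)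
      (Filter.Eventually.of_forall fun x => ?_)
    exact ENNReal.Tendsto.sub tendsto_const_nhds ((continuous_expNeg.tendsto _).comp (hlim x))
      (Or.inl ENNReal.one_ne_top)
  refine tendsto_nhds_unique hL ?_
  refine ((continuous_expNeg.tendsto _).comp hR).congr fun k => ?_
  refine (hX.laplace_simpleFunc (φ k) (K := Icc (-(k : ℝ)) k) ?_ fun x hx => ?_).symm
  · simp
  · rw [hφ, Set.indicator_of_notMem hx]

end IsPoissonProcess

/-! ### Independent marking -/

/-- The random points `Z 0, Z 1, …` of `E` have the Laplace functional of a Poisson process of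
intensity measure `Λ`. This determines the law of the point process, and is the only property of
it that is used below. -/
structure HasPoissonLaplace {Ω E : Type*} [MeasurableSpace Ω] [MeasurableSpace E]
    (P : Measure Ω) (Z : ℕ → Ω → E) (Λ : Measure E) : Prop where
  measurable : ∀ n, Measurable (Z n)
  laplace : ∀ f : E → ℝ≥0∞, Measurable f →
    ∫⁻ ω, expNeg (∑' n, f (Z n ω)) ∂P = expNeg (∫⁻ z, 1 - expNeg (f z) ∂Λ)

lemma tendsto_sum_range_tsum (g : ℕ → ℝ≥0∞) :
    Filter.Tendsto (fun N => ∑ n ∈ Finset.range N, g n) Filter.atTop (nhds (∑' n, g n)) :=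
  ENNReal.summable.hasSum.tendsto_sum_nat

/-- Exponentials of sums of functions of i.i.d. marks, averaged over the marks. -/
lemma lintegral_expNeg_tsum_iid {Ω F : Type*} [MeasurableSpace Ω] [MeasurableSpace F]
    {P : Measure Ω} [IsProbabilityMeasure P] {M : ℕ → Ω → F} {ν : Measure F}
    [IsProbabilityMeasure ν]
    (hM : ∀ n, Measurable (M n)) (hlaw : ∀ n, P.map (M n) = ν) (hind : iIndepFun M P)
    {g : ℕ → F → ℝ≥0∞} (hg : ∀ n, Measurable (g n)) :
    ∫⁻ ω, expNeg (∑' n, g n (M n ω)) ∂P =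
      expNeg (∑' n, negLog (∫⁻ m, expNeg (g n m) ∂ν)) := by
  have hle : ∀ n, ∫⁻ m, expNeg (g n m) ∂ν ≤ 1 := fun n =>
    (lintegral_mono fun m => expNeg_le_one (g n m)).trans (by simp)
  have hL := tendsto_lintegral_expNeg (P := P)
    (S := fun N ω => ∑ n ∈ Finset.range N, g n (M n ω)) (S' := fun ω => ∑' n, g n (M n ω))
    (fun N => Finset.measurable_fun_sum _ fun n _ => (hg n).comp (hM n))
    (Filter.Eventually.of_forall fun ω => tendsto_sum_range_tsum fun n => g n (M n ω))
  refine tendsto_nhds_unique hL ?_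
  refine ((continuous_expNeg.tendsto _).comp (tendsto_sum_range_tsum _)).congr fun N => ?_
  simp only [Function.comp_def, expNeg_sum, expNeg_negLog (hle _)]
  have hc := hind.comp (fun n m => expNeg (g n m)) (fun n => (hg n).expNeg)
  have := lintegral_prod_eq_prod_lintegral_of_indepFun (Finset.range N) _ hc
    (fun n => (hg n).expNeg.comp (hM n))
  simp only [Function.comp_def] at this
  rw [this]
  refine Finset.prod_congr rfl fun n _ => ?_
  rw [← hlaw n, lintegral_map (hg n).expNeg (hM n)]

/-- Independent marking of a Poisson process gives a Poisson process on the product space. -/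
theorem HasPoissonLaplace.prodMk {Ω E F : Type*} [MeasurableSpace Ω] [MeasurableSpace E]
    [MeasurableSpace F] {P : Measure Ω} [IsProbabilityMeasure P] {X : ℕ → Ω → E} {Λ : Measure E}
    [SFinite Λ] (hX : HasPoissonLaplace P X Λ) {M : ℕ → Ω → F} {ν : Measure F}
    [IsProbabilityMeasure ν] (hM : ∀ n, Measurable (M n)) (hlaw : ∀ n, P.map (M n) = ν)
    (hind : iIndepFun M P) (hXM : IndepFun (fun ω n => X n ω) (fun ω n => M n ω) P) :
    HasPoissonLaplace P (fun n ω => (X n ω, M n ω)) (Λ.prod ν) where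
  measurable n := (hX.measurable n).prodMk (hM n)
  laplace f hf := by
    have mX : Measurable fun ω n => X n ω := measurable_pi_iff.2 hX.measurable
    have mM : Measurable fun ω n => M n ω := measurable_pi_iff.2 hM
    have : IsProbabilityMeasure (P.map fun ω n => M n ω) :=
      Measure.isProbabilityMeasure_map mM.aemeasurable
    have : IsProbabilityMeasure (P.map fun ω n => X n ω) :=
      Measure.isProbabilityMeasure_map mX.aemeasurable
    have hprod := (indepFun_iff_map_prod_eq_prod_map_map mX.aemeasurable mM.aemeasurable).1 hXM
    have hmeas : Measurable fun a : (ℕ → E) × (ℕ → F) => expNeg (∑' n, f (a.1 n, a.2 n)) := by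
      refine (Measurable.tsum fun n => hf.comp ?_).expNeg
      fun_prop
    have hint : Measurable fun x => ∫⁻ m, expNeg (f (x, m)) ∂ν := hf.expNeg.lintegral_prod_right'
    have hle : ∀ x, ∫⁻ m, expNeg (f (x, m)) ∂ν ≤ 1 := fun x =>
      (lintegral_mono fun m => expNeg_le_one (f (x, m))).trans (by simp)
    calc ∫⁻ ω, expNeg (∑' n, f (X n ω, M n ω)) ∂P
        = ∫⁻ a, expNeg (∑' n, f (a.1 n, a.2 n))
            ∂(P.map fun ω => (fun n => X n ω, fun n => M n ω)) :=
          (lintegral_map hmeas (mX.prodMk mM)).symm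
      _ = ∫⁻ x, ∫⁻ m, expNeg (∑' n, f (x n, m n)) ∂(P.map fun ω n => M n ω)
            ∂(P.map fun ω n => X n ω) := by
          rw [hprod, lintegral_prod _ hmeas.aemeasurable]
      _ = ∫⁻ x, expNeg (∑' n, negLog (∫⁻ m, expNeg (f (x n, m)) ∂ν))
            ∂(P.map fun ω n => X n ω) := by
          refine lintegral_congr fun x => ?_
          rw [lintegral_map (f := fun m : ℕ → F => expNeg (∑' n, f (x n, m n)))
            (hmeas.comp measurable_prodMk_left) mM]
          exact lintegral_expNeg_tsum_iid hM hlaw hind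
            (fun n => hf.comp measurable_prodMk_left)
      _ = ∫⁻ ω, expNeg (∑' n, negLog (∫⁻ m, expNeg (f (X n ω, m)) ∂ν)) ∂P := by
          rw [lintegral_map _ mX]
          exact (Measurable.tsum fun n =>
            (measurable_negLog.comp hint).comp (measurable_pi_apply n)).expNeg
      _ = expNeg (∫⁻ z, 1 - expNeg (f z) ∂(Λ.prod ν)) := by
          rw [hX.laplace (fun x => negLog (∫⁻ m, expNeg (f (x, m)) ∂ν))
              (measurable_negLog.comp hint),
            lintegral_prod _ (hf.expNeg.const_sub 1).aemeasurable]
          congr 1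
          refine lintegral_congr fun x => ?_
          rw [expNeg_negLog (hle x), lintegral_sub
            (g := fun m => expNeg (f (x, m))) (hf.comp measurable_prodMk_left).expNeg
            (ne_top_of_le_ne_top ENNReal.one_ne_top (hle x))
            (Filter.Eventually.of_forall fun m => expNeg_le_one _)]
          simp

/-! ### Almost sure finiteness -/

namespace HasPoissonLaplace

variable {Ω E : Type*} [MeasurableSpace Ω] [MeasurableSpace E] {P : Measure Ω}
  {Z : ℕ → Ω → E} {Λ : Measure E}

lemma measurable_tsum (hZ : HasPoissonLaplace P Z Λ) {f : E → ℝ≥0∞} (hf : Measurable f) :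
    Measurable fun ω => ∑' n, f (Z n ω) :=
  Measurable.tsum fun n => hf.comp (hZ.measurable n)

/-- Sums of integrable functions over the points are almost surely finite. -/
lemma ae_tsum_ne_top [IsProbabilityMeasure P] (hZ : HasPoissonLaplace P Z Λ) {f : E → ℝ≥0∞}
    (hf : Measurable f) (hint : ∫⁻ z, f z ∂Λ ≠ ∞) : ∀ᵐ ω ∂P, ∑' n, f (Z n ω) ≠ ∞ := by
  let A : Set Ω := {ω | ∑' n, f (Z n ω) = ∞}
  have hA : MeasurableSet A := hZ.measurable_tsum hf (measurableSet_singleton ∞)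
  have hAc : ∀ s : ℝ≥0, 0 < s → P Aᶜ ≥ expNeg (s * ∫⁻ z, f z ∂Λ) := fun s hs => by
    have hs' : (s : ℝ≥0∞) ≠ 0 := by exact_mod_cast hs.ne'
    calc expNeg (s * ∫⁻ z, f z ∂Λ) ≤ expNeg (∫⁻ z, 1 - expNeg (s * f z) ∂Λ) := by
          refine antitone_expNeg ?_
          rw [← lintegral_const_mul _ hf]
          exact lintegral_mono fun z => one_sub_expNeg_le _
      _ = ∫⁻ ω, expNeg (∑' n, s * f (Z n ω)) ∂P := (hZ.laplace _ (hf.const_mul _)).symm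
      _ ≤ ∫⁻ ω, Aᶜ.indicator 1 ω ∂P := by
          refine lintegral_mono fun ω => ?_
          by_cases h : ω ∈ A
          · have h' : ∑' n, f (Z n ω) = ∞ := h
            simp [ENNReal.tsum_mul_left, h', ENNReal.mul_top hs']
          · simpa [h] using expNeg_le_one _
      _ = P Aᶜ := by rw [lintegral_indicator_one hA.compl]
  -- the sum is finite wherever `exp (-s ∑ f)` has a positive value; let `s` tend to `0`
  have hlim : Filter.Tendsto (fun s : ℝ≥0 => expNeg (s * ∫⁻ z, f z ∂Λ)) (nhdsWithin 0 (Ioi 0))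
      (nhds 1) := by
    have h1 : Filter.Tendsto (fun s : ℝ≥0 => (s : ℝ≥0∞) * ∫⁻ z, f z ∂Λ) (nhds 0)
        (nhds ((0 : ℝ≥0) * ∫⁻ z, f z ∂Λ)) :=
      ENNReal.Tendsto.mul_const (ENNReal.tendsto_coe.2 Filter.tendsto_id) (Or.inr hint)
    have h2 := (continuous_expNeg.tendsto _).comp (h1.mono_left (nhdsWithin_le_nhds (s := Ioi 0)))
    simpa [Function.comp_def] using h2
  have h1 : 1 ≤ P Aᶜ := le_of_tendsto hlim (by
    filter_upwards [self_mem_nhdsWithin] with s hs using hAc s hs)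
  have h0 : P A = 0 := (prob_compl_eq_one_iff hA).1 (le_antisymm prob_le_one h1)
  exact compl_mem_ae_iff.2 h0

/-- Only finitely many points lie in a set of finite intensity. -/
lemma ae_finite_mem [IsProbabilityMeasure P] (hZ : HasPoissonLaplace P Z Λ) {B : Set E}
    (hB : MeasurableSet B) (hfin : Λ B ≠ ∞) : ∀ᵐ ω ∂P, {n | Z n ω ∈ B}.Finite := by
  have h := hZ.ae_tsum_ne_top (f := B.indicator fun _ => 1) (measurable_const.indicator hB)
    (by rwa [lintegral_indicator hB, setLIntegral_one])
  filter_upwards [h] with ω hω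
  have : ∑' n, B.indicator (fun _ => (1 : ℝ≥0∞)) (Z n ω) = {n | Z n ω ∈ B}.encard := by
    have := tsum_indicator_const_eq_encard {n | Z n ω ∈ B} 1
    rw [mul_one] at this
    exact this
  rw [this] at hω
  refine Set.encard_ne_top_iff.1 fun htop => hω ?_
  rw [htop]; rfl

end HasPoissonLaplace

/-! ### The number of points in a set, jointly with the points outside of it -/

namespace HasPoissonLaplace

variable {Ω E : Type*} [MeasurableSpace Ω] [MeasurableSpace E] {P : Measure Ω}
  {Z : ℕ → Ω → E} {Λ : Measure E}

lemma measurable_count (hZ : HasPoissonLaplace P Z Λ) {B : Set E} (hB : MeasurableSet B) :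
    Measurable fun ω => {n | Z n ω ∈ B}.encard :=
  measurable_encard.comp (measurable_set_iff.2 fun n => measurable_mem.2 (hZ.measurable n hB))

/-- The probability generating function of the number of points in `B`, at `exp (-σ)`, weighted by
`exp (-∑ g)` over the points outside of `B`. -/
lemma lintegral_expNeg_count_mul (hZ : HasPoissonLaplace P Z Λ) {B : Set E} (hB : MeasurableSet B)
    {g : E → ℝ≥0∞} (hg : Measurable g) (σ : ℝ≥0∞) :
    ∫⁻ ω, expNeg (({n | Z n ω ∈ B}.encard : ℝ≥0∞) * σ) *
        expNeg (∑' n, Bᶜ.indicator g (Z n ω)) ∂P =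
      expNeg ((1 - expNeg σ) * Λ B + ∫⁻ z in Bᶜ, 1 - expNeg (g z) ∂Λ) := by
  have h := hZ.laplace (fun z => B.indicator (fun _ => σ) z + Bᶜ.indicator g z)
    ((measurable_const.indicator hB).add (hg.indicator hB.compl))
  have h1 : ∀ ω, ∑' n, (B.indicator (fun _ => σ) (Z n ω) + Bᶜ.indicator g (Z n ω)) =
      ({n | Z n ω ∈ B}.encard : ℝ≥0∞) * σ + ∑' n, Bᶜ.indicator g (Z n ω) := fun ω => by
    rw [ENNReal.tsum_add, ← tsum_indicator_const_eq_encard]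
    rfl
  have h2 : ∀ z, 1 - expNeg (B.indicator (fun _ => σ) z + Bᶜ.indicator g z) =
      B.indicator (fun _ => 1 - expNeg σ) z + Bᶜ.indicator (fun z => 1 - expNeg (g z)) z :=
    fun z => by by_cases hz : z ∈ B <;> simp [hz]
  simp_rw [h1, h2, expNeg_add] at h
  rw [h, lintegral_add_left (measurable_const.indicator hB), lintegral_indicator hB,
    lintegral_indicator hB.compl, setLIntegral_const]

/-- The joint law of "exactly one point in `B`" and of the points outside of `B`, from the
coefficient of `s` in the probability generating function. -/
theorem lintegral_unique_mem [IsProbabilityMeasure P] (hZ : HasPoissonLaplace P Z Λ) {B : Set E}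
    (hB : MeasurableSet B) (hfin : Λ B ≠ ∞) {g : E → ℝ≥0∞} (hg : Measurable g) :
    ∫⁻ ω in {ω | {n | Z n ω ∈ B}.encard = 1}, expNeg (∑' n, Bᶜ.indicator g (Z n ω)) ∂P =
      Λ B * expNeg (Λ B + ∫⁻ z in Bᶜ, 1 - expNeg (g z) ∂Λ) := by
  set c := ∫⁻ z in Bᶜ, 1 - expNeg (g z) ∂Λ with hc
  set Y : Ω → ℝ≥0∞ := fun ω => expNeg (∑' n, Bᶜ.indicator g (Z n ω)) with hY
  set N : Ω → ℕ∞ := fun ω => {n | Z n ω ∈ B}.encard with hN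
  have mN : Measurable N := hZ.measurable_count hB
  have mY : Measurable Y := (hZ.measurable_tsum (hg.indicator hB.compl)).expNeg
  have mA : ∀ k : ℕ∞, MeasurableSet {ω | N ω = k} := fun k => mN (measurableSet_singleton k)
  set p : ℕ∞ → ℝ≥0∞ := fun k => ∫⁻ ω in {ω | N ω = k}, Y ω ∂P with hp
  have hpk : ∀ k, p k = ∫⁻ ω, {ω | N ω = k}.indicator Y ω ∂P := fun k =>
    (lintegral_indicator (mA k) Y).symm
  have hp1 : p 1 ≤ 1 := by
    refine (setLIntegral_le_lintegral _ _).trans ((lintegral_mono fun ω => ?_).trans_eq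
      (lintegral_one.trans measure_univ))
    exact expNeg_le_one _
  have hF := fun σ => hZ.lintegral_expNeg_count_mul hB hg σ
  rw [← hc] at hF
  -- a configuration without points in `B` is selected by the value `σ = ∞`, that is, `s = 0`
  have hp0 : p 0 = expNeg (Λ B + c) := by
    have h := hF ∞
    rw [expNeg_top, tsub_zero, one_mul] at h
    rw [hpk, ← h]
    refine lintegral_congr fun ω => ?_
    by_cases h0 : N ω = 0
    · have h0' : {n | Z n ω ∈ B}.encard = 0 := h0
      simp [h0, h0', hY]
    · have : ({n | Z n ω ∈ B}.encard : ℝ≥0∞) * ∞ = ∞ := by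
        refine ENNReal.mul_top ?_
        exact_mod_cast h0
      rw [this, Set.indicator_of_notMem (by simpa using h0)]
      simp
  have hbound : ∀ σ, p 0 + expNeg σ * p 1 ≤ expNeg ((1 - expNeg σ) * Λ B + c) ∧
      expNeg ((1 - expNeg σ) * Λ B + c) ≤ p 0 + expNeg σ * p 1 + expNeg σ ^ 2 := fun σ => by
    have hsum : p 0 + expNeg σ * p 1 = ∫⁻ ω, {ω | N ω = 0}.indicator Y ω +
        expNeg σ * {ω | N ω = 1}.indicator Y ω ∂P := by
      rw [hpk, hpk, lintegral_add_left (mY.indicator (mA 0)),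
        lintegral_const_mul _ (mY.indicator (mA 1))]
    have hsum' : p 0 + expNeg σ * p 1 + expNeg σ ^ 2 = ∫⁻ ω, {ω | N ω = 0}.indicator Y ω +
        expNeg σ * {ω | N ω = 1}.indicator Y ω + expNeg σ ^ 2 ∂P := by
      rw [lintegral_add_right _ measurable_const, hsum]
      simp
    have hcases : ∀ ω, N ω = 0 ∨ N ω = 1 ∨ 2 ≤ N ω := fun ω => by
      rcases eq_or_ne (N ω) 0 with h | h
      · exact Or.inl h
      rcases eq_or_ne (N ω) 1 with h' | h'
      · exact Or.inr (Or.inl h')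
      · refine Or.inr (Or.inr ?_)
        have h1 : 1 < N ω := lt_of_le_of_ne (Order.one_le_iff_ne_zero.2 h) h'.symm
        exact Order.add_one_le_of_lt h1
    rw [hsum', hsum, ← hF σ]
    constructor <;> refine lintegral_mono fun ω => ?_
    · change _ ≤ expNeg ((N ω : ℝ≥0∞) * σ) * Y ω
      rcases hcases ω with h | h | h
      · simp [h]
      · simp [h]
      · have h0 : N ω ≠ 0 := by rintro h0; simp [h0] at h
        have h1 : N ω ≠ 1 := by rintro h1; simp [h1] at h
        simp [h0, h1]
    · change expNeg ((N ω : ℝ≥0∞) * σ) * Y ω ≤ _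
      rcases hcases ω with h | h | h
      · simp [h]
      · simp [h]
      · refine le_trans ?_ le_add_self
        refine (mul_le_of_le_one_right' (expNeg_le_one _)).trans ?_
        rw [← expNeg_nat_mul]
        refine antitone_expNeg (mul_le_mul_left ?_ _)
        exact_mod_cast h
  rcases eq_or_ne c ∞ with hc' | hc'
  · have h := (hbound 0).1
    simp only [hc', add_top, expNeg_top, expNeg_zero, one_mul, nonpos_iff_eq_zero, add_eq_zero] at h
    change p 1 = _
    rw [h.2, hc']
    simp
  -- compare the difference quotient at `s = 0` with the derivative
  set a := (Λ B).toReal with ha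
  set c' := c.toReal with hc''
  have key : ∀ s : ℝ, 0 < s → s ≤ 1 →
      (p 1).toReal ≤ s⁻¹ * (Real.exp (-((1 - s) * a + c')) - Real.exp (-(a + c'))) ∧
      s⁻¹ * (Real.exp (-((1 - s) * a + c')) - Real.exp (-(a + c'))) ≤ (p 1).toReal + s := by
    intro s hs hs1
    have h := hbound (negLog (ENNReal.ofReal s))
    rw [expNeg_negLog (ENNReal.ofReal_le_one.2 hs1), hp0] at h
    have e1 : expNeg ((1 - ENNReal.ofReal s) * Λ B + c) =
        ENNReal.ofReal (Real.exp (-((1 - s) * a + c'))) := by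
      rw [expNeg_eq_ofReal (by finiteness), ENNReal.toReal_add (by finiteness) hc',
        ENNReal.toReal_mul, ← ENNReal.ofReal_one, ← ENNReal.ofReal_sub _ hs.le,
        ENNReal.toReal_ofReal (sub_nonneg.2 hs1)]
    have e2 : expNeg (Λ B + c) = ENNReal.ofReal (Real.exp (-(a + c'))) := by
      rw [expNeg_eq_ofReal (by finiteness), ENNReal.toReal_add hfin hc']
    have e3 : p 1 = ENNReal.ofReal (p 1).toReal :=
      (ENNReal.ofReal_toReal (ne_top_of_le_ne_top ENNReal.one_ne_top hp1)).symm
    have h0 : 0 ≤ (p 1).toReal := ENNReal.toReal_nonneg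
    rw [e1, e2, e3, ← ENNReal.ofReal_mul hs.le, ← ENNReal.ofReal_pow hs.le,
      ← ENNReal.ofReal_add (by positivity) (by positivity),
      ← ENNReal.ofReal_add (by positivity) (by positivity),
      ENNReal.ofReal_le_ofReal_iff (by positivity),
      ENNReal.ofReal_le_ofReal_iff (by positivity)] at h
    constructor
    · rw [le_inv_mul_iff₀ hs]; linarith [h.1]
    · rw [inv_mul_le_iff₀ hs]; nlinarith [h.2]
  have hder : HasDerivAt (fun s : ℝ => Real.exp (-((1 - s) * a + c')))
      (a * Real.exp (-(a + c'))) 0 := by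
    have h1 : HasDerivAt (fun s : ℝ => -((1 - s) * a + c')) a 0 := by
      refine HasDerivAt.congr_deriv (f' := -(-1 * a)) ?_ (by ring)
      exact ((((hasDerivAt_id (0 : ℝ)).const_sub 1).mul_const a).add_const c').neg
    have := h1.exp
    simpa [mul_comm] using this
  have hslope := (hasDerivAt_iff_tendsto_slope_zero.1 hder).mono_left
    (nhdsWithin_mono 0 (fun s (hs : s ∈ Ioi (0 : ℝ)) => hs.ne'))
  simp only [zero_add, sub_zero, one_mul, smul_eq_mul] at hslope
  have hev : ∀ᶠ s : ℝ in nhdsWithin 0 (Ioi 0), 0 < s ∧ s ≤ 1 := by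
    filter_upwards [self_mem_nhdsWithin, nhdsWithin_le_nhds (Iic_mem_nhds one_pos)] with s h h'
    exact ⟨h, h'⟩
  have hle1 : (p 1).toReal ≤ a * Real.exp (-(a + c')) :=
    ge_of_tendsto hslope (hev.mono fun s hs => (key s hs.1 hs.2).1)
  have hle2 : a * Real.exp (-(a + c')) ≤ (p 1).toReal := by
    have ht : Filter.Tendsto (fun s : ℝ => (p 1).toReal + s) (nhdsWithin 0 (Ioi 0))
        (nhds ((p 1).toReal + 0)) :=
      (tendsto_const_nhds.add Filter.tendsto_id).mono_left nhdsWithin_le_nhds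
    rw [add_zero] at ht
    exact le_of_tendsto_of_tendsto hslope ht (hev.mono fun s hs => (key s hs.1 hs.2).2)
  change p 1 = _
  rw [← ENNReal.ofReal_toReal (ne_top_of_le_ne_top ENNReal.one_ne_top hp1),
    le_antisymm hle1 hle2, expNeg_eq_ofReal (by finiteness), ENNReal.toReal_add hfin hc',
    ENNReal.ofReal_mul ENNReal.toReal_nonneg, ENNReal.ofReal_toReal hfin]

/-- A set of small intensity rarely contains two points. -/
lemma measure_two_le_count_le [IsProbabilityMeasure P] (hZ : HasPoissonLaplace P Z Λ) {B : Set E}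
    (hB : MeasurableSet B) (hfin : Λ B ≠ ∞) :
    P {ω | 2 ≤ {n | Z n ω ∈ B}.encard} ≤ Λ B ^ 2 := by
  set N : Ω → ℕ∞ := fun ω => {n | Z n ω ∈ B}.encard with hN
  have mN : Measurable N := hZ.measurable_count hB
  have mA : ∀ k : ℕ∞, MeasurableSet {ω | N ω = k} := fun k => mN (measurableSet_singleton k)
  have h1 : P {ω | N ω = 1} = Λ B * expNeg (Λ B) := by
    have := hZ.lintegral_unique_mem hB hfin (g := fun _ => 0) measurable_const
    simpa using this
  have h0 : P {ω | N ω = 0} = expNeg (Λ B) := by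
    have := hZ.lintegral_expNeg_count_mul hB (g := fun _ => 0) measurable_const ∞
    simp only [expNeg_top, tsub_zero, one_mul, Set.indicator_zero, tsum_zero, expNeg_zero, mul_one,
      tsub_self, lintegral_zero, add_zero] at this
    rw [← this, ← lintegral_indicator_one (mA 0)]
    refine lintegral_congr fun ω => ?_
    by_cases h : N ω = 0
    · have h' : {n | Z n ω ∈ B}.encard = 0 := h
      simp [h, h']
    · have : ({n | Z n ω ∈ B}.encard : ℝ≥0∞) * ∞ = ∞ := by
        refine ENNReal.mul_top ?_
        exact_mod_cast h
      rw [this, Set.indicator_of_notMem (by simpa using h)]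
      simp
  have hdisj : Disjoint {ω | N ω = 0} {ω | N ω = 1} :=
    Set.disjoint_left.2 fun ω (h : N ω = 0) (h' : N ω = 1) => by simp [h] at h'
  have hsub : {ω | 2 ≤ N ω} ⊆ ({ω | N ω = 0} ∪ {ω | N ω = 1})ᶜ := by
    rintro ω (h : 2 ≤ N ω) (h' | h')
    · exact absurd (h.trans_eq h') (by decide)
    · exact absurd (h.trans_eq h') (by decide)
  have hr : P.real ({ω | N ω = 0} ∪ {ω | N ω = 1})ᶜ ≤ (Λ B).toReal ^ 2 := by
    rw [probReal_compl_eq_one_sub ((mA 0).union (mA 1)), measureReal_union hdisj (mA 1),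
      measureReal_def, measureReal_def, h0, h1, ENNReal.toReal_mul, expNeg_eq_ofReal hfin,
      ENNReal.toReal_ofReal (Real.exp_pos _).le]
    have h2 := Real.add_one_le_exp (-(Λ B).toReal)
    have h3 : 0 ≤ (Λ B).toReal := ENNReal.toReal_nonneg
    nlinarith
  refine (measure_mono hsub).trans ?_
  rw [← ofReal_measureReal, ← ENNReal.ofReal_toReal hfin,
    ← ENNReal.ofReal_pow ENNReal.toReal_nonneg]
  exact ENNReal.ofReal_le_ofReal hr

end HasPoissonLaplace

/-! ### The first point of a Poisson process and the points beyond it -/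

/-- The function equal to `∞` where `T ≤ t` and to `q t * y` elsewhere. The exponential of minus
its sum over a point configuration is `exp (-q t ∑ y)` if all points have `T > t`, and `0`
otherwise. -/
def barrier {E : Type*} (T : E → ℝ) (q : ℝ → ℝ≥0) (y : E → ℝ≥0∞) (t : ℝ) (z : E) : ℝ≥0∞ :=
  if T z ≤ t then ∞ else q t * y z

/-- The sum of `y` over all points but the one of index `n`. -/
def sumOthers {E : Type*} (y : E → ℝ≥0∞) (z : ℕ → E) (n : ℕ) : ℝ≥0∞ :=
  ∑' m, if m ≠ n then y (z m) else 0

lemma sumOthers_le {E : Type*} (y : E → ℝ≥0∞) (z : ℕ → E) (n : ℕ) :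
    sumOthers y z n ≤ ∑' m, y (z m) :=
  ENNReal.tsum_le_tsum fun m => by split_ifs <;> simp

lemma sumOthers_const_mul {E : Type*} (a : ℝ≥0∞) (y : E → ℝ≥0∞) (z : ℕ → E) (n : ℕ) :
    sumOthers (fun x => a * y x) z n = a * sumOthers y z n := by
  rw [sumOthers, sumOthers, ← ENNReal.tsum_mul_left]
  exact tsum_congr fun m => by split_ifs <;> simp

lemma sumOthers_eq_top {E : Type*} {y : E → ℝ≥0∞} {z : ℕ → E} {n m : ℕ} (hm : m ≠ n)
    (h : y (z m) = ∞) : sumOthers y z n = ∞ :=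
  ENNReal.tsum_eq_top_of_eq_top ⟨m, by rw [if_pos hm, h]⟩

lemma measurable_barrier {E : Type*} [MeasurableSpace E] {T : E → ℝ} (hT : Measurable T)
    (q : ℝ → ℝ≥0) {y : E → ℝ≥0∞} (hy : Measurable y) (t : ℝ) : Measurable (barrier T q y t) :=
  Measurable.ite (measurableSet_le hT measurable_const) measurable_const (hy.const_mul _)

/-- Upper end point of the interval `[l / (k + 1), (l + 1) / (k + 1))`, `l ∈ ℤ`, containing `t`. -/
def ceilGrid (k : ℕ) (t : ℝ) : ℝ := (⌊(k + 1) * t⌋ + 1) / (k + 1)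

lemma lt_ceilGrid (k : ℕ) (t : ℝ) : t < ceilGrid k t := by
  rw [ceilGrid, lt_div_iff₀ (by positivity), mul_comm]
  exact Int.lt_floor_add_one _

lemma ceilGrid_le (k : ℕ) (t : ℝ) : ceilGrid k t ≤ t + 1 / (k + 1) := by
  have hk : (0 : ℝ) < k + 1 := by positivity
  rw [ceilGrid, div_le_iff₀ hk, add_mul t, one_div, inv_mul_cancel₀ hk.ne', mul_comm t]
  linarith [Int.floor_le ((k + 1) * t)]

lemma measurable_ceilGrid (k : ℕ) : Measurable (ceilGrid k) := by
  unfold ceilGrid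
  fun_prop

lemma tendsto_ceilGrid (t : ℝ) :
    Filter.Tendsto (fun k => ceilGrid k t) Filter.atTop (nhds t) := by
  have h : Filter.Tendsto (fun k : ℕ => t + 1 / ((k : ℝ) + 1)) Filter.atTop (nhds (t + 0)) :=
    tendsto_const_nhds.add tendsto_one_div_add_atTop_nhds_zero_nat
  rw [add_zero] at h
  exact tendsto_of_tendsto_of_tendsto_of_le_of_le tendsto_const_nhds h
    (fun k => (lt_ceilGrid k t).le) (fun k => ceilGrid_le k t)

lemma measurable_apply_index {Ω E : Type*} [MeasurableSpace Ω] [MeasurableSpace E]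
    {Z : ℕ → Ω → E} (hZ : ∀ n, Measurable (Z n)) {N : Ω → ℕ} (hN : Measurable N) :
    Measurable fun ω => Z (N ω) ω :=
  (measurable_from_prod_countable_right (f := fun p : ℕ × Ω => Z p.1 p.2) hZ).comp
    (hN.prodMk measurable_id)

namespace HasPoissonLaplace

variable {Ω E : Type*} [MeasurableSpace Ω] [MeasurableSpace E] {P : Measure Ω}
  {Z : ℕ → Ω → E} {Λ : Measure E} {T : E → ℝ}

/-- If no value of `T` carries intensity, then `T` separates the points almost surely: for a
partition of the range of `T` into short intervals, two points in a common interval are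
unlikely. -/
lemma ae_injective_comp [IsProbabilityMeasure P] (hZ : HasPoissonLaplace P Z Λ)
    (hT : Measurable T) (hfin : ∀ t, Λ {z | T z ≤ t} ≠ ∞) (hatom : ∀ t, Λ {z | T z = t} = 0) :
    ∀ᵐ ω ∂P, ∀ m n, m ≠ n → T (Z m ω) ≠ T (Z n ω) := by
  have key : ∀ K : ℕ, P {ω | ∃ m n, m ≠ n ∧ T (Z m ω) = T (Z n ω) ∧ T (Z m ω) ≤ K} = 0 := by
    intro K
    let B : ℕ → ℤ → Set E := fun k l => {z | ⌊((k : ℝ) + 1) * T z⌋ = l} ∩ {z | T z ≤ K}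
    have mB : ∀ k l, MeasurableSet (B k l) := fun k l =>
      ((Int.measurable_floor.comp (hT.const_mul ((k : ℝ) + 1)))
        (measurableSet_singleton l)).inter (measurableSet_le hT measurable_const)
    let φ : ℕ → E → ℝ≥0∞ := fun k z => Λ (B k ⌊((k : ℝ) + 1) * T z⌋)
    have mφ : ∀ k, Measurable (φ k) := fun k =>
      (Measurable.of_discrete (f := fun l => Λ (B k l))).comp
        (Int.measurable_floor.comp (hT.const_mul ((k : ℝ) + 1)))
    have hBK : ∀ k l, Λ (B k l) ≤ Λ {z | T z ≤ K} := fun k l => measure_mono inter_subset_right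
    have hle : ∀ k, P {ω | ∃ m n, m ≠ n ∧ T (Z m ω) = T (Z n ω) ∧ T (Z m ω) ≤ K} ≤
        ∫⁻ z in {z | T z ≤ K}, φ k z ∂Λ := fun k => by
      calc P {ω | ∃ m n, m ≠ n ∧ T (Z m ω) = T (Z n ω) ∧ T (Z m ω) ≤ K}
          ≤ P (⋃ l, {ω | 2 ≤ {n | Z n ω ∈ B k l}.encard}) := by
            refine measure_mono ?_
            rintro ω ⟨m, n, hmn, h, hK⟩
            refine mem_iUnion.2 ⟨⌊((k : ℝ) + 1) * T (Z m ω)⌋, ?_⟩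
            refine (Set.encard_pair hmn).symm.le.trans (Set.encard_le_encard ?_)
            rintro i (rfl | rfl)
            · exact ⟨rfl, hK⟩
            · exact ⟨by simp [h], h.symm.le.trans hK⟩
        _ ≤ ∑' l, P {ω | 2 ≤ {n | Z n ω ∈ B k l}.encard} := measure_iUnion_le _
        _ ≤ ∑' l, ∫⁻ z in B k l, φ k z ∂Λ := by
            refine ENNReal.tsum_le_tsum fun l => ?_
            refine (hZ.measure_two_le_count_le (mB k l)
              (ne_top_of_le_ne_top (hfin K) (hBK k l))).trans_eq ?_
            rw [setLIntegral_congr_fun (g := fun _ => Λ (B k l)) (mB k l), setLIntegral_const, sq]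
            intro z hz
            have : ⌊((k : ℝ) + 1) * T z⌋ = l := hz.1
            simp only [φ, this]
        _ = ∫⁻ z in ⋃ l, B k l, φ k z ∂Λ := by
            rw [lintegral_iUnion (mB k)]
            intro l l' hll
            exact Set.disjoint_left.2 fun z hz hz' => hll (hz.1.symm.trans hz'.1)
        _ = ∫⁻ z in {z | T z ≤ K}, φ k z ∂Λ := by
            congr 2
            ext z
            simp [B]
    have hlim : Filter.Tendsto (fun k => ∫⁻ z in {z | T z ≤ K}, φ k z ∂Λ) Filter.atTop
        (nhds (∫⁻ z in {z | T z ≤ K}, 0 ∂Λ)) := by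
      refine tendsto_lintegral_of_dominated_convergence (fun _ => Λ {z | T z ≤ K}) mφ
        (fun k => Filter.Eventually.of_forall fun z => hBK k _) ?_
        (Filter.Eventually.of_forall fun z => ?_)
      · rw [setLIntegral_const]
        exact ENNReal.mul_ne_top (hfin K) (hfin K)
      · let A : ℕ → Set E := fun k => {z' | |T z' - T z| ≤ 1 / ((k : ℝ) + 1)}
        have mA : ∀ k, MeasurableSet (A k) := fun k =>
          measurableSet_le ((hT.sub_const _).abs) measurable_const
        have hA : Antitone A := fun i j hij z' hz' =>
          le_trans (b := 1 / ((j : ℝ) + 1)) hz'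
            (one_div_le_one_div_of_le (by positivity) (by simpa using hij))
        have hA0 : Λ (A 0) ≠ ∞ := by
          refine ne_top_of_le_ne_top (hfin (T z + 1)) (measure_mono fun z' hz' => ?_)
          have hz'' : |T z' - T z| ≤ 1 / (((0 : ℕ) : ℝ) + 1) := hz'
          have := (abs_le.1 hz'').2
          simp only [Nat.cast_zero, zero_add, div_one] at this
          change T z' ≤ T z + 1
          linarith
        have ht := tendsto_measure_iInter_atTop (μ := Λ)
          (fun k => (mA k).nullMeasurableSet) hA ⟨0, hA0⟩
        have hinter : ⋂ k, A k ⊆ {z' | T z' = T z} := fun z' hz' => by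
          have h : ∀ k : ℕ, |T z' - T z| ≤ 1 / ((k : ℝ) + 1) := fun k => mem_iInter.1 hz' k
          have h0 := ge_of_tendsto' tendsto_one_div_add_atTop_nhds_zero_nat h
          exact sub_eq_zero.1 (abs_nonpos_iff.1 h0)
        rw [measure_mono_null hinter (hatom _)] at ht
        refine tendsto_of_tendsto_of_tendsto_of_le_of_le tendsto_const_nhds ht
          (fun _ => zero_le) fun k => measure_mono fun z' hz' => ?_
        have h1 : ⌊((k : ℝ) + 1) * T z'⌋ = ⌊((k : ℝ) + 1) * T z⌋ := hz'.1
        have h2 := (Int.abs_sub_lt_one_of_floor_eq_floor h1).le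
        have hk : (0 : ℝ) < k + 1 := by positivity
        rw [← mul_sub, abs_mul, abs_of_pos hk] at h2
        change |T z' - T z| ≤ _
        rwa [le_div_iff₀ hk, mul_comm]
    rw [lintegral_zero] at hlim
    exact le_antisymm (ge_of_tendsto' hlim hle) zero_le
  have hall := ae_all_iff.2 fun K : ℕ => compl_mem_ae_iff.2 (key K)
  filter_upwards [hall] with ω hω m n hmn h
  exact hω ⌈T (Z m ω)⌉₊ ⟨m, n, hmn, h, Nat.le_ceil _⟩

/-- The exponent in `lintegral_first` is a continuous function of the value of `T` at the first
point. -/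
lemma _root_.continuous_lintegral_barrier (hT : Measurable T)
    (hfin : ∀ t, Λ {z | T z ≤ t} ≠ ∞) (hatom : ∀ t, Λ {z | T z = t} = 0) {q : ℝ → ℝ≥0}
    (hq : Continuous q) {y : E → ℝ≥0∞} (hy : Measurable y) (hyfin : ∫⁻ z, y z ∂Λ ≠ ∞) :
    Continuous fun t => ∫⁻ z, 1 - expNeg (barrier T q y t z) ∂Λ := by
  refine continuous_iff_continuousAt.2 fun t => ?_
  obtain ⟨Q, hQ⟩ : ∃ Q : ℝ≥0, ∀ᶠ s in nhds t, q s ≤ Q :=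
    ⟨q t + 1, (hq.tendsto t).eventually (Iic_mem_nhds (by simp))⟩
  have hae : ∀ᵐ z ∂Λ, T z ≠ t := compl_mem_ae_iff.2 (hatom t)
  refine tendsto_lintegral_filter_of_dominated_convergence
    (fun z => {z | T z ≤ t + 1}.indicator (fun _ => 1) z + Q * y z)
    (Filter.Eventually.of_forall fun s => ((measurable_barrier hT q hy s).expNeg.const_sub 1)) ?_ ?_
    ?_
  · filter_upwards [hQ, Iic_mem_nhds (lt_add_one t)] with s hs hs1
    refine Filter.Eventually.of_forall fun z => ?_
    by_cases hz : T z ≤ s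
    · have : T z ≤ t + 1 := hz.trans hs1
      refine le_trans ?_ le_self_add
      simp [this]
    · refine le_trans ?_ le_add_self
      rw [barrier, if_neg hz]
      exact (one_sub_expNeg_le _).trans (by gcongr)
  · have hm : MeasurableSet {z | T z ≤ t + 1} := measurableSet_le hT measurable_const
    rw [lintegral_add_left (measurable_const.indicator hm), lintegral_indicator hm,
      setLIntegral_one, lintegral_const_mul _ hy]
    exact ENNReal.add_ne_top.2 ⟨hfin _, ENNReal.mul_ne_top ENNReal.coe_ne_top hyfin⟩
  · have hyae := ae_lt_top hy hyfin
    filter_upwards [hae, hyae] with z hz hyz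
    refine ENNReal.Tendsto.sub tendsto_const_nhds ((continuous_expNeg.tendsto _).comp ?_)
      (Or.inl ENNReal.one_ne_top)
    rcases lt_or_gt_of_ne hz with h | h
    · refine tendsto_const_nhds.congr' ?_
      filter_upwards [Ioi_mem_nhds h] with s hs
      rw [barrier, barrier, if_pos h.le, if_pos (le_of_lt hs)]
    · rw [barrier, if_neg (not_le.2 h)]
      refine Filter.Tendsto.congr' (f₁ := fun s => (q s : ℝ≥0∞) * y z) ?_ ?_
      · filter_upwards [Iio_mem_nhds h] with s hs
        rw [barrier, if_neg (not_le.2 hs)]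
      · exact ENNReal.Tendsto.mul_const (ENNReal.tendsto_coe.2 (hq.tendsto t)) (Or.inr hyz.ne)

/-- The identity of `lintegral_first` on one cell of a partition of the range of `T`: the first
point lies in a subset `B` of the cell and all other points are beyond the cell. -/
lemma setLIntegral_first_mem_cell [IsProbabilityMeasure P] (hZ : HasPoissonLaplace P Z Λ)
    (hT : Measurable T) (hfin : ∀ t, Λ {z | T z ≤ t} ≠ ∞) (q : ℝ → ℝ≥0) {y : E → ℝ≥0∞}
    (hy : Measurable y) {N : Ω → ℕ} (hN : Measurable N)
    (hmin : ∀ᵐ ω ∂P, ∀ m, T (Z (N ω) ω) ≤ T (Z m ω)) {B : Set E} (hB : MeasurableSet B) {c : ℝ}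
    (hBc : ∀ z ∈ B, T z ≤ c) :
    ∫⁻ ω in {ω | Z (N ω) ω ∈ B}, expNeg (sumOthers (barrier T q y c) (fun m => Z m ω) (N ω)) ∂P =
      ∫⁻ _z in B, expNeg (∫⁻ z', 1 - expNeg (barrier T q y c z') ∂Λ) ∂Λ := by
  have hBfin : Λ B ≠ ∞ := ne_top_of_le_ne_top (hfin c) (measure_mono hBc)
  have hinf : ∀ z, T z ≤ c → barrier T q y c z = ∞ := fun z hz => if_pos hz
  have mA : MeasurableSet {ω | Z (N ω) ω ∈ B} := measurable_apply_index hZ.measurable hN hB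
  have mU : MeasurableSet {ω | {n | Z n ω ∈ B}.encard = 1} :=
    hZ.measurable_count hB (measurableSet_singleton 1)
  have h := hZ.lintegral_unique_mem hB hBfin (measurable_barrier hT q hy c)
  have hsplit : ∫⁻ z', 1 - expNeg (barrier T q y c z') ∂Λ =
      Λ B + ∫⁻ z in Bᶜ, 1 - expNeg (barrier T q y c z) ∂Λ := by
    rw [← lintegral_add_compl _ hB]
    congr 1
    rw [setLIntegral_congr_fun (g := fun _ => 1) hB fun z hz => ?_, setLIntegral_one]
    simp [hinf z (hBc z hz)]
  rw [setLIntegral_const, hsplit, mul_comm, ← h, ← lintegral_indicator mA, ← lintegral_indicator mU]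
  refine lintegral_congr_ae ?_
  filter_upwards [hmin] with ω hω
  by_cases hU : {n | Z n ω ∈ B}.encard = 1
  · obtain ⟨n, hn⟩ := Set.encard_eq_one.1 hU
    have hmem : ∀ m, Z m ω ∈ B ↔ m = n := fun m => by
      have : m ∈ {n | Z n ω ∈ B} ↔ m ∈ ({n} : Set ℕ) := by rw [hn]
      exact this
    rw [Set.indicator_of_mem (s := {ω | {n | Z n ω ∈ B}.encard = 1}) hU]
    by_cases hA : Z (N ω) ω ∈ B
    · rw [Set.indicator_of_mem (s := {ω | Z (N ω) ω ∈ B}) hA, sumOthers]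
      congr 1
      refine tsum_congr fun m => ?_
      by_cases hm : m = n
      · simp [hm, (hmem n).2 rfl, (hmem _).1 hA]
      · simp [hm, (hmem m).not.2 hm, (hmem _).1 hA]
    · rw [Set.indicator_of_notMem (s := {ω | Z (N ω) ω ∈ B}) hA]
      have htop : Bᶜ.indicator (barrier T q y c) (Z (N ω) ω) = ∞ := by
        rw [Set.indicator_of_mem hA]
        exact hinf _ ((hω n).trans (hBc _ ((hmem n).2 rfl)))
      rw [ENNReal.tsum_eq_top_of_eq_top (f := fun m => Bᶜ.indicator (barrier T q y c) (Z m ω))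
        ⟨_, htop⟩, expNeg_top]
  -- with a second point in `B`, the barrier makes the left hand side vanish
  · rw [Set.indicator_of_notMem (s := {ω | {n | Z n ω ∈ B}.encard = 1}) hU]
    by_cases hA : Z (N ω) ω ∈ B
    · rw [Set.indicator_of_mem (s := {ω | Z (N ω) ω ∈ B}) hA]
      obtain ⟨m, hm, hmB⟩ : ∃ m, m ≠ N ω ∧ Z m ω ∈ B := by
        by_contra! hcon
        refine hU (Set.encard_eq_one.2 ⟨N ω, ?_⟩)
        ext m
        exact ⟨fun hm => by_contra fun hne => hcon m hne hm, fun hm => by rw [hm]; exact hA⟩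
      rw [sumOthers_eq_top hm (hinf _ (hBc _ hmB)), expNeg_top]
    · rw [Set.indicator_of_notMem (s := {ω | Z (N ω) ω ∈ B}) hA]

/-- The law of the first point, weighted by `exp (-q ∑ y)` over the other points, where `q` may
depend on the first point: the first point has the intensity `Λ`, the other points are, given the
first point, those of a Poisson process restricted to the region beyond it, and the region up to
the first point is void. -/
theorem lintegral_first [IsProbabilityMeasure P] (hZ : HasPoissonLaplace P Z Λ)
    (hT : Measurable T) (hfin : ∀ t, Λ {z | T z ≤ t} ≠ ∞) (hatom : ∀ t, Λ {z | T z = t} = 0)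
    {q : ℝ → ℝ≥0} (hq : Continuous q) {y : E → ℝ≥0∞} (hy : Measurable y)
    (hyfin : ∫⁻ z, y z ∂Λ ≠ ∞) {N : Ω → ℕ} (hN : Measurable N)
    (hmin : ∀ᵐ ω ∂P, ∀ m, T (Z (N ω) ω) ≤ T (Z m ω)) {φ : E → ℝ≥0∞} (hφ : Measurable φ) :
    ∫⁻ ω, φ (Z (N ω) ω) *
        expNeg (q (T (Z (N ω) ω)) * sumOthers y (fun m => Z m ω) (N ω)) ∂P =
      ∫⁻ z, φ z * expNeg (∫⁻ z', 1 - expNeg (barrier T q y (T z) z') ∂Λ) ∂Λ := by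
  have mZN : Measurable fun ω => Z (N ω) ω := measurable_apply_index hZ.measurable hN
  have mTN : Measurable fun ω => T (Z (N ω) ω) := hT.comp mZN
  have msum : ∀ {f : ℝ → E → ℝ≥0∞} {t : Ω → ℝ}, Measurable (fun p : ℝ × E => f p.1 p.2) →
      Measurable t → Measurable fun ω => sumOthers (f (t ω)) (fun m => Z m ω) (N ω) :=
    fun {f t} hf ht => Measurable.tsum fun m => Measurable.ite
      (hN (measurableSet_singleton m).compl |> fun h => by
        simpa only [Set.preimage, Set.mem_compl_iff, Set.mem_singleton_iff, ne_comm, eq_comm,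
          ne_eq] using h)
      (hf.comp (ht.prodMk (hZ.measurable m))) measurable_const
  have mbar : Measurable fun p : ℝ × E => barrier T q y p.1 p.2 :=
    Measurable.ite (measurableSet_le (hT.comp measurable_snd) measurable_fst) measurable_const
      ((hq.measurable.comp measurable_fst).coe_nnreal_ennreal.mul (hy.comp measurable_snd))
  have mJ := (continuous_lintegral_barrier hT hfin hatom hq hy hyfin).measurable
  set J : ℝ → ℝ≥0∞ := fun t => ∫⁻ z', 1 - expNeg (barrier T q y t z') ∂Λ with hJ
  have hJc : Continuous J := continuous_lintegral_barrier hT hfin hatom hq hy hyfin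
  -- on each grid, sum over the cells: the barrier at the upper end point of the cell excludes all
  -- other points from the cell
  have hgrid : ∀ (k : ℕ) (F : Set E), MeasurableSet F →
      ∫⁻ ω in {ω | Z (N ω) ω ∈ F}, expNeg (sumOthers (barrier T q y (ceilGrid k (T (Z (N ω) ω))))
        (fun m => Z m ω) (N ω)) ∂P = ∫⁻ z in F, expNeg (J (ceilGrid k (T z))) ∂Λ := by
    intro k F hF
    let B : ℤ → Set E := fun l => F ∩ {z | ⌊((k : ℝ) + 1) * T z⌋ = l}
    have mB : ∀ l, MeasurableSet (B l) := fun l => hF.inter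
      ((Int.measurable_floor.comp (hT.const_mul ((k : ℝ) + 1))) (measurableSet_singleton l))
    have hBd : Pairwise (Function.onFun Disjoint B) := fun l l' hll =>
      Set.disjoint_left.2 fun z hz hz' => hll (hz.2.symm.trans hz'.2)
    have hBc : ∀ l, ∀ z ∈ B l, ceilGrid k (T z) = (l + 1) / (k + 1) := fun l z hz => by
      have : ⌊((k : ℝ) + 1) * T z⌋ = l := hz.2
      rw [ceilGrid, this]
    have hF' : F = ⋃ l, B l := by ext z; simp [B]
    have hF'' : {ω | Z (N ω) ω ∈ F} = ⋃ l, {ω | Z (N ω) ω ∈ B l} := by ext ω; simp [B]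
    rw [hF'', lintegral_iUnion (s := fun l => {ω | Z (N ω) ω ∈ B l}) (fun l => mZN (mB l)), hF',
      lintegral_iUnion mB hBd]
    · refine tsum_congr fun l => ?_
      have hcell := hZ.setLIntegral_first_mem_cell hT hfin q hy hN hmin (mB l)
        (c := (l + 1) / (k + 1)) fun z hz => hBc l z hz ▸ (lt_ceilGrid k (T z)).le
      rw [setLIntegral_congr_fun (s := {ω | Z (N ω) ω ∈ B l}) (mZN (mB l))
        (g := fun ω => expNeg (sumOthers (barrier T q y ((l + 1) / (k + 1)))
          (fun m => Z m ω) (N ω))), hcell]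
      · exact setLIntegral_congr_fun (mB l) fun z hz => by rw [hBc l z hz]
      · intro ω hω
        simp only [hBc l _ hω]
    · exact fun l l' hll => (hBd hll).preimage fun ω => Z (N ω) ω
  -- refine the grid: the other points are locally finite and have larger values of `T`, so they
  -- are eventually beyond the barrier
  have hlimL : ∀ᵐ ω ∂P, Filter.Tendsto (fun k => sumOthers
      (barrier T q y (ceilGrid k (T (Z (N ω) ω)))) (fun m => Z m ω) (N ω)) Filter.atTop
      (nhds (q (T (Z (N ω) ω)) * sumOthers y (fun m => Z m ω) (N ω))) := by
    have hloc : ∀ᵐ ω ∂P, ∀ K : ℕ, {n | Z n ω ∈ {z | T z ≤ K}}.Finite :=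
      ae_all_iff.2 fun K => hZ.ae_finite_mem (measurableSet_le hT measurable_const) (hfin K)
    filter_upwards [hmin, hZ.ae_injective_comp hT hfin hatom, hloc,
      hZ.ae_tsum_ne_top hy hyfin] with ω hω hinj hlocω hsum
    set t := T (Z (N ω) ω) with ht
    have hfinI : sumOthers y (fun m => Z m ω) (N ω) ≠ ∞ := ne_top_of_le_ne_top hsum
      (sumOthers_le _ _ _)
    have hev : ∀ᶠ s in nhds t, ∀ m, m ≠ N ω → s < T (Z m ω) := by
      obtain ⟨K, hK⟩ := exists_nat_gt t
      have h1 : ∀ᶠ s in nhds t, ∀ m ∈ {n | Z n ω ∈ {z | T z ≤ K}}, m ≠ N ω → s < T (Z m ω) := by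
        refine (Filter.eventually_all_finite (hlocω K)).2 fun m _ => ?_
        by_cases hm : m = N ω
        · exact Filter.Eventually.of_forall fun s h => absurd hm h
        · filter_upwards [Iio_mem_nhds (lt_of_le_of_ne (hω m) (hinj _ _ (Ne.symm hm)))]
            with s hs _ using hs
      filter_upwards [h1, Iio_mem_nhds hK] with s hs hsK m hm
      by_cases hmK : T (Z m ω) ≤ K
      · exact hs m hmK hm
      · exact lt_trans hsK (not_le.1 hmK)
    have hev' := (tendsto_ceilGrid t).eventually hev
    refine Filter.Tendsto.congr' (f₁ := fun k => (q (ceilGrid k t) : ℝ≥0∞) *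
      sumOthers y (fun m => Z m ω) (N ω)) ?_ ?_
    · filter_upwards [hev'] with k hk
      rw [← sumOthers_const_mul]
      refine tsum_congr fun m => ?_
      split_ifs with hm
      · rw [barrier, if_neg (not_le.2 (hk m hm))]
      · rfl
    · exact ENNReal.Tendsto.mul_const (ENNReal.tendsto_coe.2
        ((hq.tendsto t).comp (tendsto_ceilGrid t))) (Or.inr hfinI)
  have hbdd : ∀ (K : ℕ) (F : Set E), MeasurableSet F → F ⊆ {z | T z ≤ K} →
      ∫⁻ ω in {ω | Z (N ω) ω ∈ F}, expNeg (q (T (Z (N ω) ω)) *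
        sumOthers y (fun m => Z m ω) (N ω)) ∂P = ∫⁻ z in F, expNeg (J (T z)) ∂Λ := by
    intro K F hF hFK
    refine tendsto_nhds_unique (f := fun k => ∫⁻ z in F, expNeg (J (ceilGrid k (T z))) ∂Λ)
      (l := Filter.atTop) ?_ ?_
    · simp_rw [← fun k => hgrid k F hF]
      refine tendsto_lintegral_of_dominated_convergence (fun _ => 1)
        (fun k => (msum mbar ((measurable_ceilGrid k).comp mTN)).expNeg)
        (fun k => Filter.Eventually.of_forall fun ω => expNeg_le_one _) (by simp)
        (ae_restrict_of_ae ?_)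
      filter_upwards [hlimL] with ω hω
      exact (continuous_expNeg.tendsto _).comp hω
    · refine tendsto_lintegral_of_dominated_convergence (fun _ => 1)
        (fun k => (mJ.comp ((measurable_ceilGrid k).comp hT)).expNeg)
        (fun k => Filter.Eventually.of_forall fun ω => expNeg_le_one _) ?_
        (Filter.Eventually.of_forall fun z => ?_)
      · rw [setLIntegral_one]
        exact ne_top_of_le_ne_top (hfin K) (measure_mono hFK)
      · exact ((continuous_expNeg.comp hJc).tendsto _).comp (tendsto_ceilGrid (T z))
  have mW : Measurable fun ω => expNeg (q (T (Z (N ω) ω)) *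
      sumOthers y (fun m => Z m ω) (N ω)) :=
    ((hq.measurable.comp mTN).coe_nnreal_ennreal.mul
      (msum (f := fun _ => y) (hy.comp measurable_snd) mTN)).expNeg
  have mG : Measurable fun z => expNeg (J (T z)) := (mJ.comp hT).expNeg
  -- hence the two sides define the same measure on `E`
  have hmeas : (P.withDensity fun ω => expNeg (q (T (Z (N ω) ω)) *
      sumOthers y (fun m => Z m ω) (N ω))).map (fun ω => Z (N ω) ω) =
      Λ.withDensity fun z => expNeg (J (T z)) := by
    ext F hF
    have hcover : F = ⋃ K : ℕ, F ∩ {z | T z ≤ K} := by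
      ext z
      simp only [mem_iUnion, mem_inter_iff, exists_and_left, iff_self_and]
      exact fun _ => exists_nat_ge (T z)
    have hmono : Monotone fun K : ℕ => F ∩ {z | T z ≤ K} := fun K L hKL =>
      inter_subset_inter_right F fun z (hz : T z ≤ K) =>
        hz.trans (by exact_mod_cast hKL : (K : ℝ) ≤ L)
    rw [hcover, hmono.measure_iUnion, hmono.measure_iUnion]
    congr 1 with K
    have mFK : MeasurableSet (F ∩ {z | T z ≤ K}) :=
      hF.inter (measurableSet_le hT measurable_const)
    rw [Measure.map_apply mZN mFK, withDensity_apply _ (mZN mFK), withDensity_apply _ mFK]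
    exact hbdd K _ mFK inter_subset_right
  calc _ = ∫⁻ z, φ z ∂((P.withDensity fun ω => expNeg (q (T (Z (N ω) ω)) *
        sumOthers y (fun m => Z m ω) (N ω))).map (fun ω => Z (N ω) ω)) := by
        rw [lintegral_map hφ mZN, lintegral_withDensity_eq_lintegral_mul _ mW
          (g := fun ω => φ (Z (N ω) ω)) (hφ.comp mZN)]
        exact lintegral_congr fun ω => mul_comm _ _
    _ = _ := by
        rw [hmeas, lintegral_withDensity_eq_lintegral_mul _ mG hφ]
        exact lintegral_congr fun ω => mul_comm _ _

end HasPoissonLaplace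

/-! ### Exponential fading and antenna gains -/

lemma setLIntegral_Ioi_exp {a k : ℝ} (ha : 0 ≤ a) (hk : 0 < k) (c : ℝ) :
    ∫⁻ x in Ioi c, ENNReal.ofReal (a * Real.exp (-(k * x))) =
      ENNReal.ofReal (a / k * Real.exp (-(k * c))) := by
  have hint : IntegrableOn (fun x => Real.exp (-k * x)) (Ioi c) :=
    integrableOn_exp_mul_Ioi (neg_lt_zero.2 hk) c
  have h := integral_exp_mul_Ioi (neg_lt_zero.2 hk) c
  simp only [neg_mul] at hint h
  rw [← ofReal_integral_eq_lintegral_ofReal (hint.const_mul a)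
    (Filter.Eventually.of_forall fun x => by positivity), integral_const_mul, h]
  congr 1
  field_simp

lemma lintegral_expMeasure {r : ℝ} {g : ℝ → ℝ≥0∞} (hg : Measurable g) :
    ∫⁻ x, g x ∂(expMeasure r) =
      ∫⁻ x in Ioi 0, ENNReal.ofReal (r * Real.exp (-(r * x))) * g x := by
  have hm : Measurable (gammaPDF 1 r) := (measurable_gammaPDFReal 1 r).ennreal_ofReal
  rw [expMeasure, gammaMeasure, lintegral_withDensity_eq_lintegral_mul _ hm hg,
    ← lintegral_indicator measurableSet_Ioi]
  refine lintegral_congr_ae ?_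
  have h0 : ∀ᵐ x : ℝ, x ≠ 0 := by simp [ae_iff]
  filter_upwards [h0] with x hx
  change exponentialPDF r x * g x = _
  rcases lt_or_gt_of_ne hx with h | h
  · rw [exponentialPDF_of_neg h, Set.indicator_of_notMem (by simpa using h.le), zero_mul]
  · rw [exponentialPDF_of_nonneg h.le, Set.indicator_of_mem (by simpa using h)]

lemma expMeasure_tail {r : ℝ} (hr : 0 < r) (κ : ℝ≥0∞) :
    expMeasure r {x | κ < ENNReal.ofReal x} = expNeg (ENNReal.ofReal r * κ) := by
  have hm : MeasurableSet {x : ℝ | κ < ENNReal.ofReal x} :=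
    measurableSet_lt measurable_const ENNReal.measurable_ofReal
  rcases eq_or_ne κ ∞ with rfl | hκ
  · simp [hr]
  rw [← lintegral_indicator_one hm, lintegral_expMeasure (measurable_one.indicator hm)]
  have hset : ∀ x : ℝ, κ < ENNReal.ofReal x ↔ κ.toReal < x := fun x => by
    rw [ENNReal.lt_ofReal_iff_toReal_lt hκ]
  have h1 : ∀ x, (Ioi (0 : ℝ)).indicator (fun x => ENNReal.ofReal (r * Real.exp (-(r * x))) *
      {x | κ < ENNReal.ofReal x}.indicator 1 x) x =
      (Ioi κ.toReal).indicator (fun x => ENNReal.ofReal (r * Real.exp (-(r * x)))) x := fun x => by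
    have hκ0 : 0 ≤ κ.toReal := ENNReal.toReal_nonneg
    by_cases hx : κ.toReal < x
    · simp [hset, hx, hκ0.trans_lt hx]
    · simp [hset, hx]
  rw [← lintegral_indicator measurableSet_Ioi, lintegral_congr h1,
    lintegral_indicator measurableSet_Ioi, setLIntegral_Ioi_exp hr.le hr, div_self hr.ne', one_mul,
    expNeg_eq_ofReal (ENNReal.mul_ne_top ENNReal.ofReal_ne_top hκ), ENNReal.toReal_mul,
    ENNReal.toReal_ofReal hr.le]

lemma lintegral_expNeg_expMeasure {r s : ℝ} (hr : 0 < r) (hs : 0 ≤ s) :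
    ∫⁻ x, expNeg (ENNReal.ofReal (x * s)) ∂(expMeasure r) = ENNReal.ofReal (r / (r + s)) := by
  have h := setLIntegral_Ioi_exp hr.le (add_pos_of_pos_of_nonneg hr hs) 0
  rw [mul_zero, neg_zero, Real.exp_zero, mul_one] at h
  rw [lintegral_expMeasure (by fun_prop), ← h]
  refine setLIntegral_congr_fun measurableSet_Ioi fun x (hx : 0 < x) => ?_
  rw [expNeg_ofReal (by positivity), ← ENNReal.ofReal_mul (by positivity), mul_assoc,
    ← Real.exp_add]
  congr 3
  ring

lemma lintegral_ofReal_expMeasure_ne_top {r : ℝ} (hr : 0 < r) :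
    ∫⁻ x, ENNReal.ofReal x ∂(expMeasure r) ≠ ∞ := by
  have h := setLIntegral_Ioi_exp (a := 2) two_pos.le (half_pos hr) 0
  rw [lintegral_expMeasure ENNReal.measurable_ofReal]
  refine ne_top_of_le_ne_top (h ▸ ENNReal.ofReal_ne_top)
    (setLIntegral_mono (by fun_prop) fun x (hx : 0 < x) => ?_)
  rw [← ENNReal.ofReal_mul (by positivity)]
  refine ENNReal.ofReal_le_ofReal ?_
  have h1 := Real.add_one_le_exp (r / 2 * x)
  have h2 : Real.exp (-(r * x)) = Real.exp (-(r / 2 * x)) * Real.exp (-(r / 2 * x)) := by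
    rw [← Real.exp_add]; ring_nf
  have h3 : Real.exp (r / 2 * x) * Real.exp (-(r / 2 * x)) = 1 := by
    rw [← Real.exp_add]; simp
  have h4 := Real.exp_pos (-(r / 2 * x))
  calc r * Real.exp (-(r * x)) * x
      = 2 * Real.exp (-(r / 2 * x)) * ((r / 2 * x) * Real.exp (-(r / 2 * x))) := by rw [h2]; ring
    _ ≤ 2 * Real.exp (-(r / 2 * x)) * 1 := by
        refine mul_le_mul_of_nonneg_left ?_ (by positivity)
        rw [← h3]
        exact mul_le_mul_of_nonneg_right (by linarith) h4.le
    _ = _ := mul_one _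

namespace Scenario

variable (s : Scenario)

lemma losProb_pos (x : ℝ) : 0 < s.losProb x := by
  cases s <;> exact Real.exp_pos _

lemma losProb_le_one {x : ℝ} (hx : 0 ≤ x) : s.losProb x ≤ 1 := by
  cases s <;> simp only [losProb, Real.exp_le_one_iff, neg_nonpos] <;> positivity

lemma continuous_losProb : Continuous s.losProb := by
  cases s with
  | rural lo tau => exact continuous_const
  | urban a => exact Real.continuous_exp.comp (continuous_const.mul continuous_id).neg

lemma prob_nonneg (i : LinkState) {x : ℝ} (hx : 0 ≤ x) : 0 ≤ s.prob i x := by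
  cases i
  · exact (s.losProb_pos x).le
  · exact sub_nonneg.2 (s.losProb_le_one hx)

lemma prob_le_one (i : LinkState) {x : ℝ} (hx : 0 ≤ x) : s.prob i x ≤ 1 := by
  cases i
  · exact s.losProb_le_one hx
  · exact sub_le_self _ (s.losProb_pos x).le

lemma continuous_prob (i : LinkState) : Continuous (s.prob i) := by
  cases i
  · exact s.continuous_losProb
  · exact continuous_const.sub s.continuous_losProb

end Scenario

namespace Params

variable (p : Params)

lemma theta_div_pi_nonneg : 0 ≤ p.theta / Real.pi := div_nonneg p.theta_nonneg Real.pi_pos.le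

lemma theta_div_pi_le_one : p.theta / Real.pi ≤ 1 := div_le_one_of_le₀ p.theta_le_pi Real.pi_pos.le

lemma lintegral_gainLaw (g : ℝ → ℝ≥0∞) :
    ∫⁻ d, g d ∂p.gainLaw = ENNReal.ofReal (p.theta / Real.pi) * g (p.Gb * p.Gv) +
      ENNReal.ofReal (1 - p.theta / Real.pi) * g (p.gb * p.gv) := by
  rw [gainLaw, lintegral_add_measure, lintegral_smul_measure, lintegral_smul_measure,
    lintegral_dirac, lintegral_dirac, smul_eq_mul, smul_eq_mul]

instance : IsProbabilityMeasure p.gainLaw where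
  measure_univ := by
    have h := p.lintegral_gainLaw fun _ => 1
    rw [lintegral_one] at h
    rw [h, mul_one, mul_one, ← ENNReal.ofReal_add p.theta_div_pi_nonneg
      (sub_nonneg.2 p.theta_div_pi_le_one)]
    simp

instance : IsProbabilityMeasure (expMeasure p.mu) := isProbabilityMeasure_expMeasure p.mu_pos

instance : IsProbabilityMeasure (volume.restrict (Icc (0 : ℝ) 1)) := ⟨by simp⟩

/-- The factor `1 - (θ/π) μ / (μ + s G) - (1 - θ/π) μ / (μ + s g)` by which interferers of path
loss `s`, scaled by the argument of the Laplace functional, are thinned. -/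
def gainDefect (s : ℝ) : ℝ :=
  1 - (p.theta / Real.pi) * (p.mu / (p.mu + s * (p.Gb * p.Gv)))
    - (1 - p.theta / Real.pi) * (p.mu / (p.mu + s * (p.gb * p.gv)))

lemma lintegral_expNeg_fading_gain {s : ℝ} (hs : 0 ≤ s) :
    ∫⁻ m : ℝ × ℝ, 1 - expNeg (ENNReal.ofReal (m.1 * m.2 * s)) ∂((expMeasure p.mu).prod p.gainLaw) =
      ENNReal.ofReal (p.gainDefect s) := by
  have h1 := p.theta_div_pi_nonneg
  have h2 := sub_nonneg.2 p.theta_div_pi_le_one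
  have hG : 0 ≤ p.Gb * p.Gv := mul_nonneg p.Gb_pos.le p.Gv_pos.le
  have hg : 0 ≤ p.gb * p.gv := mul_nonneg p.gb_nonneg p.gv_nonneg
  have hmu := p.mu_pos
  have hm : Measurable fun m : ℝ × ℝ => expNeg (ENNReal.ofReal (m.1 * m.2 * s)) := by fun_prop
  have hval : ∫⁻ m : ℝ × ℝ, expNeg (ENNReal.ofReal (m.1 * m.2 * s))
      ∂((expMeasure p.mu).prod p.gainLaw) =
      ENNReal.ofReal (p.theta / Real.pi * (p.mu / (p.mu + s * (p.Gb * p.Gv))) +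
        (1 - p.theta / Real.pi) * (p.mu / (p.mu + s * (p.gb * p.gv)))) := by
    have hcomm : ∀ x d : ℝ, x * d * s = x * (s * d) := fun x d => by ring
    rw [lintegral_prod_symm _ hm.aemeasurable, lintegral_gainLaw]
    simp only [hcomm]
    rw [lintegral_expNeg_expMeasure hmu (by positivity),
      lintegral_expNeg_expMeasure hmu (by positivity), ← ENNReal.ofReal_mul h1,
      ← ENNReal.ofReal_mul h2, ← ENNReal.ofReal_add (by positivity) (by positivity)]
  rw [lintegral_sub hm (hval ▸ ENNReal.ofReal_ne_top)
    (Filter.Eventually.of_forall fun m => expNeg_le_one _), hval, lintegral_one, measure_univ,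
    ← ENNReal.ofReal_one, ← ENNReal.ofReal_sub _ (by positivity), gainDefect, sub_sub]

lemma gainDefect_nonneg {s : ℝ} (hs : 0 ≤ s) : 0 ≤ p.gainDefect s := by
  have h1 := p.theta_div_pi_nonneg
  have h2 := sub_nonneg.2 p.theta_div_pi_le_one
  have hmu := p.mu_pos
  have hG : p.mu / (p.mu + s * (p.Gb * p.Gv)) ≤ 1 :=
    div_le_one_of_le₀ (le_add_of_nonneg_right (mul_nonneg hs (mul_nonneg p.Gb_pos.le p.Gv_pos.le)))
      (add_nonneg hmu.le (mul_nonneg hs (mul_nonneg p.Gb_pos.le p.Gv_pos.le)))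
  have hg : p.mu / (p.mu + s * (p.gb * p.gv)) ≤ 1 :=
    div_le_one_of_le₀ (le_add_of_nonneg_right (mul_nonneg hs (mul_nonneg p.gb_nonneg p.gv_nonneg)))
      (add_nonneg hmu.le (mul_nonneg hs (mul_nonneg p.gb_nonneg p.gv_nonneg)))
  rw [gainDefect]
  nlinarith [mul_le_mul_of_nonneg_left hG h1, mul_le_mul_of_nonneg_left hg h2]

/-! ### Geometry of the road -/

lemma W_le_dist (x : ℝ) : p.W ≤ p.dist x :=
  Real.le_sqrt_of_sq_le (by nlinarith [sq_nonneg x])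

lemma dist_pos (x : ℝ) : 0 < p.dist x := p.W_pos.trans_le (p.W_le_dist x)

lemma le_dist (x : ℝ) : x ≤ p.dist x :=
  Real.le_sqrt_of_sq_le (by nlinarith [sq_nonneg p.W])

lemma dist_neg (x : ℝ) : p.dist (-x) = p.dist x := by rw [dist, dist, neg_sq]

@[fun_prop]
lemma continuous_dist : Continuous p.dist := by unfold dist; fun_prop

@[fun_prop]
lemma measurable_dist : Measurable p.dist := p.continuous_dist.measurable

lemma dist_le_iff {x r : ℝ} (hx : 0 < x) (hr : 0 ≤ r) : p.dist x ≤ r ↔ x ≤ p.b r := by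
  rw [dist, b, Real.sqrt_le_left hr, Real.le_sqrt' hx]
  constructor <;> intro h <;> linarith

lemma pathLoss_pos (i : LinkState) {r : ℝ} (hr : 0 < r) : 0 < p.pathLoss i r :=
  mul_pos (p.C_pos i) (Real.rpow_pos_of_pos hr _)

@[fun_prop]
lemma measurable_pathLoss (i : LinkState) : Measurable (p.pathLoss i) := by
  unfold pathLoss; fun_prop

lemma alpha_pos (i : LinkState) : 0 < p.alpha i := one_pos.trans (p.one_lt_alpha i)

/-- The inverse of the path loss, an increasing function of the distance. -/
lemma inv_pathLoss (i : LinkState) {r : ℝ} (hr : 0 < r) :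
    (p.pathLoss i r)⁻¹ = r ^ p.alpha i / p.C i := by
  rw [pathLoss, Real.rpow_neg hr.le, mul_inv, inv_inv, div_eq_inv_mul]

lemma exclusion_pos (i j : LinkState) {r : ℝ} (hr : 0 < r) : 0 < p.exclusion i j r := by
  unfold exclusion
  split_ifs
  · exact hr
  · have := p.C_pos i; have := p.C_pos i.other
    unfold A
    positivity

lemma inv_pathLoss_exclusion (i j : LinkState) {r : ℝ} (hr : 0 < r) :
    (p.pathLoss j (p.exclusion i j r))⁻¹ = (p.pathLoss i r)⁻¹ := by
  rw [p.inv_pathLoss j (p.exclusion_pos i j hr), p.inv_pathLoss i hr]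
  unfold exclusion
  split_ifs with h
  · rw [h]
  · have hj : i.other = j := by cases i <;> cases j <;> simp_all [LinkState.other]
    have hC := p.C_pos i
    have hC' := p.C_pos i.other
    rw [A, hj, ← Real.rpow_mul (by rw [← hj]; positivity), one_div_mul_cancel (p.alpha_pos j).ne',
      Real.rpow_one]
    have := p.C_pos j
    field_simp

/-- The stations of state `j` with at least the path loss of one of state `i` at distance `r` are
those within distance `exclusion i j r`. -/
lemma inv_pathLoss_le_iff (i j : LinkState) {r x : ℝ} (hr : 0 < r) (hx : 0 < x) :
    (p.pathLoss j x)⁻¹ ≤ (p.pathLoss i r)⁻¹ ↔ x ≤ p.exclusion i j r := by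
  rw [← p.inv_pathLoss_exclusion i j hr, p.inv_pathLoss j hx,
    p.inv_pathLoss j (p.exclusion_pos i j hr), div_le_div_iff_of_pos_right (p.C_pos j),
    Real.rpow_le_rpow_iff hx.le (p.exclusion_pos i j hr).le (p.alpha_pos j)]

/-- The path loss is integrable along the road, since the exponents exceed `1`. -/
lemma lintegral_pathLoss_ne_top (i : LinkState) :
    ∫⁻ x in Ioi 0, ENNReal.ofReal (p.pathLoss i (p.dist x)) ≠ ∞ := by
  have hα := p.alpha_pos i
  have hanti : ∀ x y : ℝ, 0 < x → x ≤ y → p.pathLoss i y ≤ p.pathLoss i x := fun x y hx hxy =>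
    mul_le_mul_of_nonneg_left (Real.rpow_le_rpow_of_nonpos hx hxy (by linarith)) (p.C_pos i).le
  have hint : IntegrableOn (p.pathLoss i) (Ioi 1) :=
    (integrableOn_Ioi_rpow_of_lt (by linarith [p.one_lt_alpha i]) one_pos).const_mul _
  have hfin := hint.lintegral_lt_top.ne
  rw [← Ioc_union_Ioi_eq_Ioi zero_le_one, lintegral_union measurableSet_Ioi
    (Set.disjoint_left.2 fun x hx hx' => absurd hx.2 (not_le.2 hx'))]
  refine ENNReal.add_ne_top.2 ⟨?_, ?_⟩
  · refine ne_top_of_le_ne_top (b := ∫⁻ _x in Ioc (0 : ℝ) 1, ENNReal.ofReal (p.pathLoss i p.W)) ?_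
      (setLIntegral_mono measurable_const fun x _ =>
        ENNReal.ofReal_le_ofReal (hanti _ _ p.W_pos (p.W_le_dist x)))
    rw [setLIntegral_const]
    simp
  · exact ne_top_of_le_ne_top hfin (setLIntegral_mono (by fun_prop) fun x (hx : 1 < x) =>
      ENNReal.ofReal_le_ofReal (hanti _ _ (one_pos.trans hx) (p.le_dist x)))

end Params

lemma lintegral_even {g : ℝ → ℝ≥0∞} (hg : ∀ x, g (-x) = g x) :
    ∫⁻ x, g x = 2 * ∫⁻ x in Ioi 0, g x := by
  have h : ∫⁻ x in Iio (0 : ℝ), g x = ∫⁻ x in Ioi (0 : ℝ), g x := by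
    have := (Measure.measurePreserving_neg (volume : Measure ℝ)).setLIntegral_comp_preimage_emb
      (MeasurableEquiv.neg ℝ).measurableEmbedding g (Iio 0)
    rw [← this]
    simp [hg]
  rw [← lintegral_add_compl g (measurableSet_Ioi (a := (0 : ℝ))), Set.compl_Ioi,
    ← setLIntegral_congr Iio_ae_eq_Iic, h, two_mul]

lemma setLIntegral_Icc_ite_le {a : ℝ} (h0 : 0 ≤ a) (h1 : a ≤ 1) (A B : ℝ≥0∞) :
    ∫⁻ u in Icc (0 : ℝ) 1, (if u ≤ a then A else B) =
      ENNReal.ofReal a * A + ENNReal.ofReal (1 - a) * B := by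
  have hU : Icc (0 : ℝ) 1 = Icc 0 a ∪ Ioc a 1 := (Icc_union_Ioc_eq_Icc h0 h1).symm
  rw [hU, lintegral_union measurableSet_Ioc
    (Set.disjoint_left.2 fun x hx hx' => absurd hx.2 (not_le.2 hx'.1)),
    setLIntegral_congr_fun (g := fun _ => A) measurableSet_Icc fun u hu => if_pos hu.2,
    setLIntegral_congr_fun (g := fun _ => B) measurableSet_Ioc fun u hu => if_neg (not_le.2 hu.1),
    setLIntegral_const, setLIntegral_const, Real.volume_Icc, Real.volume_Ioc, sub_zero, mul_comm A,
    mul_comm B]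

lemma LinkState.univ_eq : (Finset.univ : Finset LinkState) = {.los, .nlos} := rfl

lemma LinkState.sum_eq {M : Type*} [AddCommMonoid M] (f : LinkState → M) :
    ∑ i, f i = f .los + f .nlos := by
  rw [LinkState.univ_eq, Finset.sum_pair (by simp)]

lemma LinkState.prod_eq {M : Type*} [CommMonoid M] (f : LinkState → M) :
    ∏ i, f i = f .los * f .nlos := by
  rw [LinkState.univ_eq, Finset.prod_pair (by simp)]

instance : DiscreteMeasurableSpace LinkState := ⟨fun _ => trivial⟩

lemma measurable_linkState_apply {β γ : Type*} [MeasurableSpace β] [MeasurableSpace γ]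
    {ψ : LinkState → β → γ} (hψ : ∀ i, Measurable (ψ i)) {s : β → LinkState} (hs : Measurable s) :
    Measurable fun z => ψ (s z) z :=
  (measurable_from_prod_countable_right (f := fun q : LinkState × β => ψ q.1 q.2) hψ).comp
    (hs.prodMk measurable_id)

namespace Params

variable (p : Params)

/-! ### Base stations as points of a marked Poisson process -/

/-- State of a base station with given position and mark. A base station is encoded as a point
`(x, u, h, d)`: its position along the road, the uniform variable that decides its state, its power
fading and its antenna gain when it interferes. -/
def pointState (z : ℝ × ℝ × ℝ × ℝ) : LinkState :=
  if z.2.1 ≤ p.scenario.losProb |z.1| then .los else .nlos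

/-- Path loss component of a base station with given position and mark. -/
def pointPower (z : ℝ × ℝ × ℝ × ℝ) : ℝ := p.pathLoss (p.pointState z) (p.dist z.1)

/-- Inverse of the path loss component: the serving base station minimizes it. -/
def invPower (z : ℝ × ℝ × ℝ × ℝ) : ℝ := (p.pointPower z)⁻¹

/-- Interfering power received from a base station, if its state belongs to `S`. -/
def received (S : Set LinkState) (z : ℝ × ℝ × ℝ × ℝ) : ℝ≥0∞ :=
  {z | p.pointState z ∈ S}.indicator
    (fun z => ENNReal.ofReal (z.2.2.1 * z.2.2.2 * p.pointPower z)) z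

/-- Intensity measure of the process of base stations with their marks. -/
def intensity : Measure (ℝ × ℝ × ℝ × ℝ) :=
  (ENNReal.ofReal p.lamb • volume).prod
    ((volume.restrict (Icc (0 : ℝ) 1)).prod ((expMeasure p.mu).prod p.gainLaw))

@[fun_prop]
lemma measurable_pointState : Measurable p.pointState :=
  Measurable.ite (measurableSet_le (by fun_prop)
    (p.scenario.continuous_losProb.measurable.comp (by fun_prop))) measurable_const measurable_const

@[fun_prop]
lemma measurable_pointPower : Measurable p.pointPower :=
  measurable_linkState_apply (ψ := fun i (z : ℝ × ℝ × ℝ × ℝ) => p.pathLoss i (p.dist z.1))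
    (fun i => (p.measurable_pathLoss i).comp (p.measurable_dist.comp measurable_fst))
    p.measurable_pointState

@[fun_prop]
lemma measurable_invPower : Measurable p.invPower := p.measurable_pointPower.inv

@[fun_prop]
lemma measurable_received (S : Set LinkState) : Measurable (p.received S) :=
  Measurable.indicator (by fun_prop) (p.measurable_pointState (MeasurableSet.of_discrete (s := S)))

lemma received_of_mem {S : Set LinkState} {z : ℝ × ℝ × ℝ × ℝ} (h : p.pointState z ∈ S) :
    p.received S z = ENNReal.ofReal (z.2.2.1 * z.2.2.2 * p.pointPower z) :=
  Set.indicator_of_mem (s := {z | p.pointState z ∈ S}) h _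

lemma received_of_notMem {S : Set LinkState} {z : ℝ × ℝ × ℝ × ℝ} (h : p.pointState z ∉ S) :
    p.received S z = 0 :=
  Set.indicator_of_notMem (s := {z | p.pointState z ∈ S}) h _

lemma pointPower_pos (z : ℝ × ℝ × ℝ × ℝ) : 0 < p.pointPower z := p.pathLoss_pos _ (p.dist_pos _)

/-- Integration of a function of the state, the position and the remaining marks against the
intensity: independent thinning by the state, and reflection of the road at the vehicle. -/
lemma lintegral_intensity {ψ : LinkState → ℝ → ℝ × ℝ → ℝ≥0∞}
    (hψ : ∀ i, Measurable fun a : ℝ × ℝ × ℝ => ψ i a.1 a.2)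
    (heven : ∀ i x m, ψ i (-x) m = ψ i x m) :
    ∫⁻ z, ψ (p.pointState z) z.1 z.2.2 ∂p.intensity =
      ∑ i, ENNReal.ofReal (2 * p.lamb) * ∫⁻ x in Ioi 0, ENNReal.ofReal (p.scenario.prob i x) *
        ∫⁻ m, ψ i x m ∂((expMeasure p.mu).prod p.gainLaw) := by
  have hm : Measurable fun z : ℝ × ℝ × ℝ × ℝ => ψ (p.pointState z) z.1 z.2.2 :=
    measurable_linkState_apply (ψ := fun i z => ψ i z.1 z.2.2)
      (fun i => (hψ i).comp (g := fun a : ℝ × ℝ × ℝ => ψ i a.1 a.2)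
        (f := fun z : ℝ × ℝ × ℝ × ℝ => (z.1, z.2.2)) (by fun_prop)) p.measurable_pointState
  have hΨ : ∀ i, Measurable fun x => ∫⁻ m, ψ i x m ∂((expMeasure p.mu).prod p.gainLaw) :=
    fun i => (hψ i).lintegral_prod_right'
  have hprob : ∀ i, Measurable fun x => ENNReal.ofReal (p.scenario.prob i |x|) := fun i =>
    ((p.scenario.continuous_prob i).comp continuous_abs).measurable.ennreal_ofReal
  have hinner : ∀ x, ∫⁻ m, ψ (p.pointState (x, m)) x m.2
      ∂((volume.restrict (Icc (0 : ℝ) 1)).prod ((expMeasure p.mu).prod p.gainLaw)) =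
      ∑ i, ENNReal.ofReal (p.scenario.prob i |x|) *
        ∫⁻ m, ψ i x m ∂((expMeasure p.mu).prod p.gainLaw) := fun x => by
    rw [lintegral_prod (fun m : ℝ × ℝ × ℝ => ψ (p.pointState (x, m)) x m.2)
      (hm.comp (f := fun m => (x, m)) measurable_prodMk_left).aemeasurable, LinkState.sum_eq]
    simp only [Scenario.prob]
    rw [← setLIntegral_Icc_ite_le (p.scenario.losProb_pos _).le
      (p.scenario.losProb_le_one (abs_nonneg x))]
    refine lintegral_congr fun u => ?_
    by_cases hu : u ≤ p.scenario.losProb |x| <;> simp [pointState, hu]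
  have hterm : ∀ i, ∫⁻ x, ENNReal.ofReal (p.scenario.prob i |x|) *
      ∫⁻ m, ψ i x m ∂((expMeasure p.mu).prod p.gainLaw) =
      2 * ∫⁻ x in Ioi 0, ENNReal.ofReal (p.scenario.prob i x) *
        ∫⁻ m, ψ i x m ∂((expMeasure p.mu).prod p.gainLaw) := fun i => by
    rw [lintegral_even fun x => by simp only [abs_neg, heven]]
    congr 1
    exact setLIntegral_congr_fun measurableSet_Ioi fun x (hx : 0 < x) => by
      simp only [abs_of_pos hx]
  rw [intensity, lintegral_prod _ hm.aemeasurable, lintegral_smul_measure]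
  simp only [hinner]
  rw [lintegral_finsetSum (f := fun i x => ENNReal.ofReal (p.scenario.prob i |x|) *
    ∫⁻ m, ψ i x m ∂((expMeasure p.mu).prod p.gainLaw)) _ fun i _ => (hprob i).mul (hΨ i),
    smul_eq_mul, Finset.mul_sum]
  refine Finset.sum_congr rfl fun i _ => ?_
  rw [hterm, ← mul_assoc, mul_comm 2 p.lamb, ENNReal.ofReal_mul p.lamb_pos.le]
  simp

lemma intensity_setOf {A : LinkState → Set ℝ} (hA : ∀ i, MeasurableSet (A i))
    (heven : ∀ i x, -x ∈ A i ↔ x ∈ A i) :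
    p.intensity {z | z.1 ∈ A (p.pointState z)} =
      ∑ i, ENNReal.ofReal (2 * p.lamb) * ∫⁻ x in Ioi 0 ∩ A i,
        ENNReal.ofReal (p.scenario.prob i x) := by
  have h := p.lintegral_intensity (ψ := fun i x _ => (A i).indicator 1 x)
    (fun i => (measurable_one.indicator (hA i)).comp measurable_fst)
    (fun i x _ => Set.indicator_eq_indicator (heven i x) rfl)
  have hm : MeasurableSet {z | z.1 ∈ A (p.pointState z)} :=
    measurable_mem.1 (measurable_linkState_apply (ψ := fun i z => z.1 ∈ A i)
      (fun i => measurable_mem.2 (measurable_fst (hA i))) p.measurable_pointState)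
  rw [← lintegral_indicator_one hm]
  refine Eq.trans (lintegral_congr fun z => ?_) (h.trans (Finset.sum_congr rfl fun i _ => ?_))
  · exact Set.indicator_eq_indicator Iff.rfl rfl
  · rw [Set.inter_comm, ← Measure.restrict_restrict (hA i), ← lintegral_indicator (hA i)]
    congr 1
    refine lintegral_congr fun x => ?_
    by_cases hx : x ∈ A i <;> simp [hx]

lemma intensity_invPower_le_ne_top (t : ℝ) : p.intensity {z | p.invPower z ≤ t} ≠ ∞ := by
  have hm : ∀ i, MeasurableSet {x | (p.pathLoss i (p.dist x))⁻¹ ≤ t} := fun i =>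
    measurableSet_le (by fun_prop) measurable_const
  have h := p.intensity_setOf hm fun i x => by simp only [Set.mem_ofPred_eq, dist_neg]
  refine ne_of_eq_of_ne h (ENNReal.sum_ne_top.2 fun i _ => ENNReal.mul_ne_top
    ENNReal.ofReal_ne_top ?_)
  have hsub : Ioi 0 ∩ {x | (p.pathLoss i (p.dist x))⁻¹ ≤ t} ⊆
      Ioc 0 ((t * p.C i) ^ (1 / p.alpha i)) := fun x hx => by
    refine ⟨hx.1, (p.le_dist x).trans ?_⟩
    have h1 : (p.pathLoss i (p.dist x))⁻¹ ≤ t := hx.2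
    rw [p.inv_pathLoss i (p.dist_pos x), div_le_iff₀ (p.C_pos i)] at h1
    have h2 := Real.rpow_le_rpow (Real.rpow_nonneg (p.dist_pos x).le _) h1
      (one_div_nonneg.2 (p.alpha_pos i).le)
    rwa [← Real.rpow_mul (p.dist_pos x).le, mul_one_div_cancel (p.alpha_pos i).ne',
      Real.rpow_one] at h2
  refine ne_top_of_le_ne_top (b := ∫⁻ _x in Ioc 0 ((t * p.C i) ^ (1 / p.alpha i)), 1) ?_
    ((lintegral_mono_set hsub).trans (setLIntegral_mono measurable_const fun x hx => ?_))
  · rw [setLIntegral_one, Real.volume_Ioc]; exact ENNReal.ofReal_ne_top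
  · exact ENNReal.ofReal_le_one.2 (p.scenario.prob_le_one i hx.1.le)

lemma intensity_invPower_eq (t : ℝ) : p.intensity {z | p.invPower z = t} = 0 := by
  have hm : ∀ i, MeasurableSet {x | (p.pathLoss i (p.dist x))⁻¹ = t} := fun i =>
    measurableSet_eq_fun (by fun_prop) measurable_const
  have h := p.intensity_setOf hm fun i x => by simp only [Set.mem_ofPred_eq, dist_neg]
  refine h.trans (Finset.sum_eq_zero fun i _ => ?_)
  have hsub : (Ioi 0 ∩ {x | (p.pathLoss i (p.dist x))⁻¹ = t}).Subsingleton := by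
    have hle : ∀ x y : ℝ, 0 < x → 0 < y → (p.pathLoss i (p.dist x))⁻¹ = t →
        (p.pathLoss i (p.dist y))⁻¹ = t → x ≤ y := fun x y hx hy h1 h2 => by
      have h3 := (p.inv_pathLoss_le_iff i i (p.dist_pos y) (p.dist_pos x)).1 (h1.trans h2.symm).le
      rw [exclusion, if_pos rfl, dist, dist, Real.sqrt_le_sqrt_iff (by positivity)] at h3
      exact (pow_le_pow_iff_left₀ hx.le hy.le two_ne_zero).1 (by linarith)
    exact fun x hx y hy => le_antisymm (hle x y hx.1 hy.1 hx.2 hy.2) (hle y x hy.1 hx.1 hy.2 hx.2)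
  rw [setLIntegral_measure_zero _ _ (hsub.measure_zero volume), mul_zero]

lemma lintegral_fading_gain {s : ℝ} (hs : 0 ≤ s) :
    ∫⁻ m : ℝ × ℝ, ENNReal.ofReal (m.1 * m.2 * s) ∂((expMeasure p.mu).prod p.gainLaw) =
      (∫⁻ x, ENNReal.ofReal x ∂(expMeasure p.mu)) *
        (ENNReal.ofReal (p.theta / Real.pi) * ENNReal.ofReal (p.Gb * p.Gv) +
          ENNReal.ofReal (1 - p.theta / Real.pi) * ENNReal.ofReal (p.gb * p.gv)) *
        ENNReal.ofReal s := by
  have hG : 0 ≤ p.Gb * p.Gv := mul_nonneg p.Gb_pos.le p.Gv_pos.le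
  have hg : 0 ≤ p.gb * p.gv := mul_nonneg p.gb_nonneg p.gv_nonneg
  rw [lintegral_prod_symm _ (by fun_prop), lintegral_gainLaw]
  simp only [ENNReal.ofReal_mul' hs, ENNReal.ofReal_mul' hG, ENNReal.ofReal_mul' hg]
  rw [lintegral_mul_const _ (by fun_prop), lintegral_mul_const _ (by fun_prop),
    lintegral_mul_const _ (by fun_prop), lintegral_mul_const _ (by fun_prop)]
  ring

lemma lintegral_received_ne_top (S : Set LinkState) :
    ∫⁻ z, p.received S z ∂p.intensity ≠ ∞ := by
  have hle : ∫⁻ z, p.received S z ∂p.intensity ≤ ∫⁻ z, ENNReal.ofReal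
      (z.2.2.1 * z.2.2.2 * p.pathLoss (p.pointState z) (p.dist z.1)) ∂p.intensity :=
    lintegral_mono fun z => Set.indicator_le_self' (fun _ _ => zero_le) z
  refine ne_top_of_le_ne_top ?_ hle
  rw [p.lintegral_intensity (ψ := fun i x m => ENNReal.ofReal
    (m.1 * m.2 * p.pathLoss i (p.dist x))) (fun i => by fun_prop)
    (fun i x m => by simp only [dist_neg])]
  refine ENNReal.sum_ne_top.2 fun i _ => ENNReal.mul_ne_top ENNReal.ofReal_ne_top ?_
  simp only [p.lintegral_fading_gain (p.pathLoss_pos i (p.dist_pos _)).le]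
  refine ne_top_of_le_ne_top ?_ (setLIntegral_mono (by fun_prop) fun x (hx : 0 < x) =>
    mul_le_of_le_one_left' (ENNReal.ofReal_le_one.2 (p.scenario.prob_le_one i hx.le)))
  rw [lintegral_const_mul _ (by fun_prop)]
  have h1 := lintegral_ofReal_expMeasure_ne_top p.mu_pos
  have h2 := p.lintegral_pathLoss_ne_top i
  finiteness

/-! ### The exponent of the first point in terms of void probabilities and Laplace functionals -/

lemma gainDefect_le {s : ℝ} (hs : 0 ≤ s) :
    p.gainDefect s ≤ (p.Gb * p.Gv + p.gb * p.gv) / p.mu * s := by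
  have h1 := p.theta_div_pi_nonneg
  have h2 := sub_nonneg.2 p.theta_div_pi_le_one
  have hmu := p.mu_pos
  have key : ∀ G : ℝ, 0 ≤ G → 1 - p.mu / (p.mu + s * G) ≤ G / p.mu * s := fun G hG => by
    have hpos : 0 < p.mu + s * G := by positivity
    rw [one_sub_div hpos.ne', add_sub_cancel_left, div_mul_eq_mul_div, mul_comm G s]
    exact div_le_div_of_nonneg_left (by positivity) hmu (le_add_of_nonneg_right (by positivity))
  have hG := mul_nonneg p.Gb_pos.le p.Gv_pos.le
  have hg := mul_nonneg p.gb_nonneg p.gv_nonneg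
  have k1 := mul_le_mul_of_nonneg_left (key _ hG) h1
  have k2 := mul_le_mul_of_nonneg_left (key _ hg) h2
  have k3 : p.theta / Real.pi * (p.Gb * p.Gv / p.mu * s) ≤ p.Gb * p.Gv / p.mu * s :=
    mul_le_of_le_one_left (by positivity) p.theta_div_pi_le_one
  have k4 : (1 - p.theta / Real.pi) * (p.gb * p.gv / p.mu * s) ≤ p.gb * p.gv / p.mu * s :=
    mul_le_of_le_one_left (by positivity) (by linarith)
  rw [gainDefect, add_div, add_mul]
  linarith

@[fun_prop]
lemma measurable_gainDefect : Measurable p.gainDefect := by unfold gainDefect; fun_prop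

lemma expNeg_void (j : LinkState) (ρ : ℝ) :
    expNeg (ENNReal.ofReal (2 * p.lamb) * ∫⁻ x in Ioc 0 (p.b ρ),
      ENNReal.ofReal (p.scenario.prob j x)) = ENNReal.ofReal (p.voidProb j ρ) := by
  have hb : 0 ≤ p.b ρ := Real.sqrt_nonneg _
  have hlam := p.lamb_pos
  have hint : IntegrableOn (p.scenario.prob j) (Ioc 0 (p.b ρ)) :=
    ((p.scenario.continuous_prob j).intervalIntegrable 0 (p.b ρ)).1
  have hnn : 0 ≤ᵐ[volume.restrict (Ioc 0 (p.b ρ))] p.scenario.prob j :=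
    (ae_restrict_mem measurableSet_Ioc).mono fun x hx => p.scenario.prob_nonneg j hx.1.le
  rw [← ofReal_integral_eq_lintegral_ofReal hint hnn, ← ENNReal.ofReal_mul (by positivity),
    expNeg_ofReal (mul_nonneg (by positivity) (integral_nonneg_of_ae hnn)), voidProb,
    intervalIntegral.integral_of_le hb]

lemma expNeg_laplace (i j : LinkState) (r : ℝ) {t : ℝ} (ht : 0 ≤ t) :
    expNeg (ENNReal.ofReal (2 * p.lamb) * ∫⁻ x in Ioi (p.b (p.exclusion i j r)),
      ENNReal.ofReal (p.scenario.prob j x) *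
        ENNReal.ofReal (p.gainDefect (t * p.pathLoss j (p.dist x)))) =
      ENNReal.ofReal (p.laplace i j r t) := by
  set c := p.b (p.exclusion i j r) with hc
  have hb : 0 ≤ c := Real.sqrt_nonneg _
  have hlam := p.lamb_pos
  have hpl : ∀ x, 0 ≤ t * p.pathLoss j (p.dist x) := fun x =>
    mul_nonneg ht (p.pathLoss_pos j (p.dist_pos x)).le
  have hpm := (p.scenario.continuous_prob j).measurable
  have hm : Measurable fun x => p.gainDefect (t * p.pathLoss j (p.dist x)) * p.scenario.prob j x :=
    Measurable.mul (by fun_prop) hpm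
  have hnn : 0 ≤ᵐ[volume.restrict (Ioi c)]
      fun x => p.gainDefect (t * p.pathLoss j (p.dist x)) * p.scenario.prob j x :=
    (ae_restrict_mem measurableSet_Ioi).mono fun x hx => mul_nonneg (p.gainDefect_nonneg (hpl x))
      (p.scenario.prob_nonneg j (hb.trans (le_of_lt hx)))
  have hpint : IntegrableOn (fun x => p.pathLoss j (p.dist x)) (Ioi c) := by
    refine IntegrableOn.mono_set (t := Ioi 0) ⟨?_, ?_⟩ (Ioi_subset_Ioi hb)
    · exact (by fun_prop : Measurable fun x => p.pathLoss j (p.dist x)).aestronglyMeasurable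
    · rw [hasFiniteIntegral_iff_ofReal (Filter.Eventually.of_forall fun x =>
        (p.pathLoss_pos j (p.dist_pos x)).le)]
      exact lt_top_iff_ne_top.2 (p.lintegral_pathLoss_ne_top j)
  have hint : IntegrableOn (fun x => p.gainDefect (t * p.pathLoss j (p.dist x)) *
      p.scenario.prob j x) (Ioi c) := by
    refine Integrable.mono' ((hpint.const_mul t).const_mul ((p.Gb * p.Gv + p.gb * p.gv) / p.mu))
      hm.aestronglyMeasurable ((ae_restrict_mem measurableSet_Ioi).mono fun x hx => ?_)
    have hx0 : 0 ≤ x := hb.trans (le_of_lt hx)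
    rw [Real.norm_of_nonneg (mul_nonneg (p.gainDefect_nonneg (hpl x))
      (p.scenario.prob_nonneg j hx0))]
    exact (mul_le_of_le_one_right (p.gainDefect_nonneg (hpl x))
      (p.scenario.prob_le_one j hx0)).trans (p.gainDefect_le (hpl x))
  have hcongr : ∫⁻ x in Ioi c, ENNReal.ofReal (p.scenario.prob j x) *
      ENNReal.ofReal (p.gainDefect (t * p.pathLoss j (p.dist x))) =
      ∫⁻ x in Ioi c, ENNReal.ofReal (p.gainDefect (t * p.pathLoss j (p.dist x)) *
        p.scenario.prob j x) :=
    lintegral_congr fun x => by rw [ENNReal.ofReal_mul (p.gainDefect_nonneg (hpl x)), mul_comm]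
  rw [hcongr, ← ofReal_integral_eq_lintegral_ofReal hint hnn, ← ENNReal.ofReal_mul (by positivity),
    expNeg_ofReal (mul_nonneg (by positivity) (integral_nonneg_of_ae hnn)), laplace]
  simp only [gainDefect, mul_assoc, mul_left_comm, mul_comm, hc]

open Classical in
/-- Evaluation of the exponent in `HasPoissonLaplace.lintegral_first` for the network: the region
up to the serving station, at distance `r` and in state `i`, contributes the void probabilities,
the region beyond it the Laplace functionals of the interference. -/
lemma expNeg_barrier (S : Set LinkState) (q : ℝ → ℝ≥0) (i : LinkState) {r : ℝ} (hr : 0 < r) :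
    expNeg (∫⁻ z, 1 - expNeg (barrier p.invPower q (p.received S) (p.pathLoss i r)⁻¹ z)
      ∂p.intensity) =
    ∏ j, (ENNReal.ofReal (p.voidProb j (p.exclusion i j r)) *
      if j ∈ S then ENNReal.ofReal (p.laplace i j r (q (p.pathLoss i r)⁻¹)) else 1) := by
  set t := (p.pathLoss i r)⁻¹ with ht
  obtain ⟨s, hs⟩ : ∃ s : ℝ, s = q t := ⟨_, rfl⟩
  have hs0 : 0 ≤ s := hs ▸ NNReal.zero_le_coe
  have hpl : ∀ j x, 0 ≤ s * p.pathLoss j (p.dist x) := fun j x =>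
    mul_nonneg hs0 (p.pathLoss_pos j (p.dist_pos x)).le
  have hfun : ∀ z, 1 - expNeg (barrier p.invPower q (p.received S) t z) =
      (fun j x (m : ℝ × ℝ) => if (p.pathLoss j (p.dist x))⁻¹ ≤ t then 1 else if j ∈ S then
        1 - expNeg (ENNReal.ofReal (m.1 * m.2 * (s * p.pathLoss j (p.dist x)))) else 0)
        (p.pointState z) z.1 z.2.2 := fun z => by
    have h1 : p.invPower z = (p.pathLoss (p.pointState z) (p.dist z.1))⁻¹ := rfl
    simp only [barrier, h1]
    split_ifs with h2 h3
    · simp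
    · have h4 : p.received S z = ENNReal.ofReal (z.2.2.1 * z.2.2.2 *
          p.pathLoss (p.pointState z) (p.dist z.1)) := p.received_of_mem h3
      rw [h4, ← ENNReal.ofReal_coe_nnreal, ← hs, ← ENNReal.ofReal_mul hs0]
      congr 3
      ring
    · rw [p.received_of_notMem h3]
      simp
  have hmψ : ∀ j, Measurable fun a : ℝ × ℝ × ℝ => if (p.pathLoss j (p.dist a.1))⁻¹ ≤ t then
      (1 : ℝ≥0∞) else if j ∈ S then
        1 - expNeg (ENNReal.ofReal (a.2.1 * a.2.2 * (s * p.pathLoss j (p.dist a.1)))) else 0 := by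
    intro j
    refine Measurable.ite (measurableSet_le (by fun_prop) measurable_const) measurable_const ?_
    split_ifs
    · exact Measurable.const_sub (by fun_prop) 1
    · exact measurable_const
  rw [← hs, lintegral_congr hfun]
  refine (congrArg expNeg (p.lintegral_intensity (ψ := fun j x m =>
    if (p.pathLoss j (p.dist x))⁻¹ ≤ t then 1 else if j ∈ S then
      1 - expNeg (ENNReal.ofReal (m.1 * m.2 * (s * p.pathLoss j (p.dist x)))) else 0)
    hmψ (fun j x m => by simp only [dist_neg]))).trans ?_
  rw [expNeg_sum]
  refine Finset.prod_congr rfl fun j _ => ?_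
  set c := p.b (p.exclusion i j r) with hc
  have hc0 : 0 ≤ c := Real.sqrt_nonneg _
  have hiff : ∀ x, 0 < x → ((p.pathLoss j (p.dist x))⁻¹ ≤ t ↔ x ≤ c) := fun x hx => by
    rw [ht, p.inv_pathLoss_le_iff i j hr (p.dist_pos x),
      p.dist_le_iff hx (p.exclusion_pos i j hr).le]
  have hin : ∫⁻ x in Ioc 0 c, ENNReal.ofReal (p.scenario.prob j x) *
      ∫⁻ m : ℝ × ℝ, (if (p.pathLoss j (p.dist x))⁻¹ ≤ t then (1 : ℝ≥0∞) else if j ∈ S then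
        1 - expNeg (ENNReal.ofReal (m.1 * m.2 * (s * p.pathLoss j (p.dist x)))) else 0)
        ∂((expMeasure p.mu).prod p.gainLaw) =
      ∫⁻ x in Ioc 0 c, ENNReal.ofReal (p.scenario.prob j x) :=
    setLIntegral_congr_fun measurableSet_Ioc fun x hx => by
      simp [(hiff x hx.1).2 hx.2]
  have hout : ∫⁻ x in Ioi c, ENNReal.ofReal (p.scenario.prob j x) *
      ∫⁻ m : ℝ × ℝ, (if (p.pathLoss j (p.dist x))⁻¹ ≤ t then (1 : ℝ≥0∞) else if j ∈ S then
        1 - expNeg (ENNReal.ofReal (m.1 * m.2 * (s * p.pathLoss j (p.dist x)))) else 0)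
        ∂((expMeasure p.mu).prod p.gainLaw) =
      if j ∈ S then ∫⁻ x in Ioi c, ENNReal.ofReal (p.scenario.prob j x) *
        ENNReal.ofReal (p.gainDefect (s * p.pathLoss j (p.dist x))) else 0 := by
    have hnot : ∀ x ∈ Ioi c, ¬ (p.pathLoss j (p.dist x))⁻¹ ≤ t := fun x hx =>
      (hiff x (hc0.trans_lt hx)).not.2 (not_le.2 hx)
    split_ifs with hj
    · refine setLIntegral_congr_fun measurableSet_Ioi fun x hx => ?_
      simp only [hnot x hx, if_false]
      rw [p.lintegral_expNeg_fading_gain (hpl j x)]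
    · rw [setLIntegral_congr_fun (g := fun _ => 0) measurableSet_Ioi fun x hx => by
        simp [hnot x hx], lintegral_zero]
  rw [← Ioc_union_Ioi_eq_Ioi hc0, lintegral_union measurableSet_Ioi
    (Set.disjoint_left.2 fun x hx hx' => absurd hx.2 (not_le.2 hx')), hin, hout, mul_add,
    expNeg_add, expNeg_void]
  congr 1
  split_ifs with hj
  · exact p.expNeg_laplace i j r hs0
  · simp

end Params

/-! ### Independence of the fading of one station from all other data -/

lemma indepFun_prodMk_of_indepFun {Ω α β γ : Type*} [MeasurableSpace Ω] [MeasurableSpace α]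
    [MeasurableSpace β] [MeasurableSpace γ] {P : Measure Ω} [IsProbabilityMeasure P]
    {f : Ω → α} {g : Ω → β} {k : Ω → γ} (hf : Measurable f) (hg : Measurable g)
    (hk : Measurable k) (h1 : IndepFun f (fun ω => (g ω, k ω)) P) (h2 : IndepFun g k P) :
    IndepFun g (fun ω => (f ω, k ω)) P := by
  rw [indepFun_iff_map_prod_eq_prod_map_map hg.aemeasurable (hf.prodMk hk).aemeasurable]
  have : IsProbabilityMeasure (P.map g) := Measure.isProbabilityMeasure_map hg.aemeasurable
  have : IsProbabilityMeasure (P.map fun ω => (f ω, k ω)) :=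
    Measure.isProbabilityMeasure_map (hf.prodMk hk).aemeasurable
  have : IsProbabilityMeasure (P.map fun ω => (g ω, f ω, k ω)) :=
    Measure.isProbabilityMeasure_map (hg.prodMk (hf.prodMk hk)).aemeasurable
  refine Measure.ext_prod₃ fun {s t u} hs ht hu => ?_
  have e1 := h1.measure_inter_preimage_eq_mul t (s ×ˢ u) ht (hs.prod hu)
  have e2 := h2.measure_inter_preimage_eq_mul s u hs hu
  have e3 := (h1.comp measurable_id measurable_snd).measure_inter_preimage_eq_mul t u ht hu
  rw [Measure.map_apply (hg.prodMk (hf.prodMk hk)) (hs.prod (ht.prod hu)), Measure.prod_prod,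
    Measure.map_apply hg hs, Measure.map_apply (hf.prodMk hk) (ht.prod hu)]
  have s1 : (fun ω => (g ω, f ω, k ω)) ⁻¹' s ×ˢ t ×ˢ u =
      f ⁻¹' t ∩ (fun ω => (g ω, k ω)) ⁻¹' s ×ˢ u := by
    ext ω; simp only [mem_preimage, mem_prod, mem_inter_iff]; tauto
  have s2 : (fun ω => (g ω, k ω)) ⁻¹' s ×ˢ u = g ⁻¹' s ∩ k ⁻¹' u := rfl
  have s3 : (fun ω => (f ω, k ω)) ⁻¹' t ×ˢ u = f ⁻¹' t ∩ k ⁻¹' u := rfl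
  have e3' : P (f ⁻¹' t ∩ k ⁻¹' u) = P (f ⁻¹' t) * P (k ⁻¹' u) := e3
  rw [s1, e1, s2, e2, s3, e3']
  ring

lemma iIndepFun.indepFun_compl {Ω ι β : Type*} [MeasurableSpace Ω] [MeasurableSpace β]
    {P : Measure Ω} {M : ι → Ω → β} (h : iIndepFun M P) (hM : ∀ i, Measurable (M i)) (n : ι) :
    IndepFun (M n) (fun ω (i : {i // i ≠ n}) => M i ω) P := by
  have h1 := indep_iSup_of_disjoint (fun i => (hM i).comap_le) h.iIndep
    (S := {n}) (T := {n}ᶜ) disjoint_compl_right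
  refine indep_of_indep_of_le h1 ?_ ?_
  · exact le_iSup₂_of_le (f := fun i (_ : i ∈ ({n} : Set ι)) => MeasurableSpace.comap (M i) _)
      n rfl le_rfl
  · rw [MeasurableSpace.pi, MeasurableSpace.comap_iSup]
    refine iSup_le fun i => ?_
    rw [MeasurableSpace.comap_comp]
    exact le_iSup₂_of_le (f := fun j (_ : j ∈ ({n}ᶜ : Set ι)) => MeasurableSpace.comap (M j) _)
      (i : ι) i.2 le_rfl

/-- Averaging over a variable that is independent of the rest. -/
lemma lintegral_eq_of_indepFun {Ω α β : Type*} [MeasurableSpace Ω] [MeasurableSpace α]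
    [MeasurableSpace β] {P : Measure Ω} [IsProbabilityMeasure P] {f : Ω → α} {g : Ω → β}
    (hf : Measurable f) (hg : Measurable g) (h : IndepFun f g P) {F : β × α → ℝ≥0∞}
    (hF : Measurable F) :
    ∫⁻ ω, F (g ω, f ω) ∂P = ∫⁻ ω, ∫⁻ x, F (g ω, x) ∂(P.map f) ∂P := by
  have : IsProbabilityMeasure (P.map f) := Measure.isProbabilityMeasure_map hf.aemeasurable
  have : IsProbabilityMeasure (P.map g) := Measure.isProbabilityMeasure_map hg.aemeasurable
  rw [← lintegral_map hF (hg.prodMk hf),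
    (indepFun_iff_map_prod_eq_prod_map_map hg.aemeasurable hf.aemeasurable).1 h.symm,
    lintegral_prod _ hF.aemeasurable, lintegral_map hF.lintegral_prod_right' hg]

lemma indepFun_of_map_eq_prod {Ω α β : Type*} [MeasurableSpace Ω] [MeasurableSpace α]
    [MeasurableSpace β] {P : Measure Ω} {μ : Measure α} {ν : Measure β} [IsProbabilityMeasure P]
    [IsProbabilityMeasure μ] [IsProbabilityMeasure ν] {f : Ω → α} {g : Ω → β} (hf : Measurable f)
    (hg : Measurable g) (h : P.map (fun ω => (f ω, g ω)) = μ.prod ν) :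
    IndepFun f g P ∧ P.map f = μ ∧ P.map g = ν := by
  have h1 : P.map f = μ := by
    have : P.map f = (P.map fun ω => (f ω, g ω)).map Prod.fst :=
      (Measure.map_map measurable_fst (hf.prodMk hg)).symm
    rw [this, h, Measure.map_fst_prod, measure_univ, one_smul]
  have h2 : P.map g = ν := by
    have : P.map g = (P.map fun ω => (f ω, g ω)).map Prod.snd :=
      (Measure.map_map measurable_snd (hf.prodMk hg)).symm
    rw [this, h, Measure.map_snd_prod, measure_univ, one_smul]
  refine ⟨?_, h1, h2⟩
  rw [indepFun_iff_map_prod_eq_prod_map_map hf.aemeasurable hg.aemeasurable, h, h1, h2]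

lemma IsPoissonProcess.hasPoissonLaplace {Ω : Type*} [MeasurableSpace Ω] {P : Measure Ω}
    [IsProbabilityMeasure P] {lamb : ℝ} {X : ℕ → Ω → ℝ} (hX : IsPoissonProcess P lamb X) :
    HasPoissonLaplace P X (ENNReal.ofReal lamb • volume) :=
  ⟨hX.measurable, fun _ hf => hX.laplace hf⟩

lemma Params.measurable_serving {Ω : Type*} [MeasurableSpace Ω] (p : Params) {X U : ℕ → Ω → ℝ}
    (hX : ∀ n, Measurable (X n)) (hU : ∀ n, Measurable (U n)) : Measurable (p.serving X U) := by
  classical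
  have hpow : ∀ n, Measurable (p.avgPower X U n) := fun n =>
    p.measurable_pointPower.comp
      (f := fun ω => (X n ω, U n ω, 0, 0)) ((hX n).prodMk ((hU n).prodMk measurable_const))
  let A : ℕ → Set Ω := fun n => {ω | ∀ m, p.avgPower X U m ω ≤ p.avgPower X U n ω}
  have mA : ∀ n, MeasurableSet (A n) := fun n => by
    simp only [A, Set.ofPred_forall]
    exact MeasurableSet.iInter fun m => measurableSet_le (hpow m) (hpow n)
  have hex : ∀ ω, ∃ n, ω ∈ A n ∨ ∀ k, ω ∉ A k := fun ω => by
    by_cases h : ∃ n, ω ∈ A n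
    · exact h.imp fun n hn => Or.inl hn
    · exact ⟨0, Or.inr (not_exists.1 h)⟩
  have hfind : p.serving X U = fun ω => Nat.find (hex ω) := funext fun ω => by
    refine ((Nat.find_eq_iff (hex ω)).2 ⟨?_, fun n hn => ?_⟩).symm
    · by_cases h : ∃ n, ω ∈ A n
      · exact Or.inl (Nat.sInf_mem h)
      · exact Or.inr (not_exists.1 h)
    · rintro (h | h)
      · exact Nat.notMem_of_lt_sInf hn h
      · have : {n | ∀ m, p.avgPower X U m ω ≤ p.avgPower X U n ω} = ∅ :=
          Set.eq_empty_of_forall_notMem h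
        rw [serving, this, Nat.sInf_empty] at hn
        exact absurd hn (Nat.not_lt_zero n)
  rw [hfind]
  refine measurable_find hex fun n => (mA n).union ?_
  have : {ω | ∀ k, ω ∉ A k} = ⋂ k, (A k)ᶜ := by ext; simp
  change MeasurableSet {ω | ∀ k, ω ∉ A k}
  rw [this]
  exact MeasurableSet.iInter fun k => (mA k).compl

/-- A base station with its marks. -/
def station {Ω : Type*} (X U h D : ℕ → Ω → ℝ) (n : ℕ) (ω : Ω) : ℝ × ℝ × ℝ × ℝ :=
  (X n ω, U n ω, h n ω, D n ω)

lemma Params.interference_eq {Ω : Type*} (p : Params) (X U h D : ℕ → Ω → ℝ) (j : LinkState)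
    (ω : Ω) : p.interference X U h D j ω =
      sumOthers (p.received {j}) (fun n => station X U h D n ω) (p.serving X U ω) := by
  refine tsum_congr fun n => ?_
  by_cases h1 : n = p.serving X U ω
  · simp [h1]
  by_cases h2 : p.state X U n ω = j
  · rw [if_pos ⟨h1, h2⟩, if_pos h1, p.received_of_mem (show p.pointState (station X U h D n ω) ∈
      ({j} : Set LinkState) from h2)]
    rfl
  · rw [if_neg (fun h => h2 h.2), if_pos h1, p.received_of_notMem (show p.pointState
      (station X U h D n ω) ∉ ({j} : Set LinkState) from h2)]

lemma Params.interference_add {Ω : Type*} (p : Params) (X U h D : ℕ → Ω → ℝ) (ω : Ω) :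
    p.interference X U h D .los ω + p.interference X U h D .nlos ω =
      sumOthers (p.received univ) (fun n => station X U h D n ω) (p.serving X U ω) := by
  rw [p.interference_eq, p.interference_eq, sumOthers, sumOthers, ← ENNReal.tsum_add]
  refine tsum_congr fun n => ?_
  split_ifs with h1
  · rw [p.received_of_mem (S := univ) (mem_univ _)]
    rcases hs : p.pointState (station X U h D n ω) with _ | _
    · rw [p.received_of_mem (by simp [hs]), p.received_of_notMem (by simp [hs]), add_zero]
    · rw [p.received_of_notMem (by simp [hs]), p.received_of_mem (by simp [hs]), zero_add]
  · simp

namespace IsNetwork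

variable {Ω : Type*} [MeasurableSpace Ω] {P : Measure Ω} {p : Params}
  {X U h D : ℕ → Ω → ℝ}

lemma hasPoissonLaplace [IsProbabilityMeasure P] (hN : IsNetwork P p X U h D) :
    HasPoissonLaplace P (station X U h D) p.intensity :=
  hN.poisson.hasPoissonLaplace.prodMk
    (fun n => (hN.measurable_U n).prodMk ((hN.measurable_h n).prodMk (hN.measurable_D n)))
    hN.mark_law hN.mark_indep hN.indep

lemma measurable_serving (hN : IsNetwork P p X U h D) : Measurable (p.serving X U) :=
  p.measurable_serving hN.poisson.measurable hN.measurable_U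

/-- Almost surely, a serving base station exists: only finitely many stations beat a given one. -/
lemma ae_serving_min [IsProbabilityMeasure P] (hN : IsNetwork P p X U h D) :
    ∀ᵐ ω ∂P, ∀ m, p.invPower (station X U h D (p.serving X U ω) ω) ≤
      p.invPower (station X U h D m ω) := by
  have hloc : ∀ᵐ ω ∂P, ∀ K : ℕ, {n | station X U h D n ω ∈ {z | p.invPower z ≤ K}}.Finite :=
    ae_all_iff.2 fun K => hN.hasPoissonLaplace.ae_finite_mem
      (measurableSet_le p.measurable_invPower measurable_const) (p.intensity_invPower_le_ne_top K)
  filter_upwards [hloc] with ω hω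
  obtain ⟨K, hK⟩ := exists_nat_ge (p.invPower (station X U h D 0 ω))
  obtain ⟨n, hn, hmin⟩ := Set.exists_min_image _ (fun n => p.invPower (station X U h D n ω))
    (hω K) ⟨0, hK⟩
  have hmem : ∀ m, p.invPower (station X U h D n ω) ≤ p.invPower (station X U h D m ω) := by
    intro m
    by_cases hm : p.invPower (station X U h D m ω) ≤ K
    · exact hmin m hm
    · exact le_trans hn (not_le.1 hm).le
  have hne : {n | ∀ m, p.avgPower X U m ω ≤ p.avgPower X U n ω}.Nonempty := by
    refine ⟨n, fun m => ?_⟩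
    exact (inv_le_inv₀ (p.pointPower_pos (station X U h D n ω))
      (p.pointPower_pos (station X U h D m ω))).1 (hmem m)
  intro m
  exact (inv_le_inv₀ (p.pointPower_pos _) (p.pointPower_pos _)).2 (Nat.sInf_mem hne m)

/-- The fading of the station `n` is independent of the positions and of all marks once the fading
of index `n` is erased from them. -/
lemma indepFun_fading [IsProbabilityMeasure P] (hN : IsNetwork P p X U h D) (n : ℕ) :
    P.map (h n) = expMeasure p.mu ∧ IndepFun (h n) (fun ω => ((fun m => X m ω),
      fun m => (U m ω, if m = n then 0 else h m ω, D m ω))) P := by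
  have mM : ∀ m, Measurable fun ω => (U m ω, h m ω, D m ω) := fun m =>
    (hN.measurable_U m).prodMk ((hN.measurable_h m).prodMk (hN.measurable_D m))
  have mX : Measurable fun ω m => X m ω := measurable_pi_iff.2 hN.poisson.measurable
  have mUD : Measurable fun ω => (U n ω, D n ω) := (hN.measurable_U n).prodMk (hN.measurable_D n)
  have mR : Measurable fun ω (i : {i // i ≠ n}) => (U i ω, h i ω, D i ω) :=
    measurable_pi_iff.2 fun i => mM i
  obtain ⟨hU, -, hhD⟩ := indepFun_of_map_eq_prod (hN.measurable_U n)
    ((hN.measurable_h n).prodMk (hN.measurable_D n)) (hN.mark_law n)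
  obtain ⟨hhD', hh, -⟩ := indepFun_of_map_eq_prod (hN.measurable_h n) (hN.measurable_D n) hhD
  refine ⟨hh, ?_⟩
  have i1 : IndepFun (h n) (fun ω => (U n ω, D n ω)) P :=
    indepFun_prodMk_of_indepFun (hN.measurable_U n) (hN.measurable_h n) (hN.measurable_D n) hU hhD'
  have i2 : IndepFun (h n) (fun ω => ((fun i : {i // i ≠ n} => (U i ω, h i ω, D i ω)),
      (U n ω, D n ω))) P := by
    refine indepFun_prodMk_of_indepFun mR (hN.measurable_h n) mUD ?_ i1
    exact (iIndepFun.indepFun_compl hN.mark_indep mM n).symm.comp (φ := id)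
      (ψ := fun m : ℝ × ℝ × ℝ => (m.2.1, (m.1, m.2.2))) measurable_id (by fun_prop)
  have i3 : IndepFun (h n) (fun ω => ((fun m => X m ω),
      ((fun i : {i // i ≠ n} => (U i ω, h i ω, D i ω)), (U n ω, D n ω)))) P := by
    refine indepFun_prodMk_of_indepFun mX (hN.measurable_h n) (mR.prodMk mUD) ?_ i2
    exact hN.indep.comp (φ := id) (ψ := fun m : ℕ → ℝ × ℝ × ℝ =>
      ((m n).2.1, ((fun i : {i // i ≠ n} => m i), ((m n).1, (m n).2.2)))) measurable_id
      (by fun_prop)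
  have mg : Measurable fun a : (ℕ → ℝ) × ({i // i ≠ n} → ℝ × ℝ × ℝ) × (ℝ × ℝ) =>
      (a.1, fun m => if hm : m = n then (a.2.2.1, 0, a.2.2.2) else a.2.1 ⟨m, hm⟩) := by
    refine measurable_fst.prodMk (measurable_pi_iff.2 fun m => ?_)
    by_cases hm : m = n
    · simp only [hm, dite_true]; fun_prop
    · simp only [hm, dite_false]; fun_prop
  have hcomp := i3.comp measurable_id mg
  refine hcomp.congr Filter.EventuallyEq.rfl (Filter.Eventually.of_forall fun ω =>
    Prod.ext rfl ?_)
  funext m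
  by_cases hm : m = n
  · simp [hm]
  · simp [hm]

end IsNetwork

/-! ### The coverage event -/

namespace Params

variable (p : Params)

lemma Delta1_pos : 0 < p.Delta1 := mul_pos p.Gb_pos p.Gv_pos

/-- The argument of the Laplace functionals in the coverage probability, as a function of the
inverse path loss of the serving base station. -/
def covRate (Γ t : ℝ) : ℝ≥0 := (p.mu * Γ / p.Delta1 * t).toNNReal

lemma continuous_covRate (Γ : ℝ) : Continuous (p.covRate Γ) :=
  continuous_real_toNNReal.comp (continuous_const.mul continuous_id)

lemma covRate_inv_pathLoss {Γ : ℝ} (hΓ : 0 < Γ) (i : LinkState) {r : ℝ} (hr : 0 < r) :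
    (p.covRate Γ (p.pathLoss i r)⁻¹ : ℝ) = p.laplaceArg i Γ r := by
  have h1 := p.mu_pos
  have h2 := p.Delta1_pos
  have h3 := p.C_pos i
  have h4 := p.pathLoss_pos i hr
  rw [covRate, Real.coe_toNNReal _ (by positivity), p.inv_pathLoss i hr, laplaceArg]
  field_simp

/-- The fading threshold above which the vehicle is covered, for given data of the serving base
station `z` and given interference `I`. -/
def fadingThreshold (Γ : ℝ) (z : ℝ × ℝ × ℝ × ℝ) (I : ℝ≥0∞) : ℝ≥0∞ :=
  ENNReal.ofReal (Γ / p.Delta1 * p.invPower z) * (I + ENNReal.ofReal p.noise)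

/-- The coverage condition is a threshold for the fading `x`. It includes infinite interference,
when both sides are false. -/
lemma lt_sinr_iff {Γ : ℝ} (hΓ : 0 < Γ) (z : ℝ × ℝ × ℝ × ℝ) (x : ℝ) (I : ℝ≥0∞) :
    ENNReal.ofReal Γ < ENNReal.ofReal (x * p.Delta1 * p.pointPower z) /
      (I + ENNReal.ofReal p.noise) ↔ p.fadingThreshold Γ z I < ENNReal.ofReal x := by
  have hD := p.Delta1_pos
  have hl := p.pointPower_pos z
  have hn := p.noise_pos
  have hT : 0 < p.invPower z := inv_pos.2 hl
  rcases eq_or_ne I ∞ with rfl | hI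
  · have : ENNReal.ofReal (Γ / p.Delta1 * p.invPower z) ≠ 0 :=
      (ENNReal.ofReal_pos.2 (by positivity)).ne'
    simp [fadingThreshold, ENNReal.mul_top this]
  lift I to ℝ≥0 using hI
  have hS : (I : ℝ≥0∞) + ENNReal.ofReal p.noise = ENNReal.ofReal (I + p.noise) := by
    rw [ENNReal.ofReal_add NNReal.zero_le_coe hn.le, ENNReal.ofReal_coe_nnreal]
  have hs : (0 : ℝ) < I + p.noise := add_pos_of_nonneg_of_pos I.2 hn
  rw [fadingThreshold, hS, ENNReal.lt_div_iff_mul_lt (Or.inl (ENNReal.ofReal_pos.2 hs).ne')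
    (Or.inl ENNReal.ofReal_ne_top), ← ENNReal.ofReal_mul hΓ.le,
    ← ENNReal.ofReal_mul (by positivity),
    ENNReal.ofReal_lt_ofReal_iff_of_nonneg (by positivity),
    ENNReal.ofReal_lt_ofReal_iff_of_nonneg (by positivity), invPower,
    show Γ / p.Delta1 * (p.pointPower z)⁻¹ * (I + p.noise) =
      Γ * (I + p.noise) / (p.Delta1 * p.pointPower z) by field_simp,
    div_lt_iff₀ (by positivity), mul_assoc x]

lemma mu_mul_fadingThreshold (Γ : ℝ) (z : ℝ × ℝ × ℝ × ℝ) (I : ℝ≥0∞) :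
    ENNReal.ofReal p.mu * p.fadingThreshold Γ z I =
      p.covRate Γ (p.invPower z) * (I + ENNReal.ofReal p.noise) := by
  rw [fadingThreshold, ← mul_assoc, ← ENNReal.ofReal_mul p.mu_pos.le, covRate, ENNReal.ofReal,
    show p.mu * (Γ / p.Delta1 * p.invPower z) = p.mu * Γ / p.Delta1 * p.invPower z by ring]

end Params

lemma measurable_sumOthers {Ω E : Type*} [MeasurableSpace Ω] [MeasurableSpace E] {y : E → ℝ≥0∞}
    (hy : Measurable y) {z : Ω → ℕ → E} (hz : ∀ n, Measurable fun ω => z ω n) (n : ℕ) :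
    Measurable fun ω => sumOthers y (z ω) n :=
  Measurable.tsum fun m => by
    by_cases hm : m = n
    · simp only [hm, ne_eq, not_true_eq_false, if_false]; exact measurable_const
    · simp only [ne_eq, hm, not_false_eq_true, if_true]; exact hy.comp (hz m)

namespace IsNetwork

variable {Ω : Type*} [MeasurableSpace Ω] {P : Measure Ω} {p : Params}
  {X U h D : ℕ → Ω → ℝ}

/-- Averaging over the fading of the serving base station, which is independent of its index, of
its path loss and of the interference. -/
lemma measure_coverage_eq [IsProbabilityMeasure P] (hN : IsNetwork P p X U h D) {Γ : ℝ}
    (hΓ : 0 < Γ) :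
    P {ω | ENNReal.ofReal Γ < p.sinr X U h D ω} = ∫⁻ ω, expNeg (p.covRate Γ (p.invPower
      (station X U h D (p.serving X U ω) ω)) * (sumOthers (p.received univ)
        (fun m => station X U h D m ω) (p.serving X U ω) + ENNReal.ofReal p.noise)) ∂P := by
  let κ : Ω → ℕ → ℝ≥0∞ := fun ω n => p.fadingThreshold Γ (station X U h D n ω)
    (sumOthers (p.received univ) (fun m => station X U h D m ω) n)
  have hset : {ω | ENNReal.ofReal Γ < p.sinr X U h D ω} =
      {ω | κ ω (p.serving X U ω) < ENNReal.ofReal (h (p.serving X U ω) ω)} := by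
    ext ω
    change ENNReal.ofReal Γ < p.sinr X U h D ω ↔ _
    rw [Params.sinr, p.interference_add]
    exact p.lt_sinr_iff hΓ (station X U h D (p.serving X U ω) ω) _ _
  have mst := hN.hasPoissonLaplace.measurable
  have mκ : ∀ n, Measurable fun ω => κ ω n := fun n =>
    (Measurable.ennreal_ofReal ((p.measurable_invPower.comp (mst n)).const_mul _)).mul
      ((measurable_sumOthers (p.measurable_received univ) mst n).add_const _)
  have mserv := hN.measurable_serving
  have mB : ∀ n, MeasurableSet {ω | p.serving X U ω = n} := fun n =>
    mserv (measurableSet_singleton n)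
  have mE : ∀ n, MeasurableSet {ω | κ ω n < ENNReal.ofReal (h n ω)} := fun n =>
    measurableSet_lt (mκ n) (hN.measurable_h n).ennreal_ofReal
  -- the computation on the event that the station `n` serves
  have key : ∀ n, P ({ω | p.serving X U ω = n} ∩ {ω | κ ω n < ENNReal.ofReal (h n ω)}) =
      ∫⁻ ω in {ω | p.serving X U ω = n}, expNeg (ENNReal.ofReal p.mu * κ ω n) ∂P := by
    intro n
    obtain ⟨hlaw, hind⟩ := hN.indepFun_fading n
    let V : Ω → (ℕ → ℝ) × (ℕ → ℝ × ℝ × ℝ) := fun ω =>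
      ((fun m => X m ω), fun m => (U m ω, if m = n then 0 else h m ω, D m ω))
    let N' : (ℕ → ℝ) × (ℕ → ℝ × ℝ × ℝ) → ℕ :=
      p.serving (fun m v => v.1 m) (fun m v => (v.2 m).1)
    let κ' : (ℕ → ℝ) × (ℕ → ℝ × ℝ × ℝ) → ℝ≥0∞ := fun v =>
      p.fadingThreshold Γ (v.1 n, v.2 n) (sumOthers (p.received univ) (fun m => (v.1 m, v.2 m)) n)
    have hN' : ∀ ω, N' (V ω) = p.serving X U ω := fun ω => rfl
    have hκ' : ∀ ω, κ' (V ω) = κ ω n := fun ω => by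
      have : sumOthers (p.received univ) (fun m => ((V ω).1 m, (V ω).2 m)) n =
          sumOthers (p.received univ) (fun m => station X U h D m ω) n := by
        refine tsum_congr fun m => ?_
        by_cases hm : m = n
        · simp [hm]
        · simp [hm, V, station]
      simp only [κ', κ, this]
      rfl
    have mV : Measurable V := by
      refine (measurable_pi_iff.2 hN.poisson.measurable).prodMk (measurable_pi_iff.2 fun m => ?_)
      refine (hN.measurable_U m).prodMk (Measurable.prodMk ?_ (hN.measurable_D m))
      split_ifs
      · exact measurable_const
      · exact hN.measurable_h m
    have mN' : Measurable N' := p.measurable_serving (fun m => by fun_prop) (fun m => by fun_prop)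
    have mκ' : Measurable κ' :=
      (Measurable.ennreal_ofReal ((p.measurable_invPower.comp (by fun_prop)).const_mul _)).mul
        ((measurable_sumOthers (p.measurable_received univ) (fun m => by fun_prop) n).add_const _)
    have mA : MeasurableSet {v | N' v = n} := mN' (measurableSet_singleton n)
    have mF : MeasurableSet {a : ((ℕ → ℝ) × (ℕ → ℝ × ℝ × ℝ)) × ℝ |
        N' a.1 = n ∧ κ' a.1 < ENNReal.ofReal a.2} :=
      (measurable_fst mA).inter (measurableSet_lt (mκ'.comp measurable_fst)
        measurable_snd.ennreal_ofReal)
    have hmain := lintegral_eq_of_indepFun (hN.measurable_h n) mV hind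
      (measurable_one.indicator mF)
    rw [hlaw] at hmain
    rw [← lintegral_indicator_one ((mB n).inter (mE n)), ← lintegral_indicator (mB n)]
    refine Eq.trans (lintegral_congr fun ω => ?_) (hmain.trans (lintegral_congr fun ω => ?_))
    · refine Set.indicator_eq_indicator ?_ rfl
      change (p.serving X U ω = n ∧ κ ω n < _) ↔ (N' (V ω) = n ∧ κ' (V ω) < _)
      rw [hN', hκ']
    · by_cases hω : p.serving X U ω = n
      · rw [Set.indicator_of_mem (s := {ω | p.serving X U ω = n}) hω, ← expMeasure_tail p.mu_pos,
          ← lintegral_indicator_one (measurableSet_lt measurable_const ENNReal.measurable_ofReal)]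
        refine lintegral_congr fun x => Set.indicator_eq_indicator ?_ rfl
        change (N' (V ω) = n ∧ κ' (V ω) < _) ↔ κ ω n < _
        rw [hN', hκ', and_iff_right hω]
      · rw [Set.indicator_of_notMem (s := {ω | p.serving X U ω = n}) hω]
        refine (lintegral_congr fun x => Set.indicator_of_notMem ?_ _).trans lintegral_zero
        exact fun hmem => hω hmem.1
  have hdisj : Pairwise (Function.onFun Disjoint fun n => {ω | p.serving X U ω = n}) :=
    fun n n' hnn => Set.disjoint_left.2 fun ω h1 h2 => hnn (h1.symm.trans h2)
  have hcover : (⋃ n, {ω | p.serving X U ω = n}) = univ := by ext; simp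
  have hset' : {ω | κ ω (p.serving X U ω) < ENNReal.ofReal (h (p.serving X U ω) ω)} =
      ⋃ n, {ω | p.serving X U ω = n} ∩ {ω | κ ω n < ENNReal.ofReal (h n ω)} := by
    ext ω
    simp
  rw [hset, hset', measure_iUnion (fun n n' hnn => (hdisj hnn).mono inter_subset_left
    inter_subset_left) (fun n => (mB n).inter (mE n)), ← setLIntegral_univ, ← hcover,
    lintegral_iUnion mB hdisj]
  refine tsum_congr fun n => ?_
  rw [key n]
  refine setLIntegral_congr_fun (mB n) fun ω (hω : p.serving X U ω = n) => ?_
  simp only [κ]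
  rw [hω, p.mu_mul_fadingThreshold]

end IsNetwork

/-! ### Change of variables to the distance of the serving base station -/

namespace Params

variable (p : Params)

lemma b_pos {r : ℝ} (hr : p.W < r) : 0 < p.b r :=
  Real.sqrt_pos.2 (by nlinarith [p.W_pos])

lemma dist_b {r : ℝ} (hr : p.W ≤ r) : p.dist (p.b r) = r := by
  have hW := p.W_pos
  rw [dist, b, Real.sq_sqrt (by nlinarith), sub_add_cancel, Real.sqrt_sq (by linarith)]

lemma b_dist {x : ℝ} (hx : 0 ≤ x) : p.b (p.dist x) = x := by
  rw [dist, b, Real.sq_sqrt (by positivity), add_sub_cancel_right, Real.sqrt_sq hx]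

lemma hasDerivAt_b {r : ℝ} (hr : p.W < r) : HasDerivAt p.b (r / p.b r) r := by
  have hpos : r ^ 2 - p.W ^ 2 ≠ 0 := (Real.sqrt_pos.1 (p.b_pos hr)).ne'
  have h := ((hasDerivAt_pow 2 r).sub_const (p.W ^ 2)).sqrt hpos
  refine h.congr_deriv ?_
  rw [b]
  simp only [Nat.cast_ofNat, Nat.add_one_sub_one, pow_one]
  rw [mul_div_mul_left _ _ two_ne_zero]

lemma f_eq (i : LinkState) {r : ℝ} (hr : p.W < r) :
    p.f i r = p.voidProb i r * (2 * p.lamb * (p.scenario.prob i (p.b r) * (r / p.b r))) := by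
  have hc := p.scenario.continuous_prob i
  have h1 : HasDerivAt (fun c => ∫ x in (0 : ℝ)..c, p.scenario.prob i x)
      (p.scenario.prob i (p.b r)) (p.b r) :=
    intervalIntegral.integral_hasDerivAt_right (hc.intervalIntegrable _ _)
      (hc.stronglyMeasurableAtFilter _ _) hc.continuousAt
  have h2 := ((((h1.comp r (p.hasDerivAt_b hr)).const_mul (2 * p.lamb)).neg).exp).const_sub 1
  have h3 : HasDerivAt (fun r' => 1 - p.voidProb i r') _ r := h2
  rw [f, h3.deriv, voidProb]
  simp only [Function.comp_apply, Pi.neg_apply]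
  ring

lemma voidProb_pos (i : LinkState) (r : ℝ) : 0 < p.voidProb i r := Real.exp_pos _

lemma laplace_pos (i j : LinkState) (r t : ℝ) : 0 < p.laplace i j r t := Real.exp_pos _

/-- The change of variables `x = b r`. -/
lemma lintegral_dist (i : LinkState) (H : ℝ → ℝ≥0∞) :
    ∫⁻ x in Ioi 0, ENNReal.ofReal (p.scenario.prob i x) * H (p.dist x) =
      ∫⁻ r in Ioi p.W, ENNReal.ofReal (r / p.b r) *
        (ENNReal.ofReal (p.scenario.prob i (p.b r)) * H r) := by
  have himage : p.b '' Ioi p.W = Ioi 0 := by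
    ext x
    constructor
    · rintro ⟨r, hr, rfl⟩
      exact p.b_pos hr
    · intro (hx : 0 < x)
      refine ⟨p.dist x, ?_, p.b_dist hx.le⟩
      exact Real.lt_sqrt_of_sq_lt (by nlinarith)
  have hinj : InjOn p.b (Ioi p.W) := fun r hr s hs hrs => by
    rw [← p.dist_b (le_of_lt hr), hrs, p.dist_b (le_of_lt hs)]
  rw [← himage, lintegral_image_eq_lintegral_abs_deriv_mul measurableSet_Ioi
    (fun r hr => (p.hasDerivAt_b hr).hasDerivWithinAt) hinj]
  refine setLIntegral_congr_fun measurableSet_Ioi fun r (hr : p.W < r) => ?_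
  have hr0 := p.W_pos.trans hr
  simp only [p.dist_b hr.le]
  rw [abs_of_pos (div_pos hr0 (p.b_pos hr))]

/-- The product of `expNeg_barrier` when both states interfere, regrouped into the factors of the
coverage integrand. -/
lemma prod_void_mul_laplace (i : LinkState) (r t : ℝ) :
    ∏ j, (ENNReal.ofReal (p.voidProb j (p.exclusion i j r)) *
      ENNReal.ofReal (p.laplace i j r t)) =
    ENNReal.ofReal (p.voidProb i r * p.voidProb i.other (p.A i r) *
      (p.laplace i .los r t * p.laplace i .nlos r t)) := by
  have hv := fun j ρ => (p.voidProb_pos j ρ).le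
  have hl := fun j => (p.laplace_pos i j r t).le
  simp only [← ENNReal.ofReal_mul (hv _ _)]
  rw [LinkState.prod_eq, ← ENNReal.ofReal_mul (mul_nonneg (hv _ _) (hl _))]
  congr 1
  cases i <;> simp only [exclusion, LinkState.other, if_true, reduceCtorEq, if_false] <;> ring

end Params

namespace Params

variable (p : Params)

/-- The expected number of base stations of state `i` per unit of distance, at distance `r`. -/
def distDensity (i : LinkState) (r : ℝ) : ℝ :=
  2 * p.lamb * (p.scenario.prob i (p.b r) * (r / p.b r))

lemma distDensity_nonneg (i : LinkState) {r : ℝ} (hr : p.W < r) : 0 ≤ p.distDensity i r := by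
  have h1 := p.lamb_pos
  have h2 := p.scenario.prob_nonneg i (p.b_pos hr).le
  have h3 := p.b_pos hr
  have h4 := p.W_pos.trans hr
  unfold distDensity
  positivity

lemma measurable_distDensity (i : LinkState) : Measurable (p.distDensity i) := by
  have hb : Measurable p.b := by unfold b; fun_prop
  exact (((p.scenario.continuous_prob i).measurable.comp hb).mul
    (measurable_id.div hb)).const_mul _

lemma lintegral_intensity_dist {H : LinkState → ℝ → ℝ≥0∞} (hH : ∀ i, Measurable (H i)) :
    ∫⁻ z, H (p.pointState z) (p.dist z.1) ∂p.intensity =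
      ∑ i, ∫⁻ r in Ioi p.W, ENNReal.ofReal (p.distDensity i r) * H i r := by
  refine (p.lintegral_intensity (ψ := fun i x _ => H i (p.dist x))
    (fun i => (hH i).comp (p.measurable_dist.comp measurable_fst))
    (fun i x m => by simp only [dist_neg])).trans (Finset.sum_congr rfl fun i _ => ?_)
  simp only [lintegral_const, measure_univ, mul_one]
  rw [p.lintegral_dist i (H i), ← lintegral_const_mul' _ _ ENNReal.ofReal_ne_top]
  refine setLIntegral_congr_fun measurableSet_Ioi fun r (hr : p.W < r) => ?_
  have h1 := p.lamb_pos
  have h2 := p.scenario.prob_nonneg i (p.b_pos hr).le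
  simp only [distDensity]
  rw [ENNReal.ofReal_mul (p := 2 * p.lamb) (by positivity), ENNReal.ofReal_mul h2]
  ring

/-- The probability, by `HasPoissonLaplace.lintegral_first`, that no station precedes one of
inverse path loss `t`, weighted by the Laplace transform, at `q t`, of the power received from the
stations of states in `S` beyond it. -/
def firstWeight (S : Set LinkState) (q : ℝ → ℝ≥0) (t : ℝ) : ℝ≥0∞ :=
  expNeg (∫⁻ z, 1 - expNeg (barrier p.invPower q (p.received S) t z) ∂p.intensity)

lemma measurable_firstWeight (S : Set LinkState) {q : ℝ → ℝ≥0} (hq : Continuous q) :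
    Measurable (p.firstWeight S q) :=
  (continuous_lintegral_barrier p.measurable_invPower p.intensity_invPower_le_ne_top
    p.intensity_invPower_eq hq (p.measurable_received S)
    (p.lintegral_received_ne_top S)).measurable.expNeg

lemma covIntegrand_nonneg (i : LinkState) (Γ : ℝ) {r : ℝ} (hr : p.W < r) :
    0 ≤ p.covIntegrand i Γ r := by
  have h1 := p.distDensity_nonneg i hr
  have h2 := p.voidProb_pos i r
  have h3 := p.voidProb_pos i.other (p.A i r)
  have h4 := p.laplace_pos i .los r (p.laplaceArg i Γ r)
  have h5 := p.laplace_pos i .nlos r (p.laplaceArg i Γ r)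
  rw [covIntegrand, fbar, p.f_eq i hr, ← distDensity]
  positivity

lemma ofReal_covIntegrand (i : LinkState) {Γ : ℝ} (hΓ : 0 < Γ) {r : ℝ} (hr : p.W < r) :
    ENNReal.ofReal (p.distDensity i r) *
      (expNeg (p.covRate Γ (p.pathLoss i r)⁻¹ * ENNReal.ofReal p.noise) *
        p.firstWeight univ (p.covRate Γ) (p.pathLoss i r)⁻¹) =
      ENNReal.ofReal (p.covIntegrand i Γ r) := by
  have hr0 := p.W_pos.trans hr
  have hd := p.distDensity_nonneg i hr
  have hn := p.noise_pos
  rw [firstWeight, p.expNeg_barrier univ _ i hr0]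
  simp only [mem_univ, if_true]
  rw [p.prod_void_mul_laplace, p.covRate_inv_pathLoss hΓ i hr0, ← ENNReal.ofReal_coe_nnreal,
    p.covRate_inv_pathLoss hΓ i hr0]
  have hq : 0 ≤ p.laplaceArg i Γ r := p.covRate_inv_pathLoss hΓ i hr0 ▸ NNReal.zero_le_coe
  rw [← ENNReal.ofReal_mul hq, expNeg_ofReal (by positivity), ← ENNReal.ofReal_mul (by positivity),
    ← ENNReal.ofReal_mul hd, covIntegrand, fbar, p.f_eq i hr, ← distDensity,
    show -p.mu * p.noise * Γ * r ^ p.alpha i / (p.Delta1 * p.C i) =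
      -(p.laplaceArg i Γ r * p.noise) by rw [laplaceArg]; ring]
  congr 1
  ring

end Params

namespace IsNetwork

variable {Ω : Type*} [MeasurableSpace Ω] {P : Measure Ω} {p : Params}
  {X U h D : ℕ → Ω → ℝ}

/-- `HasPoissonLaplace.lintegral_first` for the serving station, as an integral over its
distance. -/
lemma lintegral_serving [IsProbabilityMeasure P] (hN : IsNetwork P p X U h D) (S : Set LinkState)
    {q : ℝ → ℝ≥0} (hq : Continuous q) {φ : LinkState → ℝ → ℝ≥0∞} (hφ : ∀ i, Measurable (φ i)) :
    ∫⁻ ω, φ (p.servingState X U ω) (p.servingDist X U ω) *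
      expNeg (q (p.invPower (station X U h D (p.serving X U ω) ω)) *
        sumOthers (p.received S) (fun m => station X U h D m ω) (p.serving X U ω)) ∂P =
    ∑ i, ∫⁻ r in Ioi p.W, ENNReal.ofReal (p.distDensity i r) *
      (φ i r * p.firstWeight S q (p.pathLoss i r)⁻¹) := by
  have hφm : Measurable fun z : ℝ × ℝ × ℝ × ℝ => φ (p.pointState z) (p.dist z.1) :=
    measurable_linkState_apply (ψ := fun i (z : ℝ × ℝ × ℝ × ℝ) => φ i (p.dist z.1))
      (fun i => (hφ i).comp (p.measurable_dist.comp measurable_fst)) p.measurable_pointState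
  refine (hN.hasPoissonLaplace.lintegral_first p.measurable_invPower
    p.intensity_invPower_le_ne_top p.intensity_invPower_eq hq (p.measurable_received S)
    (p.lintegral_received_ne_top S) hN.measurable_serving hN.ae_serving_min hφm).trans ?_
  exact p.lintegral_intensity_dist (H := fun i r => φ i r * p.firstWeight S q (p.pathLoss i r)⁻¹)
    fun i => (hφ i).mul ((p.measurable_firstWeight S hq).comp (p.measurable_pathLoss i).inv)

lemma measure_coverage [IsProbabilityMeasure P] (hN : IsNetwork P p X U h D) {Γ : ℝ}
    (hΓ : 0 < Γ) :
    P {ω | ENNReal.ofReal Γ < p.sinr X U h D ω} =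
      ∑ i, ∫⁻ r in Ioi p.W, ENNReal.ofReal (p.covIntegrand i Γ r) := by
  have hq := p.continuous_covRate Γ
  have hφ : ∀ i, Measurable fun r =>
      expNeg (p.covRate Γ (p.pathLoss i r)⁻¹ * ENNReal.ofReal p.noise) := fun i => by
    have := hq.measurable.comp (p.measurable_pathLoss i).inv
    exact (this.coe_nnreal_ennreal.mul_const _).expNeg
  rw [hN.measure_coverage_eq hΓ]
  simp only [mul_add, expNeg_add, mul_comm (expNeg (_ * sumOthers _ _ _))]
  refine (hN.lintegral_serving univ hq hφ).trans (Finset.sum_congr rfl fun i _ => ?_)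
  exact setLIntegral_congr_fun measurableSet_Ioi fun r hr => p.ofReal_covIntegrand i hΓ hr

/-- Both integrands are nonnegative, and their integrals add up to a probability. -/
lemma integrableOn_covIntegrand [IsProbabilityMeasure P] (hN : IsNetwork P p X U h D) {Γ : ℝ}
    (hΓ : 0 < Γ) (i : LinkState) : IntegrableOn (p.covIntegrand i Γ) (Ioi p.W) := by
  have hnn : 0 ≤ᵐ[volume.restrict (Ioi p.W)] p.covIntegrand i Γ :=
    (ae_restrict_mem measurableSet_Ioi).mono fun r hr => p.covIntegrand_nonneg i Γ hr
  have hq := p.continuous_covRate Γ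
  have hm : Measurable fun r => ENNReal.ofReal (p.distDensity i r) *
      (expNeg (p.covRate Γ (p.pathLoss i r)⁻¹ * ENNReal.ofReal p.noise) *
        p.firstWeight univ (p.covRate Γ) (p.pathLoss i r)⁻¹) := by
    have h1 := hq.measurable.comp (p.measurable_pathLoss i).inv
    have h2 := (p.measurable_firstWeight univ hq).comp (p.measurable_pathLoss i).inv
    exact (p.measurable_distDensity i).ennreal_ofReal.mul
      ((h1.coe_nnreal_ennreal.mul_const _).expNeg.mul h2)
  have hmeas : AEStronglyMeasurable (p.covIntegrand i Γ) (volume.restrict (Ioi p.W)) := by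
    refine hm.ennreal_toReal.aestronglyMeasurable.congr
      ((ae_restrict_mem measurableSet_Ioi).mono fun r hr => ?_)
    simp only [p.ofReal_covIntegrand i hΓ hr]
    exact ENNReal.toReal_ofReal (p.covIntegrand_nonneg i Γ hr)
  refine ⟨hmeas, (hasFiniteIntegral_iff_ofReal hnn).2 (lt_top_iff_ne_top.2 ?_)⟩
  have hsum : ∑ i, ∫⁻ r in Ioi p.W, ENNReal.ofReal (p.covIntegrand i Γ r) ≠ ∞ :=
    hN.measure_coverage hΓ ▸ measure_ne_top P _
  exact ENNReal.sum_ne_top.1 hsum i (Finset.mem_univ i)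

lemma measureReal_coverage [IsProbabilityMeasure P] (hN : IsNetwork P p X U h D) {Γ : ℝ}
    (hΓ : 0 < Γ) :
    P.real {ω | ENNReal.ofReal Γ < p.sinr X U h D ω} =
      ∑ i, ∫ r in Ioi p.W, p.covIntegrand i Γ r := by
  have hnn : ∀ i, 0 ≤ᵐ[volume.restrict (Ioi p.W)] p.covIntegrand i Γ := fun i =>
    (ae_restrict_mem measurableSet_Ioi).mono fun r hr => p.covIntegrand_nonneg i Γ hr
  have h := hN.measure_coverage hΓ
  simp only [← ofReal_integral_eq_lintegral_ofReal (hN.integrableOn_covIntegrand hΓ _) (hnn _)] at h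
  rw [measureReal_def, h, ← ENNReal.ofReal_sum_of_nonneg fun i _ => integral_nonneg_of_ae (hnn i),
    ENNReal.toReal_ofReal (Finset.sum_nonneg fun i _ => integral_nonneg_of_ae (hnn i))]

end IsNetwork

/-! ### The conditional Laplace functional of the interference -/

namespace Params

variable (p : Params)

/-- The weights of the first point with and without the interference from the stations of state
`j` differ by the Laplace functional of the latter. -/
lemma firstWeight_singleton (i j : LinkState) {r : ℝ} (hr : 0 < r) (t : ℝ≥0) :
    p.firstWeight {j} (fun _ => t) (p.pathLoss i r)⁻¹ =
      ENNReal.ofReal (p.laplace i j r t) * p.firstWeight ∅ (fun _ => t) (p.pathLoss i r)⁻¹ := by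
  rw [firstWeight, firstWeight, p.expNeg_barrier {j} _ i hr, p.expNeg_barrier ∅ _ i hr]
  simp only [mem_singleton_iff, mem_empty_iff_false, if_false, mul_one, Finset.prod_mul_distrib,
    Finset.prod_ite_eq', Finset.mem_univ, if_true]
  rw [mul_comm]

lemma firstWeight_empty_ne_zero (i : LinkState) {r : ℝ} (hr : 0 < r) (q : ℝ → ℝ≥0) :
    p.firstWeight ∅ q (p.pathLoss i r)⁻¹ ≠ 0 := by
  rw [firstWeight, p.expNeg_barrier ∅ _ i hr]
  simp only [mem_empty_iff_false, if_false, mul_one]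
  exact Finset.prod_ne_zero_iff.2 fun j _ => (ENNReal.ofReal_pos.2 (p.voidProb_pos j _)).ne'

/-- The Laplace functional of the interference is a measurable function of the distance of the
serving station, being a quotient of two continuous functions of its path loss. -/
lemma measurable_laplace_indicator (i j : LinkState) {t : ℝ} (ht : 0 ≤ t) :
    Measurable ((Ioi 0).indicator fun r => p.laplace i j r t) := by
  lift t to ℝ≥0 using ht
  have hm : ∀ S, Measurable fun r => p.firstWeight S (fun _ => t) (p.pathLoss i r)⁻¹ := fun S =>
    (p.measurable_firstWeight S continuous_const).comp (p.measurable_pathLoss i).inv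
  have h := ((hm {j}).div (hm ∅)).ennreal_toReal.indicator (measurableSet_Ioi (a := (0 : ℝ)))
  convert h using 1
  refine Set.indicator_congr fun r hr => Eq.symm ?_
  change ((p.firstWeight {j} (fun _ => t) (p.pathLoss i r)⁻¹) /
    (p.firstWeight ∅ (fun _ => t) (p.pathLoss i r)⁻¹)).toReal = _
  rw [p.firstWeight_singleton i j hr, ENNReal.mul_div_cancel_right
    (p.firstWeight_empty_ne_zero i hr _) (expNeg_ne_top _),
    ENNReal.toReal_ofReal (p.laplace_pos i j r t).le]

lemma received_empty : p.received ∅ = 0 := funext fun _ => p.received_of_notMem (notMem_empty _)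

end Params

namespace IsNetwork

variable {Ω : Type*} [MeasurableSpace Ω] {P : Measure Ω} {p : Params}
  {X U h D : ℕ → Ω → ℝ}

lemma measurable_servingState_servingDist (hN : IsNetwork P p X U h D) :
    Measurable fun ω => (p.servingState X U ω, p.servingDist X U ω) := by
  have mst : ∀ n, Measurable (station X U h D n) := fun n =>
    (hN.poisson.measurable n).prodMk
      ((hN.measurable_U n).prodMk ((hN.measurable_h n).prodMk (hN.measurable_D n)))
  have h := measurable_apply_index mst hN.measurable_serving
  exact (p.measurable_pointState.comp h).prodMk (p.measurable_dist.comp h.fst)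

/-- The characterization of the conditional Laplace functional, in terms of `[0, ∞]`-valued
integrals. -/
lemma lintegral_laplace [IsProbabilityMeasure P] (hN : IsNetwork P p X U h D) (j : LinkState)
    (t : ℝ≥0) {φ : LinkState → ℝ → ℝ≥0∞} (hφ : ∀ i, Measurable (φ i)) :
    ∫⁻ ω, φ (p.servingState X U ω) (p.servingDist X U ω) *
      expNeg (t * p.interference X U h D j ω) ∂P =
    ∫⁻ ω, φ (p.servingState X U ω) (p.servingDist X U ω) *
      ENNReal.ofReal (p.laplace (p.servingState X U ω) j (p.servingDist X U ω) t) ∂P := by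
  have h1 := hN.lintegral_serving {j} (q := fun _ => t) continuous_const hφ
  have h2 := hN.lintegral_serving ∅ (q := fun _ => t) continuous_const
    (φ := fun i r => φ i r * ENNReal.ofReal ((Ioi 0).indicator (fun r => p.laplace i j r t) r))
    fun i => (hφ i).mul (p.measurable_laplace_indicator i j t.2).ennreal_ofReal
  simp only [p.interference_eq]
  rw [h1]
  refine Eq.trans (Finset.sum_congr rfl fun i _ => ?_) (h2.symm.trans ?_)
  · refine setLIntegral_congr_fun measurableSet_Ioi fun r (hr : p.W < r) => ?_
    have hr0 : 0 < r := p.W_pos.trans hr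
    simp only [p.firstWeight_singleton i j hr0, Set.indicator_of_mem (mem_Ioi.2 hr0), mul_assoc]
  · refine lintegral_congr fun ω => ?_
    have hpos : p.servingDist X U ω ∈ Ioi 0 := p.dist_pos _
    simp [sumOthers, Set.indicator_of_mem hpos, Params.received_empty]

/-- The conditional Laplace functional of the interference, on the whole probability space: the two
sides have the same integrals over the events of the conditioning σ-algebra, which are given by the
state and the distance of the serving station. -/
lemma condExp_laplace [IsProbabilityMeasure P] (hN : IsNetwork P p X U h D) (j : LinkState)
    {t : ℝ} (ht : 0 ≤ t) :
    P[fun ω => Real.exp (-(t * (p.interference X U h D j ω).toReal)) | p.servingSigma X U]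
      =ᵐ[P] fun ω => p.laplace (p.servingState X U ω) j (p.servingDist X U ω) t := by
  have hser := hN.measurable_servingState_servingDist
  have hm : p.servingSigma X U ≤ ‹MeasurableSpace Ω› := hser.comap_le
  lift t to ℝ≥0 using ht
  have mst := hN.hasPoissonLaplace.measurable
  have mI : Measurable (p.interference X U h D j) := by
    rw [show p.interference X U h D j = _ from funext (p.interference_eq X U h D j)]
    exact measurable_apply_index (Z := fun n ω => sumOthers (p.received {j})
      (fun m => station X U h D m ω) n)
      (measurable_sumOthers (p.measurable_received {j}) mst) hN.measurable_serving
  have hfin : ∀ᵐ ω ∂P, p.interference X U h D j ω ≠ ∞ := by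
    filter_upwards [hN.hasPoissonLaplace.ae_tsum_ne_top (p.measurable_received {j})
      (p.lintegral_received_ne_top {j})] with ω hω
    rw [p.interference_eq]
    exact ne_top_of_le_ne_top hω (sumOthers_le _ _ _)
  have mf : Measurable fun ω => Real.exp (-(t * (p.interference X U h D j ω).toReal)) := by
    fun_prop
  have mG : Measurable fun a : LinkState × ℝ =>
      (Ioi 0).indicator (fun r => p.laplace a.1 j r t) a.2 :=
    measurable_from_prod_countable_right fun i => p.measurable_laplace_indicator i j t.2
  have hG : (fun ω => p.laplace (p.servingState X U ω) j (p.servingDist X U ω) t) = fun ω =>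
      (Ioi 0).indicator (fun r => p.laplace (p.servingState X U ω) j r t)
        (p.servingDist X U ω) :=
    funext fun ω => (Set.indicator_of_mem (s := Ioi 0) (a := p.servingDist X U ω) (p.dist_pos _)
      fun r => p.laplace (p.servingState X U ω) j r t).symm
  have mg : Measurable[p.servingSigma X U] fun ω =>
      p.laplace (p.servingState X U ω) j (p.servingDist X U ω) t :=
    hG ▸ mG.comp (comap_measurable _)
  have hset : ∀ s, MeasurableSet[p.servingSigma X U] s →
      ∫⁻ ω in s, ENNReal.ofReal (Real.exp (-(t * (p.interference X U h D j ω).toReal))) ∂P =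
        ∫⁻ ω in s, ENNReal.ofReal
          (p.laplace (p.servingState X U ω) j (p.servingDist X U ω) t) ∂P := by
    rintro _ ⟨A, hA, rfl⟩
    have h := hN.lintegral_laplace j t (φ := fun i r => A.indicator 1 (i, r))
      fun i => (measurable_one.indicator hA).comp measurable_prodMk_left
    rw [← lintegral_indicator (hser hA), ← lintegral_indicator (hser hA)]
    refine Eq.trans (lintegral_congr_ae ?_) (h.trans (lintegral_congr fun ω => ?_))
    · filter_upwards [hfin] with ω hω
      by_cases hωA : (p.servingState X U ω, p.servingDist X U ω) ∈ A <;>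
        simp [Set.indicator, hωA, expNeg_eq_ofReal (ENNReal.mul_ne_top ENNReal.coe_ne_top hω)]
    · by_cases hωA : (p.servingState X U ω, p.servingDist X U ω) ∈ A <;>
        simp [Set.indicator, hωA]
  have hfnn : ∀ ω, 0 ≤ Real.exp (-(t * (p.interference X U h D j ω).toReal)) := fun ω =>
    (Real.exp_pos _).le
  have hgnn : ∀ ω, 0 ≤ p.laplace (p.servingState X U ω) j (p.servingDist X U ω) t := fun ω =>
    (p.laplace_pos _ _ _ _).le
  have hfint : Integrable (fun ω => Real.exp (-(t * (p.interference X U h D j ω).toReal))) P := by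
    refine Integrable.of_bound mf.aestronglyMeasurable 1 (Filter.Eventually.of_forall fun ω => ?_)
    rw [Real.norm_of_nonneg (hfnn ω), Real.exp_le_one_iff, neg_nonpos]
    positivity
  have hgint : Integrable
      (fun ω => p.laplace (p.servingState X U ω) j (p.servingDist X U ω) t) P := by
    refine ⟨(mg.mono hm le_rfl).aestronglyMeasurable, ?_⟩
    rw [hasFiniteIntegral_iff_ofReal (Filter.Eventually.of_forall hgnn), ← setLIntegral_univ,
      ← hset univ MeasurableSet.univ, setLIntegral_univ]
    exact hfint.lintegral_lt_top
  refine (ae_eq_condExp_of_forall_setIntegral_eq hm hfint (fun s _ _ => hgint.integrableOn)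
    (fun s hs _ => ?_) mg.aestronglyMeasurable).symm
  rw [integral_eq_lintegral_of_nonneg_ae (Filter.Eventually.of_forall hgnn)
    (mg.mono hm le_rfl).aestronglyMeasurable, integral_eq_lintegral_of_nonneg_ae
    (Filter.Eventually.of_forall hfnn) mf.aestronglyMeasurable, hset s hs]

end IsNetwork

/-- Coverage probability of the test vehicle. First part: given that the serving base station has
state `i` and lies at distance `r`, the Laplace functional of the interference from the base
stations of state `j` is `p.laplace i j r`. Second part: the coverage probability, whose
integrands are integrable. -/
theorem theorem1 {Ω : Type*} [MeasurableSpace Ω] (P : Measure Ω) [IsProbabilityMeasure P]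
    (p : Params) (X U h D : ℕ → Ω → ℝ) (hN : IsNetwork P p X U h D) :
    (∀ (i j : LinkState) (t : ℝ), 0 ≤ t →
      P[fun ω => Real.exp (-(t * (p.interference X U h D j ω).toReal)) | p.servingSigma X U]
        =ᵐ[P.restrict {ω | p.servingState X U ω = i}]
          fun ω => p.laplace i j (p.servingDist X U ω) t) ∧
    ∀ Γ : ℝ, 0 < Γ →
      (∀ i : LinkState, IntegrableOn (p.covIntegrand i Γ) (Ioi p.W)) ∧
      P.real {ω | ENNReal.ofReal Γ < p.sinr X U h D ω} =
        ∑ i : LinkState, ∫ r in Ioi p.W, p.covIntegrand i Γ r := by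
  refine ⟨fun i j t ht => ?_, fun Γ hΓ =>
    ⟨hN.integrableOn_covIntegrand hΓ, hN.measureReal_coverage hΓ⟩⟩
  have hi : MeasurableSet {ω | p.servingState X U ω = i} :=
    hN.measurable_servingState_servingDist.fst (measurableSet_singleton i)
  filter_upwards [ae_restrict_of_ae (hN.condExp_laplace j ht), ae_restrict_mem hi] with ω hω hωi
  rw [hω, show p.servingState X U ω = i from hωi]

end
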